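/- **Setting.** Let $L_2^n[\Omega]$ denote the square-integrable $\mathbb{R}^n$-valued functions on $\Omega$, and let $W_2^n[[0,1]^2]$ be the Sobolev space of all $u\in L_2^n[[0,1]^2]$ whose weak derivatives $\partial_x^i\partial_y^j u$ lie in $L_2$ for all $0\le i,j\le 2$, with the corresponding Sobolev norm. For $u\in W_2^{n}$ let $\Lambda_1u\in\mathbb{R}^{16n}$ consist of the values of $u,\partial_xu,\partial_yu,\partial_x\partial_yu$ at the four corners of $[0,1]^2$, let $\Lambda_2u$ (a function of $x$ with $4n$ components) consist of the values of $\partial_x^2u,\partial_x^2\partial_yu$ on the edges $y=0$, $y=1$, and let $\Lambda_3u$ (a function of $y$ with $4n$ components) consist of the values of $\partial_y^2u,\partial_x\partial_y^2u$ on the edges $x=0$, $x=1$. Put $\Lambda_{\rm bf}=(\Lambda_1,\Lambda_2,\Lambda_3)$, and write $\mathrm{M}[N]$ for multiplication by $N$ and $\int_{[0,1]^2}[N]v=\int_0^1\int_0^1N(\theta,\eta)v(\theta,\eta)\,d\eta\,d\theta$. Let $A_{ij}\in L_\infty^{n_u\times n_u}[[0,1]^2]$, $B\in L_2^{n_u\times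 n_w}[[0,1]^2]$, $C_{ij}\in L_2^{n_z\times n_u}[[0,1]^2]$ ($0\le i,j\le2$), $D\in\mathbb{R}^{n_z\times n_w}$, $C_1\in\mathbb{R}^{m_1\times 16n_u}$, $D_1\in\mathbb{R}^{m_1\times n_w}$, $C_k\in L_2^{m_k\times4n_u}[0,1]$, $D_k\in L_2^{m_k\times n_w}[0,1]$ ($k=2,3$), and $E\in\mathbb{R}^{8n_u\times24n_u}$. Let $$X=\{u\in W_2^{n_u}[[0,1]^2]\mid \mathrm{M}[E]\Lambda_{\rm bf}u=0\},$$ where each of the $8n_u$ rows of $\mathrm{M}[E]\Lambda_{\rm bf}u$ is regarded as a function of $(x,y)\in[0,1]^2$, and equality is almost everywhere. Assume that the boundary conditions are well-posed: the boundary operator $\mathrm{M}[E]\Lambda_{\rm bf}$ restricted to $\{h\in W_2^{n_u}\mid\partial_x^2\partial_y^2h=0\}$ is a bijection onto the set $\{\mathrm{M}[E]\Lambda_{\rm bf}u\mid u\in W_2^{n_u}\}$ of all boundary data. For $w:[0,\infty)\to\mathbb{R}^{n_w}$ and $u_0\in X$, a triple $(u,z,q)$ with $u:[0,\infty)\to W_2^{n_u}$,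 $z:[0,\infty)\to\mathbb{R}^{n_z}$ and $q=(q_1,q_2,q_3):[0,\infty)\to\mathbb{R}^{m_1}\times L_2^{m_2}[0,1]\times L_2^{m_3}[0,1]$ is a *solution of the PDE with input $w$ and initial state $u_0$* if $u$ is Fréchet differentiable as a map into $W_2^{n_u}$, $u(0)=u_0$, and for all $t\ge0$: $u(t)\in X$, $$u_t(t)=\sum_{i,j=0}^2\mathrm{M}[A_{ij}]\partial_x^i\partial_y^ju(t)+\mathrm{M}[B]w(t),\qquad z(t)=\sum_{i,j=0}^2\int_{[0,1]^2}[C_{ij}]\,\partial_x^i\partial_y^ju(t)+Dw(t),$$ $$q_k(t)=\mathrm{M}[C_k]\Lambda_ku(t)+\mathrm{M}[D_k]w(t),\qquad k=1,2,3.$$ A *2D PI operator* is a bounded linear operator $\mathcal{R}:L_2^n[[0,1]^2]\to L_2^m[[0,1]^2]$ of the form $$\begin{aligned}(\mathcal{R}v)(x,y)={}&R_{00}(x,y)v(x,y)+\int_0^xR_{10}(x,y,\theta)v(\theta,y)d\theta+\int_x^1R_{20}(x,y,\theta)v(\theta,y)d\theta\\&+\int_0^yR_{01}(x,y,\eta)v(x,\eta)d\eta+\int_y^1R_{02}(x,y,\eta)v(x,\eta)d\eta\\&+\int_0^x\!\!\int_0^yR_{11}(x,y,\theta,\eta)v(\theta,\eta)d\eta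 d\theta+\int_x^1\!\!\int_0^yR_{21}(x,y,\theta,\eta)v(\theta,\eta)d\eta d\theta\\&+\int_0^x\!\!\int_y^1R_{12}(x,y,\theta,\eta)v(\theta,\eta)d\eta d\theta+\int_x^1\!\!\int_y^1R_{22}(x,y,\theta,\eta)v(\theta,\eta)d\eta d\theta\end{aligned}$$ with square-integrable matrix-valued $R_{ij}$. A *PI operator from functions on $[0,1]^2$ to functions of $x\in[0,1]$* is a linear operator of the form $$(\mathcal{R}v)(x)=\int_0^1\Big[R_0(x,\eta)v(x,\eta)+\int_0^xR_1(x,\theta,\eta)v(\theta,\eta)d\theta+\int_x^1R_2(x,\theta,\eta)v(\theta,\eta)d\theta\Big]d\eta$$ on $L_2^n[[0,1]^2]$ with square-integrable $R_0,R_1,R_2$ (its values are measurable functions, defined almost everywhere); PI operators to functions of $y$ are defined in the same way with the roles of the two variables exchanged. PI operators from $L_2^n[[0,1]^2]$ to $\mathbb{R}^m$ are the integral operators $\int_{[0,1]^2}[K]$, and PI operators from $\mathbb{R}^n$ to functions are the multipliers $\mathrm{M}[K]$, in both cases with $K$ square-integrable. **Lemma.** There are operators $\mathcal{T},\mathcal{A},\mathcal{B},\mathcal{C},\mathcal{D},\mathcal{C}_q=(\mathcal{C}_{q,1},\mathcal{C}_{q,2},\mathcal{C}_{q,3}),\mathcal{D}_q=(\mathcal{D}_{q,1},\mathcal{D}_{q,2},\mathcal{D}_{q,3})$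 with the following properties: * $\mathcal{T}:L_2^{n_u}\to L_2^{n_u}$ satisfies $\mathcal{T}\,\partial_x^2\partial_y^2u=u$ for all $u\in X$, and $\mathcal{T}v\in X$, $\partial_x^2\partial_y^2\mathcal{T}v=v$ for all $v\in L_2^{n_u}[[0,1]^2]$; * $\mathcal{A}=\sum_{i,j}\mathrm{M}[A_{ij}]\partial_x^i\partial_y^j\mathcal{T}$, $\mathcal{B}=\mathrm{M}[B]$, $\mathcal{C}=\sum_{i,j}\int_{[0,1]^2}[C_{ij}]\,\partial_x^i\partial_y^j\mathcal{T}$, $\mathcal{D}=\mathrm{M}[D]$; * $\mathcal{C}_{q,k}=\mathrm{M}[C_k]\circ\Lambda_k\circ\mathcal{T}$ and $\mathcal{D}_{q,k}=\mathrm{M}[D_k]$ for $k=1,2,3$; and all of them, in particular $\mathcal{C}_q$, are PI operators. Moreover, for every input $w$, every $u_0\in X$, and all $u:[0,\infty)\to W_2^{n_u}$, $z$, $q$ as above, the following are equivalent: 1. $(u,z,q)$ is a solution of the PDE with input $w$ and initial state $u_0$; 2. $u(t)\in X$ for all $t\ge0$, and $v=\partial_x^2\partial_y^2u:[0,\infty)\to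 L_2^{n_u}[[0,1]^2]$ together with $(z,q)$ solves the PIE with initial state $v_0=\partial_x^2\partial_y^2u_0$, that is, $v$ is Fréchet differentiable into $L_2^{n_u}$, $v(0)=v_0$, and for all $t\ge0$ $$\mathcal{T}v_t(t)=\mathcal{A}v(t)+\mathcal{B}w(t),\qquad z(t)=\mathcal{C}v(t)+\mathcal{D}w(t),\qquad q(t)=\mathcal{C}_qv(t)+\mathcal{D}_qw(t).$$ -/

import Mathlib

open MeasureTheory Set
open scoped ContDiff

noncomputable section

namespace PIE2D

/-- Column vectors with the Euclidean norm. -/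
abbrev Vec (n : ℕ) := EuclideanSpace ℝ (Fin n)

/-- Lebesgue measure on `[0,1]`. -/
def leb1 : Measure ℝ := volume.restrict (Icc 0 1)

instance : IsFiniteMeasure leb1 := by
  unfold leb1; infer_instance

/-- Lebesgue measure on the square `[0,1]²`. -/
def leb2 : Measure (ℝ × ℝ) := leb1.prod leb1

instance : IsFiniteMeasure leb2 := by
  unfold leb2; infer_instance

/-- `L₂ⁿ[0,1]`. -/
abbrev L2I (n : ℕ) := Lp (Vec n) 2 leb1

/-- `L₂ⁿ[[0,1]²]`. -/
abbrev L2S (n : ℕ) := Lp (Vec n) 2 leb2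

/-- Matrix times column vector. -/
def mv {ι κ : Type} [Fintype κ] (M : Matrix ι κ ℝ) (x : EuclideanSpace ℝ κ) :
    EuclideanSpace ℝ ι :=
  WithLp.toLp 2 (M.mulVec x.ofLp)

/-- A matrix-valued function all of whose entries are in `L_p(μ)`. -/
def MatMemLp {α : Type} [MeasurableSpace α] {ι κ : Type} (M : α → Matrix ι κ ℝ) (p : ENNReal)
    (μ : Measure α) : Prop :=
  ∀ i j, MemLp (fun a => M a i j) p μ

/-! ### The Sobolev space `W₂ⁿ[[0,1]²]` -/

/-- Smooth functions with compact support in the open unit square. -/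
def IsTest (φ : ℝ × ℝ → ℝ) : Prop :=
  ContDiff ℝ ∞ φ ∧ HasCompactSupport φ ∧ tsupport φ ⊆ Ioo 0 1 ×ˢ Ioo 0 1

/-- `g` is the weak derivative of `f` in the constant direction `e`. -/
def IsWeakDeriv {n : ℕ} (e : ℝ × ℝ) (f g : L2S n) : Prop :=
  ∀ φ : ℝ × ℝ → ℝ, IsTest φ →
    ∫ p, φ p • g p ∂leb2 = - ∫ p, fderiv ℝ φ p e • f p ∂leb2

lemma integrable_smul_of_continuous {n : ℕ} (f : L2S n) {ψ : ℝ × ℝ → ℝ}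
    (hc : Continuous ψ) (hs : HasCompactSupport ψ) :
    Integrable (fun p => ψ p • f p) leb2 := by
  obtain ⟨C, hC⟩ := hs.exists_bound_of_continuous hc
  exact ((Lp.memLp f).integrable (by norm_num)).bdd_smul C hc.aestronglyMeasurable
    (Filter.Eventually.of_forall hC)

lemma IsTest.fderiv_continuous {φ : ℝ × ℝ → ℝ} (h : IsTest φ) (e : ℝ × ℝ) :
    Continuous (fun p => fderiv ℝ φ p e) :=
  (h.1.continuous_fderiv (by simp)).clm_apply continuous_const

lemma IsTest.fderiv_compact {φ : ℝ × ℝ → ℝ} (h : IsTest φ) (e : ℝ × ℝ) :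
    HasCompactSupport (fun p => fderiv ℝ φ p e) :=
  (h.2.1.fderiv (𝕜 := ℝ)).comp_left (g := fun L : ℝ × ℝ →L[ℝ] ℝ => L e) (by simp)

lemma IsWeakDeriv.add {n : ℕ} {e : ℝ × ℝ} {f g f₁ g₁ : L2S n} (h : IsWeakDeriv e f g)
    (h₁ : IsWeakDeriv e f₁ g₁) : IsWeakDeriv e (f + f₁) (g + g₁) := by
  intro φ hφ
  have key : ∀ (ψ : ℝ × ℝ → ℝ) (a b : L2S n), Continuous ψ → HasCompactSupport ψ →
      ∫ p, ψ p • (a + b) p ∂leb2 = ∫ p, ψ p • a p ∂leb2 + ∫ p, ψ p • b p ∂leb2 := by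
    intro ψ a b hc hs
    rw [← integral_add (integrable_smul_of_continuous a hc hs)
      (integrable_smul_of_continuous b hc hs)]
    refine integral_congr_ae ?_
    filter_upwards [Lp.coeFn_add a b] with p hp
    rw [hp, Pi.add_apply, smul_add]
  rw [key _ _ _ hφ.1.continuous hφ.2.1,
    key _ _ _ (hφ.fderiv_continuous e) (hφ.fderiv_compact e), h φ hφ, h₁ φ hφ, neg_add]

lemma IsWeakDeriv.smul {n : ℕ} {e : ℝ × ℝ} {f g : L2S n} (c : ℝ) (h : IsWeakDeriv e f g) :
    IsWeakDeriv e (c • f) (c • g) := by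
  intro φ hφ
  have key : ∀ (ψ : ℝ × ℝ → ℝ) (a : L2S n),
      ∫ p, ψ p • (c • a) p ∂leb2 = c • ∫ p, ψ p • a p ∂leb2 := by
    intro ψ a
    rw [← integral_smul]
    refine integral_congr_ae ?_
    filter_upwards [Lp.coeFn_smul c a] with p hp
    rw [hp, Pi.smul_apply, smul_comm]
  rw [key, key, h φ hφ, smul_neg]

lemma IsWeakDeriv.zero {n : ℕ} (e : ℝ × ℝ) : IsWeakDeriv e (0 : L2S n) 0 := by
  intro φ hφ
  have key : ∀ ψ : ℝ × ℝ → ℝ, ∫ p, ψ p • (0 : L2S n) p ∂leb2 = 0 := by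
    intro ψ
    rw [← integral_zero (ℝ × ℝ) (Vec n) (μ := leb2)]
    refine integral_congr_ae ?_
    filter_upwards [Lp.coeFn_zero (Vec n) 2 leb2] with p hp
    rw [hp, Pi.zero_apply, smul_zero]
  rw [key, key, neg_zero]

/-- The Sobolev space `W₂ⁿ[[0,1]²]`. An element is stored as the family `U i j = ∂ₓⁱ∂ᵧʲ u`,
`0 ≤ i, j ≤ 2`, of the weak derivatives of the function `u = U 0 0`, all of them in `L₂`.
The norm is the largest of the nine `L₂` norms, which is equivalent to the usual Sobolev norm. -/
def W2 (n : ℕ) : Submodule ℝ (Fin 3 → Fin 3 → L2S n) where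
  carrier := {U |
    (∀ (i : Fin 2) (j : Fin 3), IsWeakDeriv (1, 0) (U i.castSucc j) (U i.succ j)) ∧
    (∀ (i : Fin 3) (j : Fin 2), IsWeakDeriv (0, 1) (U i j.castSucc) (U i j.succ))}
  add_mem' := fun ha hb =>
    ⟨fun i j => (ha.1 i j).add (hb.1 i j), fun i j => (ha.2 i j).add (hb.2 i j)⟩
  zero_mem' := ⟨fun _ _ => IsWeakDeriv.zero _, fun _ _ => IsWeakDeriv.zero _⟩
  smul_mem' := fun c _ h => ⟨fun i j => (h.1 i j).smul c, fun i j => (h.2 i j).smul c⟩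

/-- `∂ₓⁱ∂ᵧʲ : W₂ⁿ → L₂ⁿ`; for `i = j = 0` it is the embedding of `W₂ⁿ` in `L₂ⁿ`. -/
def pd {n : ℕ} (i j : Fin 3) (u : W2 n) : L2S n := u.1 i j

/-! ### Evaluation on the boundary -/

/-- The representative of `g` that is continuous on the closed square. -/
def repC {n : ℕ} (g : L2S n) : ℝ × ℝ → Vec n :=
  Classical.epsilon fun f => ContinuousOn f (Icc 0 1 ×ˢ Icc 0 1) ∧ g =ᵐ[leb2] f

/-- A representative of `g` that is continuous in `y` for almost every `x`; its values at
`y = 0` and `y = 1` are determined for almost every `x`. -/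
def repY {n : ℕ} (g : L2S n) : ℝ × ℝ → Vec n :=
  Classical.epsilon fun f =>
    (∀ᵐ x ∂leb1, ContinuousOn (fun y => f (x, y)) (Icc 0 1)) ∧ g =ᵐ[leb2] f

/-- A representative of `g` that is continuous in `x` for almost every `y`; its values at
`x = 0` and `x = 1` are determined for almost every `y`. -/
def repX {n : ℕ} (g : L2S n) : ℝ × ℝ → Vec n :=
  Classical.epsilon fun f =>
    (∀ᵐ y ∂leb1, ContinuousOn (fun x => f (x, y)) (Icc 0 1)) ∧ g =ᵐ[leb2] f

/-- The end point `0` or `1` of the unit interval. -/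
def endpt (b : Fin 2) : ℝ := ((b : ℕ) : ℝ)

/-- `((i, j), (a, b), k)`: component `k` of `∂ₓⁱ∂ᵧʲ u` at the corner `(a, b)`;
`16 n` indices. -/
abbrev CornerIdx (n : ℕ) := (Fin 2 × Fin 2) × (Fin 2 × Fin 2) × Fin n

/-- `(j, b, k)`: component `k` of a derivative of order `j` in the normal direction, on the
edge number `b`; `4 n` indices. -/
abbrev EdgeIdx (n : ℕ) := Fin 2 × Fin 2 × Fin n

/-- `Λ₁ u`: the values of `u`, `∂ₓu`, `∂ᵧu`, `∂ₓ∂ᵧu` at the four corners. -/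
def Lam1 {n : ℕ} (u : W2 n) : EuclideanSpace ℝ (CornerIdx n) :=
  WithLp.toLp 2 fun c =>
    repC (pd c.1.1.castSucc c.1.2.castSucc u) (endpt c.2.1.1, endpt c.2.1.2) c.2.2

/-- `Λ₂ u`: the values of `∂ₓ²u`, `∂ₓ²∂ᵧu` on the edges `y = 0` and `y = 1`, as functions
of `x`. -/
def Lam2 {n : ℕ} (u : W2 n) (x : ℝ) : EuclideanSpace ℝ (EdgeIdx n) :=
  WithLp.toLp 2 fun c => repY (pd 2 c.1.castSucc u) (x, endpt c.2.1) c.2.2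

/-- `Λ₃ u`: the values of `∂ᵧ²u`, `∂ₓ∂ᵧ²u` on the edges `x = 0` and `x = 1`, as functions
of `y`. -/
def Lam3 {n : ℕ} (u : W2 n) (y : ℝ) : EuclideanSpace ℝ (EdgeIdx n) :=
  WithLp.toLp 2 fun c => repX (pd c.1.castSucc 2 u) (endpt c.2.1, y) c.2.2

/-- The matrices `E ∈ ℝ^{8n × 24n}` that define boundary conditions. -/
abbrev BCMatrix (n : ℕ) :=
  Matrix (Fin (8 * n)) (CornerIdx n ⊕ EdgeIdx n ⊕ EdgeIdx n) ℝ

/-- `M[E] Λ_bf u`, as a function on the square, where `Λ_bf = (Λ₁, Λ₂, Λ₃)`. -/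
def bdry {n : ℕ} (E : BCMatrix n) (u : W2 n) (p : ℝ × ℝ) : Vec (8 * n) :=
  mv E (WithLp.toLp 2 (Sum.elim (Lam1 u).ofLp (Sum.elim (Lam2 u p.1).ofLp (Lam3 u p.2).ofLp)))

/-- The domain `X = {u ∈ W₂ⁿ | M[E] Λ_bf u = 0}`. -/
def X {n : ℕ} (E : BCMatrix n) : Set (W2 n) := {u | bdry E u =ᵐ[leb2] 0}

/-- Well-posedness of the boundary conditions: the boundary operator `M[E] Λ_bf` is invertible
on the functions without fundamental state (those with `∂ₓ²∂ᵧ² u = 0`, which are free in the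
boundary values only), as a map onto the space of all the boundary data `M[E] Λ_bf u`. -/
def WellPosedBC {n : ℕ} (E : BCMatrix n) : Prop :=
  ∀ u : W2 n, ∃! h : W2 n, pd 2 2 h = 0 ∧ bdry E h =ᵐ[leb2] bdry E u

/-! ### The PDE -/

/-- The parameters `{A_ij, B, C_ij, D, C_k, D_k, E}` of a PDE with outputs. -/
structure PDESystem (nu nw nz m₁ m₂ m₃ : ℕ) where
  A : Fin 3 → Fin 3 → ℝ × ℝ → Matrix (Fin nu) (Fin nu) ℝ
  B : ℝ × ℝ → Matrix (Fin nu) (Fin nw) ℝ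
  C : Fin 3 → Fin 3 → ℝ × ℝ → Matrix (Fin nz) (Fin nu) ℝ
  D : Matrix (Fin nz) (Fin nw) ℝ
  C₁ : Matrix (Fin m₁) (CornerIdx nu) ℝ
  C₂ : ℝ → Matrix (Fin m₂) (EdgeIdx nu) ℝ
  C₃ : ℝ → Matrix (Fin m₃) (EdgeIdx nu) ℝ
  D₁ : Matrix (Fin m₁) (Fin nw) ℝ
  D₂ : ℝ → Matrix (Fin m₂) (Fin nw) ℝ
  D₃ : ℝ → Matrix (Fin m₃) (Fin nw) ℝ
  E : BCMatrix nu
  memLp_A : ∀ i j, MatMemLp (A i j) ⊤ leb2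
  memLp_B : MatMemLp B 2 leb2
  memLp_C : ∀ i j, MatMemLp (C i j) 2 leb2
  memLp_C₂ : MatMemLp C₂ 2 leb1
  memLp_C₃ : MatMemLp C₃ 2 leb1
  memLp_D₂ : MatMemLp D₂ 2 leb1
  memLp_D₃ : MatMemLp D₃ 2 leb1

variable {nu nw nz m₁ m₂ m₃ : ℕ}

/-- `∑ M[A_ij] ∂ₓⁱ∂ᵧʲ u`. -/
def PDESystem.genA (G : PDESystem nu nw nz m₁ m₂ m₃) (u : W2 nu) (p : ℝ × ℝ) : Vec nu :=
  ∑ i, ∑ j, mv (G.A i j p) (pd i j u p)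

/-- `∑ ∫[C_ij] ∂ₓⁱ∂ᵧʲ u`. -/
def PDESystem.genC (G : PDESystem nu nw nz m₁ m₂ m₃) (u : W2 nu) : Vec nz :=
  ∑ i, ∑ j, ∫ p, mv (G.C i j p) (pd i j u p) ∂leb2

/-- `(u, z, (q₁, q₂, q₃))` is a solution of the PDE for the input `w` and the initial state `u₀`.
The state is Fréchet differentiable on `[0, ∞)` as a map to the Sobolev space `W₂` that
contains `X`. -/
structure IsPDESolution (G : PDESystem nu nw nz m₁ m₂ m₃) (w : ℝ → Vec nw) (u₀ : W2 nu)
    (u : ℝ → W2 nu) (z : ℝ → Vec nz) (q₁ : ℝ → Vec m₁) (q₂ : ℝ → L2I m₂) (q₃ : ℝ → L2I m₃) :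
    Prop where
  diff : DifferentiableOn ℝ u (Ici 0)
  init : u 0 = u₀
  mem : ∀ t, 0 ≤ t → u t ∈ X G.E
  state : ∀ t, 0 ≤ t → pd 0 0 (derivWithin u (Ici 0) t) =ᵐ[leb2]
    fun p => G.genA (u t) p + mv (G.B p) (w t)
  reg : ∀ t, 0 ≤ t → z t = G.genC (u t) + mv G.D (w t)
  obs₁ : ∀ t, 0 ≤ t → q₁ t = mv G.C₁ (Lam1 (u t)) + mv G.D₁ (w t)
  obs₂ : ∀ t, 0 ≤ t → q₂ t =ᵐ[leb1]
    fun x => mv (G.C₂ x) (Lam2 (u t) x) + mv (G.D₂ x) (w t)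
  obs₃ : ∀ t, 0 ≤ t → q₃ t =ᵐ[leb1]
    fun y => mv (G.C₃ y) (Lam3 (u t) y) + mv (G.D₃ y) (w t)

/-! ### PI operators -/

/-- Parameters `R = [R_ij]` of a 2D PI operator. -/
structure PIParam (m n : ℕ) where
  R00 : ℝ × ℝ → Matrix (Fin m) (Fin n) ℝ
  R10 : ℝ × ℝ → ℝ → Matrix (Fin m) (Fin n) ℝ
  R20 : ℝ × ℝ → ℝ → Matrix (Fin m) (Fin n) ℝ
  R01 : ℝ × ℝ → ℝ → Matrix (Fin m) (Fin n) ℝ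
  R02 : ℝ × ℝ → ℝ → Matrix (Fin m) (Fin n) ℝ
  R11 : ℝ × ℝ → ℝ × ℝ → Matrix (Fin m) (Fin n) ℝ
  R21 : ℝ × ℝ → ℝ × ℝ → Matrix (Fin m) (Fin n) ℝ
  R12 : ℝ × ℝ → ℝ × ℝ → Matrix (Fin m) (Fin n) ℝ
  R22 : ℝ × ℝ → ℝ × ℝ → Matrix (Fin m) (Fin n) ℝ
  memLp_R00 : MatMemLp R00 2 leb2
  memLp_R10 : MatMemLp (Function.uncurry R10) 2 (leb2.prod leb1)
  memLp_R20 : MatMemLp (Function.uncurry R20) 2 (leb2.prod leb1)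
  memLp_R01 : MatMemLp (Function.uncurry R01) 2 (leb2.prod leb1)
  memLp_R02 : MatMemLp (Function.uncurry R02) 2 (leb2.prod leb1)
  memLp_R11 : MatMemLp (Function.uncurry R11) 2 (leb2.prod leb2)
  memLp_R21 : MatMemLp (Function.uncurry R21) 2 (leb2.prod leb2)
  memLp_R12 : MatMemLp (Function.uncurry R12) 2 (leb2.prod leb2)
  memLp_R22 : MatMemLp (Function.uncurry R22) 2 (leb2.prod leb2)

/-- The function `PI[R] v`. -/
def PIParam.app {m n : ℕ} (R : PIParam m n) (v : ℝ × ℝ → Vec n) (p : ℝ × ℝ) : Vec m :=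
  mv (R.R00 p) (v p)
    + (∫ θ in (0 : ℝ)..p.1, mv (R.R10 p θ) (v (θ, p.2)))
    + (∫ θ in p.1..(1 : ℝ), mv (R.R20 p θ) (v (θ, p.2)))
    + (∫ η in (0 : ℝ)..p.2, mv (R.R01 p η) (v (p.1, η)))
    + (∫ η in p.2..(1 : ℝ), mv (R.R02 p η) (v (p.1, η)))
    + (∫ θ in (0 : ℝ)..p.1, ∫ η in (0 : ℝ)..p.2, mv (R.R11 p (θ, η)) (v (θ, η)))
    + (∫ θ in p.1..(1 : ℝ), ∫ η in (0 : ℝ)..p.2, mv (R.R21 p (θ, η)) (v (θ, η)))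
    + (∫ θ in (0 : ℝ)..p.1, ∫ η in p.2..(1 : ℝ), mv (R.R12 p (θ, η)) (v (θ, η)))
    + (∫ θ in p.1..(1 : ℝ), ∫ η in p.2..(1 : ℝ), mv (R.R22 p (θ, η)) (v (θ, η)))

/-- A bounded operator `L₂ⁿ[[0,1]²] → L₂ᵐ[[0,1]²]` that is a 2D PI operator. -/
def IsPI2D {m n : ℕ} (P : L2S n →L[ℝ] L2S m) : Prop :=
  ∃ R : PIParam m n, ∀ v, P v =ᵐ[leb2] R.app v

/-- Parameters of a PI operator from functions on the square to functions on `[0,1]`. -/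
structure PIParam1 (m n : ℕ) where
  R0 : ℝ → ℝ → Matrix (Fin m) (Fin n) ℝ
  R1 : ℝ → ℝ × ℝ → Matrix (Fin m) (Fin n) ℝ
  R2 : ℝ → ℝ × ℝ → Matrix (Fin m) (Fin n) ℝ
  memLp_R0 : MatMemLp (Function.uncurry R0) 2 (leb1.prod leb1)
  memLp_R1 : MatMemLp (Function.uncurry R1) 2 (leb1.prod leb2)
  memLp_R2 : MatMemLp (Function.uncurry R2) 2 (leb1.prod leb2)

/-- `PI[R] v` as a function of `x`. -/
def PIParam1.appX {m n : ℕ} (R : PIParam1 m n) (v : ℝ × ℝ → Vec n) (x : ℝ) : Vec m :=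
  ∫ η in (0 : ℝ)..1, (mv (R.R0 x η) (v (x, η))
    + (∫ θ in (0 : ℝ)..x, mv (R.R1 x (θ, η)) (v (θ, η)))
    + (∫ θ in x..(1 : ℝ), mv (R.R2 x (θ, η)) (v (θ, η))))

/-- `PI[R] v` as a function of `y`. -/
def PIParam1.appY {m n : ℕ} (R : PIParam1 m n) (v : ℝ × ℝ → Vec n) (y : ℝ) : Vec m :=
  ∫ θ in (0 : ℝ)..1, (mv (R.R0 y θ) (v (θ, y))
    + (∫ η in (0 : ℝ)..y, mv (R.R1 y (θ, η)) (v (θ, η)))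
    + (∫ η in y..(1 : ℝ), mv (R.R2 y (θ, η)) (v (θ, η))))

/-- `P` is a PI operator from functions on the square to functions of `x`. Square integrable
parameters alone do not force the values into `L₂`, so they are classes of measurable
functions. -/
def IsPI1DX {m n : ℕ} (P : L2S n →ₗ[ℝ] (ℝ →ₘ[leb1] Vec m)) : Prop :=
  ∃ R : PIParam1 m n, ∀ v, P v =ᵐ[leb1] R.appX v

/-- `P` is a PI operator from functions on the square to functions of `y`. -/
def IsPI1DY {m n : ℕ} (P : L2S n →ₗ[ℝ] (ℝ →ₘ[leb1] Vec m)) : Prop :=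
  ∃ R : PIParam1 m n, ∀ v, P v =ᵐ[leb1] R.appY v

/-- `P` is an integral operator `∫[K]` from functions on the square to vectors. -/
def IsPI0 {m n : ℕ} (P : L2S n →L[ℝ] Vec m) : Prop :=
  ∃ K : ℝ × ℝ → Matrix (Fin m) (Fin n) ℝ, MatMemLp K 2 leb2 ∧
    ∀ v, P v = ∫ p, mv (K p) (v p) ∂leb2

/-- `P = M[K]`, from vectors to functions on the square or on the interval. -/
def IsMult {α : Type} [MeasurableSpace α] {μ : Measure α} {m n : ℕ}
    (K : α → Matrix (Fin m) (Fin n) ℝ) (P : Vec n →L[ℝ] Lp (Vec m) 2 μ) : Prop :=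
  MatMemLp K 2 μ ∧ ∀ w, P w =ᵐ[μ] fun a => mv (K a) w

/-! ### The PIE -/

/-- The operators `{T, A, B, (C, C_q), (D, D_q)}` of a PIE, with
`C_q = (Cq₁, Cq₂, Cq₃)`, `D_q = (Dq₁, Dq₂, Dq₃)`. -/
structure PIESystem (nu nw nz m₁ m₂ m₃ : ℕ) where
  T : L2S nu →L[ℝ] L2S nu
  A : L2S nu →L[ℝ] L2S nu
  B : Vec nw →L[ℝ] L2S nu
  C : L2S nu →L[ℝ] Vec nz
  D : Vec nw →L[ℝ] Vec nz
  Cq₁ : L2S nu →L[ℝ] Vec m₁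
  Cq₂ : L2S nu →ₗ[ℝ] (ℝ →ₘ[leb1] Vec m₂)
  Cq₃ : L2S nu →ₗ[ℝ] (ℝ →ₘ[leb1] Vec m₃)
  Dq₁ : Vec nw →L[ℝ] Vec m₁
  Dq₂ : Vec nw →L[ℝ] L2I m₂
  Dq₃ : Vec nw →L[ℝ] L2I m₃

/-- All the operators of the PIE are PI operators (for `D` and `Dq₁`, which are given by
matrices, there is nothing to require). -/
structure PIESystem.IsPI (P : PIESystem nu nw nz m₁ m₂ m₃) : Prop where
  T : IsPI2D P.T
  A : IsPI2D P.A
  B : ∃ K, IsMult K P.B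
  C : IsPI0 P.C
  Cq₁ : IsPI0 P.Cq₁
  Cq₂ : IsPI1DX P.Cq₂
  Cq₃ : IsPI1DY P.Cq₃
  Dq₂ : ∃ K, IsMult K P.Dq₂
  Dq₃ : ∃ K, IsMult K P.Dq₃

/-- The PIE operators associated with a PDE: `T` is inverse to `∂ₓ²∂ᵧ²` on `X`, and
`A = ∑ M[A_ij] ∂ₓⁱ∂ᵧʲ ∘ T`, `B = M[B]`, `C = ∑ ∫[C_ij] ∂ₓⁱ∂ᵧʲ ∘ T`, `D = M[D]`,
`Cqₖ = M[C_k] ∘ Λₖ ∘ T`, `Dqₖ = M[D_k]`. These conditions determine all the operators. -/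
structure IsAssociated (G : PDESystem nu nw nz m₁ m₂ m₃) (P : PIESystem nu nw nz m₁ m₂ m₃) :
    Prop where
  left_inv : ∀ u ∈ X G.E, P.T (pd 2 2 u) = pd 0 0 u
  right_inv : ∀ v, ∃ u ∈ X G.E, pd 0 0 u = P.T v ∧ pd 2 2 u = v
  A : ∀ v, ∀ u : W2 nu, pd 0 0 u = P.T v → P.A v =ᵐ[leb2] G.genA u
  B : IsMult G.B P.B
  C : ∀ v, ∀ u : W2 nu, pd 0 0 u = P.T v → P.C v = G.genC u
  D : ∀ w, P.D w = mv G.D w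
  Cq₁ : ∀ v, ∀ u : W2 nu, pd 0 0 u = P.T v → P.Cq₁ v = mv G.C₁ (Lam1 u)
  Cq₂ : ∀ v, ∀ u : W2 nu, pd 0 0 u = P.T v →
    P.Cq₂ v =ᵐ[leb1] fun x => mv (G.C₂ x) (Lam2 u x)
  Cq₃ : ∀ v, ∀ u : W2 nu, pd 0 0 u = P.T v →
    P.Cq₃ v =ᵐ[leb1] fun y => mv (G.C₃ y) (Lam3 u y)
  Dq₁ : ∀ w, P.Dq₁ w = mv G.D₁ w
  Dq₂ : IsMult G.D₂ P.Dq₂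
  Dq₃ : IsMult G.D₃ P.Dq₃

/-- `(v, (z, q₁, q₂, q₃))` is a solution of the PIE for the input `w` and the initial
state `v₀`. -/
structure IsPIESolution (P : PIESystem nu nw nz m₁ m₂ m₃) (w : ℝ → Vec nw) (v₀ : L2S nu)
    (v : ℝ → L2S nu) (z : ℝ → Vec nz) (q₁ : ℝ → Vec m₁) (q₂ : ℝ → L2I m₂) (q₃ : ℝ → L2I m₃) :
    Prop where
  diff : DifferentiableOn ℝ v (Ici 0)
  init : v 0 = v₀
  state : ∀ t, 0 ≤ t → P.T (derivWithin v (Ici 0) t) = P.A (v t) + P.B (w t)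
  reg : ∀ t, 0 ≤ t → z t = P.C (v t) + P.D (w t)
  obs₁ : ∀ t, 0 ≤ t → q₁ t = P.Cq₁ (v t) + P.Dq₁ (w t)
  obs₂ : ∀ t, 0 ≤ t → (q₂ t : ℝ →ₘ[leb1] Vec m₂) = P.Cq₂ (v t) + (P.Dq₂ (w t)).1
  obs₃ : ∀ t, 0 ≤ t → (q₃ t : ℝ →ₘ[leb1] Vec m₃) = P.Cq₃ (v t) + (P.Dq₃ (w t)).1

end PIE2D

end

/-!
The boundary value problem `∂ₓ²∂ᵧ² u = v`, `u ∈ X`, has a unique solution `S v` for every `v` in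
`L₂`, and `S : L₂ → W₂` is continuous. Everything else follows from this, and from an explicit form
of `S`.

Functions in `W₂` are described by their Taylor data at the corner `(0, 0)` (`ofTaylor`,
`exists_ofTaylor_eq`): with `J` the primitive from `0` in one of the variables, `u` is the sum of
`Jₓᵏ Jᵧˡ d_kl` over `0 ≤ k, l ≤ 2`, where `d₂₂ = ∂ₓ²∂ᵧ² u` is arbitrary, `d_k2` is a function of
`y`, `d_2l` is a function of `x`, and `d_kl` is a constant for `k, l < 2`. This rests on the du
Bois-Reymond lemma: a function with weak derivative zero in `x` does not depend on `x`
(`IsWeakDeriv.avgX_eq`). All traces are explicit in the Taylor data (`Lam1_apply`, `Lam2_ae`,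
`Lam3_ae`). Functions of one variable and constants are kept as functions on the square that are
fixed by averaging, so that all operators act in `L₂` of the square.

In these terms the condition `M[E] Λ_bf u = 0` reads: a constant, plus `∑ P_l d_2l(x)` plus moments
of `v` in `y`, plus `∑ P'_k d_k2(y)` plus moments of `v` in `x`, is zero. A function of `x` that is
the negative of a function of `y` is constant, so each of the two parts is constant
(`edges_eq_cst`). The block matrix `(P₀ P₁)` is injective (`edgeMatY_injective`): if it maps `(α₀,
α₁) ≠ 0` to zero, then, with `s` the second derivative of `x²(1 - x)²`, the data `d_2l = s α_l`
give a nonzero function without fundamental state and with zero boundary data, in contradiction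
with well-posedness. Hence the edge data are, up to constants, constant matrices times moments of
`v`, and the remaining constants are found by linear algebra, again from well-posedness; they
depend continuously on `v` (`WellPosedBC.exists_solution`, `WellPosedBC.exists_inverse`).

Consequently all derivatives of `S v` are sums of compositions of at most one partial integration
in each variable, with constant matrices as coefficients, and of operators of finite rank
(`IsWordSum`). By the Riesz representation the latter are integral operators, so that these are 2D
PI operators, also after multiplication by bounded functions (`IsFullPI`). The traces on the edges
are moments of `v` in one variable plus a constant given by a functional of `v`, with kernels that
do not depend on the variable along the edge (`IsEdgePI`), and can be multiplied by
square-integrable functions of that variable.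

Finally, a trajectory `u` with values in `X` equals `S ∘ v` with `v = ∂ₓ²∂ᵧ² u`, and the continuous
linear maps `S` and `∂ₓ²∂ᵧ²` commute with the derivative in time, which gives the equivalence of
the PDE with the PIE (`isPDESolution_iff`).
-/

noncomputable section

namespace PIE2D

set_option linter.unusedSectionVars false

variable {n m : ℕ}

/-! ### Integral operators on `L₂` spaces of probability spaces -/

instance : IsProbabilityMeasure leb1 := ⟨by simp [leb1]⟩

instance : IsProbabilityMeasure leb2 := by unfold leb2; infer_instance

section IntOp

variable {Ω B Ω' : Type} [MeasurableSpace Ω] [MeasurableSpace B] [MeasurableSpace Ω']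
  {μ : Measure Ω} {ν : Measure B} {μ' : Measure Ω'} [IsProbabilityMeasure μ]
  [IsProbabilityMeasure ν] [IsProbabilityMeasure μ']

/-- Averaging over a factor of a product of probability spaces does not increase the `L₂` norm
(Jensen's inequality). -/
lemma eLpNorm_integral_right_le {w : Ω × B → Vec n} (hw : AEStronglyMeasurable w (μ.prod ν)) :
    eLpNorm (fun a => ∫ b, w (a, b) ∂ν) 2 μ ≤ eLpNorm w 2 (μ.prod ν) := by
  have h2 : ((2 : NNReal) : ENNReal) = 2 := rfl
  have key : eLpNorm (fun a => ∫ b, w (a, b) ∂ν) 2 μ ^ (2 : ℝ)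
      ≤ eLpNorm w 2 (μ.prod ν) ^ (2 : ℝ) := by
    have e1 := eLpNorm_nnreal_pow_eq_lintegral (μ := μ) (p := 2) two_ne_zero
      (f := fun a => ∫ b, w (a, b) ∂ν)
    have e2 := eLpNorm_nnreal_pow_eq_lintegral (μ := μ.prod ν) (p := 2) two_ne_zero (f := w)
    simp only [h2, NNReal.coe_ofNat] at e1 e2
    rw [e1, e2, lintegral_prod _ (hw.enorm.pow_const _)]
    refine lintegral_mono_ae ?_
    filter_upwards [hw.prodMk_left] with a ha
    have e3 := eLpNorm_nnreal_pow_eq_lintegral (μ := ν) (p := 2) two_ne_zero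
      (f := fun b => w (a, b))
    simp only [h2, NNReal.coe_ofNat] at e3
    rw [← e3]
    gcongr
    calc ‖∫ b, w (a, b) ∂ν‖ₑ ≤ ∫⁻ b, ‖w (a, b)‖ₑ ∂ν := enorm_integral_le_lintegral_enorm _
      _ = eLpNorm (fun b => w (a, b)) 1 ν := (eLpNorm_one_eq_lintegral_enorm).symm
      _ ≤ _ := eLpNorm_le_eLpNorm_of_exponent_le (by norm_num) ha
  exact (ENNReal.rpow_le_rpow_iff (by norm_num)).1 key

lemma coeFn_comp {τ : Ω × B → Ω'} (hτ : MeasurePreserving τ (μ.prod ν) μ') {v f : Ω' → Vec n}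
    (h : v =ᵐ[μ'] f) : ∀ᵐ a ∂μ, ∀ᵐ b ∂ν, v (τ (a, b)) = f (τ (a, b)) :=
  Measure.ae_ae_of_ae_prod (hτ.quasiMeasurePreserving.ae h)

lemma integrable_coeFn {α : Type} [MeasurableSpace α] {ρ : Measure α} [IsFiniteMeasure ρ]
    (v : Lp (Vec n) 2 ρ) : Integrable v ρ := (Lp.memLp v).integrable (by norm_num)

lemma memLp_kernel_smul {τ : Ω × B → Ω'} (hτ : MeasurePreserving τ (μ.prod ν) μ')
    {k : Ω × B → ℝ} (hk : Measurable k) {C : ℝ} (hC : ∀ z, |k z| ≤ C) (v : Lp (Vec n) 2 μ') :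
    MemLp (fun z => k z • v (τ z)) 2 (μ.prod ν) := by
  have h1 : MemLp (fun z => v (τ z)) 2 (μ.prod ν) := (Lp.memLp v).comp_measurePreserving hτ
  refine h1.of_le_mul (c := C) (hk.aestronglyMeasurable.smul h1.1) (Filter.Eventually.of_forall ?_)
  intro z
  rw [norm_smul, Real.norm_eq_abs]
  gcongr
  exact hC z

lemma integrable_kernel_smul {τ : Ω × B → Ω'} (hτ : MeasurePreserving τ (μ.prod ν) μ')
    {k : Ω × B → ℝ} (hk : Measurable k) {C : ℝ} (hC : ∀ z, |k z| ≤ C) (v : Lp (Vec n) 2 μ') :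
    ∀ᵐ a ∂μ, Integrable (fun b => k (a, b) • v (τ (a, b))) ν :=
  ((memLp_kernel_smul hτ hk hC v).integrable (by norm_num)).prod_right_ae

lemma memLp_integral_kernel {τ : Ω × B → Ω'} (hτ : MeasurePreserving τ (μ.prod ν) μ')
    {k : Ω × B → ℝ} (hk : Measurable k) {C : ℝ} (hC : ∀ z, |k z| ≤ C) (v : Lp (Vec n) 2 μ') :
    MemLp (fun a => ∫ b, k (a, b) • v (τ (a, b)) ∂ν) 2 μ := by
  have h1 := memLp_kernel_smul hτ hk hC v
  exact ⟨h1.1.integral_prod_right', (eLpNorm_integral_right_le h1.1).trans_lt h1.2⟩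

/-- The integral operator `(K v)(a) = ∫ k(a, b) v(τ(a, b)) db` with a bounded scalar kernel `k`.
The map `τ` selects the variables over which one integrates: for `τ ((x, y), θ) = (θ, y)` this
is integration in the first variable only. -/
def intOp {τ : Ω × B → Ω'} (hτ : MeasurePreserving τ (μ.prod ν) μ')
    {k : Ω × B → ℝ} (hk : Measurable k) (hC : ∃ C, ∀ z, |k z| ≤ C) :
    Lp (Vec n) 2 μ' →L[ℝ] Lp (Vec n) 2 μ :=
  LinearMap.mkContinuous
    { toFun := fun v => (memLp_integral_kernel hτ hk hC.choose_spec v).toLp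
      map_add' := by
        intro v w
        rw [← MemLp.toLp_add]
        refine MemLp.toLp_congr _ _ ?_
        filter_upwards [coeFn_comp hτ (Lp.coeFn_add v w),
          integrable_kernel_smul hτ hk hC.choose_spec v,
          integrable_kernel_smul hτ hk hC.choose_spec w] with a h hv hw
        rw [Pi.add_apply, ← integral_add hv hw]
        refine integral_congr_ae ?_
        filter_upwards [h] with b hb
        rw [hb, Pi.add_apply, smul_add]
      map_smul' := by
        intro c v
        rw [RingHom.id_apply, ← MemLp.toLp_const_smul]
        refine MemLp.toLp_congr _ _ ?_
        filter_upwards [coeFn_comp hτ (Lp.coeFn_smul c v)] with a h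
        rw [Pi.smul_apply, ← integral_smul]
        refine integral_congr_ae ?_
        filter_upwards [h] with b hb
        rw [hb, Pi.smul_apply, smul_comm] } |hC.choose| (by
      intro v
      have hC' : ∀ z, |k z| ≤ |hC.choose| := fun z => (hC.choose_spec z).trans (le_abs_self _)
      have h1 := memLp_kernel_smul hτ hk hC.choose_spec v
      have h2 : eLpNorm (fun z => k z • v (τ z)) 2 (μ.prod ν)
          ≤ ENNReal.ofReal |hC.choose| * eLpNorm v 2 μ' := by
        rw [← eLpNorm_comp_measurePreserving (Lp.memLp v).1 hτ]
        refine eLpNorm_le_mul_eLpNorm_of_ae_le_mul (Filter.Eventually.of_forall fun z => ?_) 2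
        rw [norm_smul, Real.norm_eq_abs]
        exact mul_le_mul_of_nonneg_right (hC' z) (norm_nonneg _)
      have h3 := (eLpNorm_integral_right_le h1.1).trans h2
      simp only [LinearMap.coe_mk, AddHom.coe_mk, Lp.norm_def]
      rw [← ENNReal.toReal_ofReal (abs_nonneg hC.choose), ← ENNReal.toReal_mul,
        eLpNorm_congr_ae (MemLp.coeFn_toLp _)]
      exact ENNReal.toReal_mono (ENNReal.mul_ne_top ENNReal.ofReal_ne_top (Lp.memLp v).2.ne) h3)

lemma intOp_coe {τ : Ω × B → Ω'} (hτ : MeasurePreserving τ (μ.prod ν) μ')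
    {k : Ω × B → ℝ} (hk : Measurable k) (hC : ∃ C, ∀ z, |k z| ≤ C) (v : Lp (Vec n) 2 μ') :
    intOp hτ hk hC v =ᵐ[μ] fun a => ∫ b, k (a, b) • v (τ (a, b)) ∂ν :=
  MemLp.coeFn_toLp (memLp_integral_kernel hτ hk hC.choose_spec v)

end IntOp

/-! ### Integration in one of the two variables -/

/-- A bounded measurable scalar kernel `k(x, θ)`. -/
structure BKer where
  /-- the function `k` -/
  k : ℝ × ℝ → ℝ
  meas : Measurable k
  bdd : ∃ C, ∀ z, |k z| ≤ C

/-- The composition `∫₀¹ k(x, s) l(s, θ) ds` of kernels. -/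
def BKer.comp (k l : BKer) : BKer where
  k := fun z => ∫ s, k.k (z.1, s) * l.k (s, z.2) ∂leb1
  meas := by
    have h : Measurable fun q : (ℝ × ℝ) × ℝ => k.k (q.1.1, q.2) * l.k (q.2, q.1.2) :=
      (k.meas.comp (by fun_prop)).mul (l.meas.comp (by fun_prop))
    exact (h.stronglyMeasurable.integral_prod_right' (ν := leb1)).measurable
  bdd := by
    obtain ⟨C, hC⟩ := k.bdd
    obtain ⟨C', hC'⟩ := l.bdd
    refine ⟨C * C', fun z => ?_⟩
    have h := norm_integral_le_of_norm_le_const (μ := leb1) (C := C * C')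
      (f := fun s => k.k (z.1, s) * l.k (s, z.2)) (Filter.Eventually.of_forall fun s => by
        rw [norm_mul]
        exact mul_le_mul (hC _) (hC' _) (norm_nonneg _) ((abs_nonneg _).trans (hC (0, 0))))
    simpa using h

/-- The kernel of `v ↦ ∫_b^x v`, for an end point `b` of `[0,1]`: the Heaviside kernel of
`∫₀ˣ` minus `b`. The formula makes sense for every real `b`, but has this meaning for `b = 0` and
`b = 1` only. -/
def stepK (b : ℝ) : BKer where
  k := fun z => (if z.2 < z.1 then 1 else 0) - b
  meas := (Measurable.ite (measurableSet_lt measurable_snd measurable_fst) measurable_const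
    measurable_const).sub measurable_const
  bdd := ⟨1 + |b|, fun z => (abs_sub _ _).trans (by gcongr; split_ifs <;> simp)⟩

/-- The constant kernel of `v ↦ ∫₀¹ v`. -/
def oneK : BKer where
  k := fun _ => 1
  meas := measurable_const
  bdd := ⟨1, fun _ => by simp⟩

lemma measurePreserving_selX :
    MeasurePreserving (fun z : (ℝ × ℝ) × ℝ => (z.2, z.1.2)) (leb2.prod leb1) leb2 := by
  have h1 : MeasurePreserving (fun z : (ℝ × ℝ) × ℝ => (z.1.2, z.2)) (leb2.prod leb1) leb2 :=
    (measurePreserving_snd (μ := leb1) (ν := leb1)).prod (MeasurePreserving.id leb1)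
  exact Measure.measurePreserving_swap.comp h1

/-- `(KX k v)(x, y) = ∫₀¹ k(x, θ) v(θ, y) dθ`. -/
def KX (k : BKer) : L2S n →L[ℝ] L2S n :=
  intOp measurePreserving_selX (k := fun z => k.k (z.1.1, z.2)) (k.meas.comp (by fun_prop))
    ⟨_, fun z => k.bdd.choose_spec (z.1.1, z.2)⟩

lemma KX_coe (k : BKer) (v : L2S n) :
    KX k v =ᵐ[leb2] fun p => ∫ θ, k.k (p.1, θ) • v (θ, p.2) ∂leb1 := intOp_coe _ _ _ v

lemma measurePreserving_swap : MeasurePreserving (Prod.swap : ℝ × ℝ → ℝ × ℝ) leb2 leb2 :=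
  Measure.measurePreserving_swap

/-- Exchange of the two variables. -/
def swapL : L2S n →L[ℝ] L2S n :=
  (Lp.compMeasurePreservingₗᵢ ℝ Prod.swap measurePreserving_swap).toContinuousLinearMap

lemma swapL_coe (v : L2S n) : swapL v =ᵐ[leb2] fun p => v (p.2, p.1) :=
  Lp.coeFn_compMeasurePreserving v measurePreserving_swap

lemma ae_swap {P : ℝ × ℝ → Prop} (h : ∀ᵐ p ∂leb2, P p) : ∀ᵐ p ∂leb2, P (p.2, p.1) :=
  measurePreserving_swap.quasiMeasurePreserving.ae h

@[simp] lemma swapL_swapL (v : L2S n) : swapL (swapL v) = v := by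
  apply Lp.ext
  filter_upwards [swapL_coe (swapL v), ae_swap (swapL_coe v)] with p h1 h2
  rw [h1, h2]

/-- `(KY k v)(x, y) = ∫₀¹ k(y, η) v(x, η) dη`. -/
def KY (k : BKer) : L2S n →L[ℝ] L2S n := swapL ∘L KX k ∘L swapL

lemma ae_prod {P : ℝ × ℝ → Prop} (h : ∀ᵐ p ∂leb2, P p) :
    ∀ᵐ x ∂leb1, ∀ᵐ y ∂leb1, P (x, y) := Measure.ae_ae_of_ae_prod h

lemma ae_prod' {P : ℝ × ℝ → Prop} (h : ∀ᵐ p ∂leb2, P p) :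
    ∀ᵐ y ∂leb1, ∀ᵐ x ∂leb1, P (x, y) := ae_prod (ae_swap h)

lemma ae_fst {P : ℝ → Prop} (h : ∀ᵐ x ∂leb1, P x) : ∀ᵐ p ∂leb2, P p.1 :=
  (measurePreserving_fst (μ := leb1) (ν := leb1)).quasiMeasurePreserving.ae h

lemma ae_snd {P : ℝ → Prop} (h : ∀ᵐ x ∂leb1, P x) : ∀ᵐ p ∂leb2, P p.2 :=
  (measurePreserving_snd (μ := leb1) (ν := leb1)).quasiMeasurePreserving.ae h

lemma KY_coe (k : BKer) (v : L2S n) :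
    KY k v =ᵐ[leb2] fun p => ∫ η, k.k (p.2, η) • v (p.1, η) ∂leb1 := by
  filter_upwards [swapL_coe (KX k (swapL v)), ae_swap (KX_coe k (swapL v)),
    ae_fst (ae_prod' (swapL_coe v))] with p h1 h2 h3
  have : KY k v = swapL (KX k (swapL v)) := rfl
  rw [this, h1, h2]
  refine integral_congr_ae ?_
  filter_upwards [h3] with η hη
  simp only [hη]

lemma swapL_KX (k : BKer) (v : L2S n) : swapL (KX k v) = KY k (swapL v) := by
  simp [KY]

lemma swapL_KY (k : BKer) (v : L2S n) : swapL (KY k v) = KX k (swapL v) := by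
  simp [KY]

lemma integrable_sec (v : L2S n) : ∀ᵐ y ∂leb1, Integrable (fun x => v (x, y)) leb1 :=
  (integrable_coeFn v).swap.prod_right_ae

lemma integrable_sec' (v : L2S n) : ∀ᵐ x ∂leb1, Integrable (fun y => v (x, y)) leb1 :=
  (integrable_coeFn v).prod_right_ae

lemma integrable_bdd_smul {α : Type} [MeasurableSpace α] {μ : Measure α} {k : α → ℝ}
    (hk : Measurable k) (hC : ∃ C, ∀ z, |k z| ≤ C) {f : α → Vec n} (hf : Integrable f μ) :
    Integrable (fun a => k a • f a) μ := by
  obtain ⟨C, hC⟩ := hC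
  exact hf.bdd_smul C hk.aestronglyMeasurable (Filter.Eventually.of_forall hC)

lemma BKer.meas_sec (k : BKer) (x : ℝ) : Measurable fun θ => k.k (x, θ) :=
  k.meas.comp (by fun_prop)

lemma BKer.bdd_sec (k : BKer) (x : ℝ) : ∃ C, ∀ θ, |k.k (x, θ)| ≤ C :=
  ⟨_, fun _ => k.bdd.choose_spec _⟩

lemma KX_comp (k l : BKer) (v : L2S n) : KX k (KX l v) = KX (k.comp l) v := by
  apply Lp.ext
  filter_upwards [KX_coe k (KX l v), KX_coe (k.comp l) v, ae_snd (ae_prod' (KX_coe l v)),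
    ae_snd (integrable_sec v)] with p h1 h2 h3 h4
  rw [h1, h2]
  have e1 : ∫ s, k.k (p.1, s) • KX l v (s, p.2) ∂leb1
      = ∫ s, ∫ θ, (k.k (p.1, s) * l.k (s, θ)) • v (θ, p.2) ∂leb1 ∂leb1 := by
    refine integral_congr_ae ?_
    filter_upwards [h3] with s hs
    simp only [hs, mul_smul]
    rw [integral_smul]
  rw [e1, integral_integral_swap]
  · refine integral_congr_ae (Filter.Eventually.of_forall fun θ => ?_)
    simp only [BKer.comp]
    rw [integral_smul_const]
  · refine integrable_bdd_smul (k := fun z : ℝ × ℝ => k.k (p.1, z.1) * l.k (z.1, z.2))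
      ?_ ?_ (h4.comp_snd leb1)
    · exact (k.meas.comp (by fun_prop)).mul (l.meas.comp (by fun_prop))
    · obtain ⟨C, hC⟩ := k.bdd
      obtain ⟨C', hC'⟩ := l.bdd
      refine ⟨C * C', fun z => ?_⟩
      rw [abs_mul]
      exact mul_le_mul (hC _) (hC' _) (abs_nonneg _) ((abs_nonneg _).trans (hC (0, 0)))

lemma KY_comp (k l : BKer) (v : L2S n) : KY k (KY l v) = KY (k.comp l) v := by
  simp [KY, KX_comp]

/-- The double integral `∫₀¹∫₀¹ k(x, θ) l(y, η) v(θ, η) dη dθ`, a function that is defined at every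
point `(x, y)`, and not only almost everywhere. -/
def dblInt (k l : BKer) (v : ℝ × ℝ → Vec n) (p : ℝ × ℝ) : Vec n :=
  ∫ q, (k.k (p.1, q.1) * l.k (p.2, q.2)) • v q ∂leb2

lemma integrable_dbl (k l : BKer) (v : L2S n) (p : ℝ × ℝ) :
    Integrable (fun q => (k.k (p.1, q.1) * l.k (p.2, q.2)) • v q) leb2 := by
  refine integrable_bdd_smul (k := fun z : ℝ × ℝ => k.k (p.1, z.1) * l.k (p.2, z.2))
      ?_ ?_ (integrable_coeFn v)
  · exact (k.meas.comp (by fun_prop)).mul (l.meas.comp (by fun_prop))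
  · obtain ⟨C, hC⟩ := k.bdd
    obtain ⟨C', hC'⟩ := l.bdd
    refine ⟨C * C', fun z => ?_⟩
    rw [abs_mul]
    exact mul_le_mul (hC _) (hC' _) (abs_nonneg _) ((abs_nonneg _).trans (hC (0, 0)))

lemma KX_KY_coe (k l : BKer) (v : L2S n) : KX k (KY l v) =ᵐ[leb2] dblInt k l v := by
  filter_upwards [KX_coe k (KY l v), ae_snd (ae_prod' (KY_coe l v))] with p h1 h3
  rw [h1, dblInt]
  refine Eq.trans ?_ (integral_prod _ (integrable_dbl k l v p)).symm
  refine integral_congr_ae ?_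
  filter_upwards [h3] with s hs
  simp only [hs, mul_smul]
  rw [integral_smul]

lemma dblInt_swap (k l : BKer) (v : L2S n) (p : ℝ × ℝ) :
    dblInt k l (swapL v) p = dblInt l k v (p.2, p.1) := by
  unfold dblInt
  rw [← measurePreserving_swap.integral_comp MeasurableEquiv.prodComm.measurableEmbedding]
  refine integral_congr_ae ?_
  filter_upwards [ae_swap (swapL_coe v)] with q hq
  simp only [Prod.swap, hq]
  rw [mul_comm]

lemma KY_KX_coe (k l : BKer) (v : L2S n) : KY l (KX k v) =ᵐ[leb2] dblInt k l v := by
  have e : KY l (KX k v) = swapL (KX l (KY k (swapL v))) := by simp [KY]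
  rw [e]
  filter_upwards [swapL_coe (KX l (KY k (swapL v))), ae_swap (KX_KY_coe l k (swapL v))]
    with p h1 h2
  rw [h1, h2, dblInt_swap]

/-- Integrations in different variables commute. -/
lemma KX_KY_comm (k l : BKer) (v : L2S n) : KY l (KX k v) = KX k (KY l v) :=
  Lp.ext ((KY_KX_coe k l v).trans (KX_KY_coe k l v).symm)

/-- Application of a constant linear map to the values. -/
def liftL (L : Vec n →L[ℝ] Vec m) : L2S n →L[ℝ] L2S m := L.compLpL 2 leb2

lemma liftL_coe (L : Vec n →L[ℝ] Vec m) (v : L2S n) : liftL L v =ᵐ[leb2] fun p => L (v p) :=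
  L.coeFn_compLpL v

lemma KX_liftL (k : BKer) (L : Vec n →L[ℝ] Vec m) (v : L2S n) :
    KX k (liftL L v) = liftL L (KX k v) := by
  apply Lp.ext
  filter_upwards [KX_coe k (liftL L v), liftL_coe L (KX k v), KX_coe k v,
    ae_snd (ae_prod' (liftL_coe L v)), ae_snd (integrable_sec v)] with p h1 h2 h3 h4 h5
  rw [h1, h2, h3, ← L.integral_comp_comm (integrable_bdd_smul (k.meas_sec _) (k.bdd_sec _) h5)]
  refine integral_congr_ae ?_
  filter_upwards [h4] with θ hθ
  rw [hθ, map_smul]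

lemma swapL_liftL (L : Vec n →L[ℝ] Vec m) (v : L2S n) :
    swapL (liftL L v) = liftL L (swapL v) := by
  apply Lp.ext
  filter_upwards [swapL_coe (liftL L v), ae_swap (liftL_coe L v), liftL_coe L (swapL v),
    swapL_coe v] with p h1 h2 h3 h4
  rw [h1, h2, h3, h4]

lemma KY_liftL (k : BKer) (L : Vec n →L[ℝ] Vec m) (v : L2S n) :
    KY k (liftL L v) = liftL L (KY k v) := by
  simp [KY, KX_liftL, swapL_liftL]

/-! ### Averages, primitives and constants -/

/-- The average in `x`; its fixed points are the functions that do not depend on `x`. -/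
abbrev avgX : L2S n →L[ℝ] L2S n := KX oneK

/-- The average in `y`; its fixed points are the functions that do not depend on `y`. -/
abbrev avgY : L2S n →L[ℝ] L2S n := KY oneK

/-- The primitive in `x` that vanishes on the edge `x = b`, for `b = 0` or `b = 1`. -/
abbrev primX (b : ℝ) : L2S n →L[ℝ] L2S n := KX (stepK b)

/-- The primitive in `y` that vanishes on the edge `y = b`, for `b = 0` or `b = 1`. -/
abbrev primY (b : ℝ) : L2S n →L[ℝ] L2S n := KY (stepK b)

lemma KX_congr {k l : BKer} (h : ∀ z, k.k z = l.k z) (v : L2S n) : KX k v = KX l v := by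
  apply Lp.ext
  filter_upwards [KX_coe k v, KX_coe l v] with p h1 h2
  simp only [h1, h2, h]

lemma avgX_avgX (v : L2S n) : avgX (avgX v) = avgX v := by
  rw [KX_comp]
  exact KX_congr (fun z => by simp [BKer.comp, oneK]) v

lemma avgY_avgY (v : L2S n) : avgY (avgY v) = avgY v := by
  simp [KY, avgX_avgX]

lemma primX_eq (b : ℝ) (v : L2S n) : primX b v = primX 0 v - b • avgX v := by
  apply Lp.ext
  filter_upwards [KX_coe (stepK b) v, KX_coe (stepK 0) v, KX_coe oneK v,
    Lp.coeFn_sub (primX 0 v) (b • avgX v), Lp.coeFn_smul b (avgX v),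
    ae_snd (integrable_sec v)] with p h1 h2 h3 h4 h5 h6
  rw [h1, h4, Pi.sub_apply, h5, Pi.smul_apply, h2, h3, ← integral_smul, ← integral_sub]
  · refine integral_congr_ae (Filter.Eventually.of_forall fun θ => ?_)
    simp [stepK, oneK, sub_smul]
  · exact integrable_bdd_smul ((stepK 0).meas_sec _) ((stepK 0).bdd_sec _) h6
  · exact (integrable_bdd_smul (oneK.meas_sec p.1) (oneK.bdd_sec _) h6).smul b

lemma primY_eq (b : ℝ) (v : L2S n) : primY b v = primY 0 v - b • avgY v := by
  have h := primX_eq b (swapL v)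
  simp only [KY, ContinuousLinearMap.comp_apply] at *
  rw [h, map_sub, map_smul]

/-- Constants as elements of `L₂`. -/
def cst (n : ℕ) : Vec n →L[ℝ] L2S n := Lp.constL 2 leb2 ℝ

lemma cst_coe (c : Vec n) : cst n c =ᵐ[leb2] fun _ => c := Lp.coeFn_const ..

/-- The mean value over the square. -/
def meanL : L2S n →L[ℝ] Vec n :=
  LinearMap.mkContinuous
    { toFun := fun v => ∫ p, v p ∂leb2
      map_add' := fun v w => by
        rw [← integral_add (integrable_coeFn v) (integrable_coeFn w)]
        exact integral_congr_ae (Lp.coeFn_add v w)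
      map_smul' := fun c v => by
        rw [RingHom.id_apply, ← integral_smul]
        exact integral_congr_ae (Lp.coeFn_smul c v) } 1 (by
      intro v
      simp only [LinearMap.coe_mk, AddHom.coe_mk, one_mul]
      refine (norm_integral_le_lintegral_norm _).trans ?_
      rw [Lp.norm_def]
      refine ENNReal.toReal_mono (Lp.memLp v).2.ne ?_
      simp only [ofReal_norm]
      rw [← eLpNorm_one_eq_lintegral_enorm]
      exact eLpNorm_le_eLpNorm_of_exponent_le (by norm_num) (Lp.memLp v).1)

lemma meanL_apply (v : L2S n) : meanL v = ∫ p, v p ∂leb2 := rfl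

lemma avgX_avgY (v : L2S n) : avgX (avgY v) = cst n (meanL v) := by
  apply Lp.ext
  filter_upwards [KX_KY_coe oneK oneK v, cst_coe (meanL v)] with p h1 h2
  rw [h1, h2, meanL_apply]
  simp [dblInt, oneK]

lemma meanL_cst (c : Vec n) : meanL (cst n c) = c := by
  rw [meanL_apply, integral_congr_ae (cst_coe c)]
  simp

lemma avgX_cst (c : Vec n) : avgX (cst n c) = cst n c := by
  apply Lp.ext
  filter_upwards [KX_coe oneK (cst n c), cst_coe c, ae_snd (ae_prod' (cst_coe c))] with p h1 h2 h3
  rw [h1, h2]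
  have : ∫ θ, oneK.k (p.1, θ) • cst n c (θ, p.2) ∂leb1 = ∫ _θ, c ∂leb1 := by
    refine integral_congr_ae ?_
    filter_upwards [h3] with θ hθ
    rw [hθ]
    simp [oneK]
  rw [this]
  simp

lemma swapL_cst (c : Vec n) : swapL (cst n c) = cst n c := by
  apply Lp.ext
  filter_upwards [swapL_coe (cst n c), cst_coe c, ae_swap (cst_coe c)] with p h1 h2 h3
  rw [h1, h2, h3]

lemma avgY_cst (c : Vec n) : avgY (cst n c) = cst n c := by
  simp [KY, swapL_cst, avgX_cst]

lemma liftL_cst (L : Vec n →L[ℝ] Vec m) (c : Vec n) : liftL L (cst n c) = cst m (L c) := by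
  apply Lp.ext
  filter_upwards [liftL_coe L (cst n c), cst_coe c, cst_coe (L c)] with p h1 h2 h3
  rw [h1, h2, h3]

/-! ### Weak derivatives and primitives -/

lemma integral_leb2 {f : ℝ × ℝ → Vec n} (h : Integrable f leb2) :
    ∫ p, f p ∂leb2 = ∫ x, ∫ y, f (x, y) ∂leb1 ∂leb1 := integral_prod f h

lemma integral_leb2_symm {f : ℝ × ℝ → Vec n} (h : Integrable f leb2) :
    ∫ p, f p ∂leb2 = ∫ y, ∫ x, f (x, y) ∂leb1 ∂leb1 := integral_prod_symm f h

/-- The transpose of `KX k`, applied to test functions. -/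
lemma integral_smul_KX (k : BKer) {φ : ℝ × ℝ → ℝ} (hφ : Continuous φ) (hs : HasCompactSupport φ)
    (g : L2S n) :
    ∫ p, φ p • KX k g p ∂leb2 = ∫ p, (∫ x, k.k (x, p.1) * φ (x, p.2) ∂leb1) • g p ∂leb2 := by
  obtain ⟨C, hC⟩ := hs.exists_bound_of_continuous hφ
  obtain ⟨C', hC'⟩ := k.bdd
  have hC0 : 0 ≤ C := (norm_nonneg _).trans (hC 0)
  have hC0' : 0 ≤ C' := (abs_nonneg _).trans (hC' 0)
  have i1 : Integrable (fun p => φ p • KX k g p) leb2 := integrable_smul_of_continuous _ hφ hs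
  have i2 : Integrable (fun p : ℝ × ℝ => (∫ x, k.k (x, p.1) * φ (x, p.2) ∂leb1) • g p) leb2 := by
    refine integrable_bdd_smul (k := fun p : ℝ × ℝ => ∫ x, k.k (x, p.1) * φ (x, p.2) ∂leb1)
      ?_ ⟨C' * C, fun z => ?_⟩ (integrable_coeFn g)
    · have h : Measurable fun q : (ℝ × ℝ) × ℝ => k.k (q.2, q.1.1) * φ (q.2, q.1.2) :=
        (k.meas.comp (by fun_prop)).mul (hφ.measurable.comp (by fun_prop))
      exact (h.stronglyMeasurable.integral_prod_right' (ν := leb1)).measurable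
    · have h := norm_integral_le_of_norm_le_const (μ := leb1) (C := C' * C)
        (f := fun x => k.k (x, z.1) * φ (x, z.2)) (Filter.Eventually.of_forall fun s => by
          rw [norm_mul]
          exact mul_le_mul (hC' _) (hC _) (norm_nonneg _) hC0')
      simpa using h
  rw [integral_leb2_symm i1, integral_leb2_symm i2]
  refine integral_congr_ae ?_
  filter_upwards [ae_prod' (KX_coe k g), integrable_sec g] with y h1 h2
  have e1 : ∫ x, φ (x, y) • KX k g (x, y) ∂leb1
      = ∫ x, ∫ θ, (k.k (x, θ) * φ (x, y)) • g (θ, y) ∂leb1 ∂leb1 := by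
    refine integral_congr_ae ?_
    filter_upwards [h1] with x hx
    rw [hx, ← integral_smul]
    simp only [smul_smul, mul_comm]
  rw [e1, integral_integral_swap]
  · simp only [integral_smul_const]
  · refine integrable_bdd_smul (k := fun z : ℝ × ℝ => k.k (z.1, z.2) * φ (z.1, y))
      ?_ ⟨C' * C, fun z => ?_⟩ (h2.comp_snd leb1)
    · exact (k.meas.comp (by fun_prop)).mul (hφ.measurable.comp (by fun_prop))
    · rw [abs_mul]
      exact mul_le_mul (hC' _) (hC _) (abs_nonneg _) hC0'

/-- Integrals over `[0,1]` against the Heaviside kernel. -/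
lemma integral_leb1_ite {E : Type} [NormedAddCommGroup E] [NormedSpace ℝ E] (f : ℝ → E) {t : ℝ}
    (ht : t ∈ Icc (0 : ℝ) 1) :
    ∫ x, (if t < x then f x else 0) ∂leb1 = ∫ x in t..1, f x := by
  rw [intervalIntegral.integral_of_le ht.2]
  have : (fun x => if t < x then f x else 0) = (Ioi t).indicator f := by
    ext x; simp [indicator]
  rw [this, integral_indicator measurableSet_Ioi, leb1, Measure.restrict_restrict measurableSet_Ioi]
  congr 2
  ext x
  simp only [mem_inter_iff, mem_Ioi, mem_Icc, mem_Ioc]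
  constructor
  · rintro ⟨h1, h2, h3⟩; exact ⟨h1, h3⟩
  · rintro ⟨h1, h2⟩; exact ⟨h1, ht.1.trans h1.le, h2⟩

lemma integral_leb1 {E : Type} [NormedAddCommGroup E] [NormedSpace ℝ E] (f : ℝ → E) :
    ∫ x, f x ∂leb1 = ∫ x in (0 : ℝ)..1, f x := by
  rw [intervalIntegral.integral_of_le zero_le_one, leb1, integral_Icc_eq_integral_Ioc]

lemma ae_mem_leb1 : ∀ᵐ x ∂leb1, x ∈ Icc (0 : ℝ) 1 := ae_restrict_mem measurableSet_Icc

lemma ae_mem_Ioo_leb1 : ∀ᵐ x ∂leb1, x ∈ Ioo (0 : ℝ) 1 := by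
  have : leb1 = volume.restrict (Ioo 0 1) := (Measure.restrict_congr_set Ioo_ae_eq_Icc).symm
  rw [this]
  exact ae_restrict_mem measurableSet_Ioo

lemma hasDerivAt_slice {φ : ℝ × ℝ → ℝ} (h : ContDiff ℝ ∞ φ) (x y : ℝ) :
    HasDerivAt (fun x => φ (x, y)) (fderiv ℝ φ (x, y) (1, 0)) x :=
  ((h.differentiable (by simp)) (x, y)).hasFDerivAt.comp_hasDerivAt x
    ((hasDerivAt_id x).prodMk (hasDerivAt_const x y))

lemma IsTest.eq_zero_of_notMem {φ : ℝ × ℝ → ℝ} (h : IsTest φ) {p : ℝ × ℝ}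
    (hp : p ∉ Ioo (0 : ℝ) 1 ×ˢ Ioo (0 : ℝ) 1) : φ p = 0 :=
  image_eq_zero_of_notMem_tsupport fun hp' => hp (h.2.2 hp')

lemma IsTest.integral_fderiv {φ : ℝ × ℝ → ℝ} (h : IsTest φ) (t y : ℝ) :
    ∫ x in t..1, fderiv ℝ φ (x, y) (1, 0) = - φ (t, y) := by
  rw [intervalIntegral.integral_eq_sub_of_hasDerivAt (fun x _ => hasDerivAt_slice h.1 x y)]
  · rw [h.eq_zero_of_notMem (p := (1, y)) (by simp), zero_sub]
  · have := h.fderiv_continuous (1, 0)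
    exact (this.comp (by fun_prop : Continuous fun x : ℝ => (x, y))).intervalIntegrable _ _

lemma isWeakDeriv_avgX (f : L2S n) : IsWeakDeriv (1, 0) (avgX f) 0 := by
  intro φ hφ
  rw [integral_smul_KX _ (hφ.fderiv_continuous _) (hφ.fderiv_compact _)]
  have e : ∀ p : ℝ × ℝ, ∫ x, oneK.k (x, p.1) * fderiv ℝ φ (x, p.2) (1, 0) ∂leb1 = 0 := by
    intro p
    simp only [oneK, one_mul]
    rw [integral_leb1, hφ.integral_fderiv, hφ.eq_zero_of_notMem (by simp), neg_zero]
  simp [e]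

lemma isWeakDeriv_primX_zero (g : L2S n) : IsWeakDeriv (1, 0) (primX 0 g) g := by
  intro φ hφ
  rw [integral_smul_KX _ (hφ.fderiv_continuous _) (hφ.fderiv_compact _), ← integral_neg]
  refine integral_congr_ae ?_
  filter_upwards [ae_fst ae_mem_leb1] with p hp
  have e : ∫ x, (stepK 0).k (x, p.1) * fderiv ℝ φ (x, p.2) (1, 0) ∂leb1 = - φ p := by
    simp only [stepK, sub_zero, ite_mul, one_mul, zero_mul]
    rw [integral_leb1_ite _ hp, hφ.integral_fderiv]
  rw [e, neg_smul, neg_neg]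

lemma isWeakDeriv_primX (b : ℝ) (g : L2S n) : IsWeakDeriv (1, 0) (primX b g) g := by
  have h := (isWeakDeriv_primX_zero g).add ((isWeakDeriv_avgX g).smul (-b))
  rwa [smul_zero, add_zero, neg_smul, ← sub_eq_add_neg, ← primX_eq] at h

lemma IsWeakDeriv.sub {e : ℝ × ℝ} {f g f₁ g₁ : L2S n} (h : IsWeakDeriv e f g)
    (h₁ : IsWeakDeriv e f₁ g₁) : IsWeakDeriv e (f - f₁) (g - g₁) := by
  have := h.add (h₁.smul (-1))
  simpa [sub_eq_add_neg] using this

/-- Weak derivatives are unique. -/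
lemma IsWeakDeriv.eq_zero {e : ℝ × ℝ} {g : L2S n} (h : IsWeakDeriv e 0 g) : g = 0 := by
  apply Lp.ext
  have h1 := (isOpen_Ioo.prod isOpen_Ioo : IsOpen (Ioo (0 : ℝ) 1 ×ˢ Ioo (0 : ℝ) 1)
    ).ae_eq_zero_of_integral_contDiff_smul_eq_zero (f := g) (μ := leb2)
    ((integrable_coeFn g).locallyIntegrable.locallyIntegrableOn _) (by
      intro φ h1 h2 h3
      rw [h φ ⟨h1, h2, h3⟩]
      simp)
  filter_upwards [h1, ae_fst ae_mem_Ioo_leb1, ae_snd ae_mem_Ioo_leb1,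
    Lp.coeFn_zero (Vec n) 2 leb2] with p h2 h3 h4 h5
  rw [h2 ⟨h3, h4⟩, h5, Pi.zero_apply]

/-! ### Functions with a vanishing weak derivative -/

/-- Smooth functions with compact support in the open unit interval. -/
def IsTest1 (φ : ℝ → ℝ) : Prop :=
  ContDiff ℝ ∞ φ ∧ HasCompactSupport φ ∧ tsupport φ ⊆ Ioo 0 1

lemma IsTest1.mul {φ ψ : ℝ → ℝ} (h : IsTest1 φ) (h' : IsTest1 ψ) :
    IsTest fun p => φ p.1 * ψ p.2 := by
  have hs : tsupport (fun p : ℝ × ℝ => φ p.1 * ψ p.2) ⊆ tsupport φ ×ˢ tsupport ψ := by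
    refine closure_minimal (fun p hp => ?_) ((isClosed_tsupport _).prod (isClosed_tsupport _))
    rw [Function.mem_support, mul_ne_zero_iff] at hp
    exact ⟨subset_closure hp.1, subset_closure hp.2⟩
  refine ⟨(h.1.comp contDiff_fst).mul (h'.1.comp contDiff_snd), ?_,
    hs.trans (prod_mono h.2.2 h'.2.2)⟩
  exact (h.2.1.prod h'.2.1).of_isClosed_subset (isClosed_tsupport _) hs

lemma IsTest1.continuous_deriv {φ : ℝ → ℝ} (h : IsTest1 φ) : Continuous (deriv φ) :=
  h.1.continuous_deriv (by simp)

lemma IsTest1.fderiv_mul {φ ψ : ℝ → ℝ} (h : IsTest1 φ) (h' : IsTest1 ψ) (p : ℝ × ℝ) :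
    fderiv ℝ (fun p : ℝ × ℝ => φ p.1 * ψ p.2) p (1, 0) = deriv φ p.1 * ψ p.2 := by
  have e1 := hasDerivAt_slice (h.mul h').1 p.1 p.2
  have e2 : HasDerivAt (fun x => φ x * ψ p.2) (deriv φ p.1 * ψ p.2) p.1 :=
    (((h.1.differentiable (by simp)) p.1).hasDerivAt).mul_const _
  exact e1.unique e2

lemma exists_isTest1_integral_eq_one : ∃ ρ : ℝ → ℝ, IsTest1 ρ ∧ ∫ x, ρ x ∂leb1 = 1 := by
  let b : ContDiffBump (1 / 2 : ℝ) := ⟨1 / 8, 1 / 4, by norm_num, by norm_num⟩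
  have ht : tsupport (b.normed volume) ⊆ Ioo 0 1 := by
    rw [b.tsupport_normed_eq]
    intro x hx
    rw [Metric.mem_closedBall, Real.dist_eq, abs_le] at hx
    have h1 : -(1 / 4 : ℝ) ≤ x - 1 / 2 := hx.1
    have h2 : x - 1 / 2 ≤ (1 / 4 : ℝ) := hx.2
    constructor <;> linarith
  refine ⟨b.normed volume, ⟨b.contDiff_normed, b.hasCompactSupport_normed, ht⟩, ?_⟩
  refine Eq.trans ?_ (b.integral_normed (μ := volume))
  rw [leb1]
  refine setIntegral_eq_integral_of_forall_compl_eq_zero fun x hx => ?_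
  exact image_eq_zero_of_notMem_tsupport fun hx' => hx (Ioo_subset_Icc_self (ht hx'))

/-- A test function with mean value zero is the derivative of a test function. -/
lemma IsTest1.exists_deriv_eq {ψ : ℝ → ℝ} (h : IsTest1 ψ) (h0 : ∫ x, ψ x ∂leb1 = 0) :
    ∃ χ, IsTest1 χ ∧ deriv χ = ψ := by
  have hc := h.1.continuous
  have hd : ∀ x, HasDerivAt (fun x => ∫ s in (0 : ℝ)..x, ψ s) (ψ x) x := fun x =>
    intervalIntegral.integral_hasDerivAt_right (hc.intervalIntegrable _ _)
      hc.aestronglyMeasurable.stronglyMeasurableAtFilter hc.continuousAt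
  have hde : deriv (fun x => ∫ s in (0 : ℝ)..x, ψ s) = ψ := funext fun x => (hd x).deriv
  obtain ⟨a, b, ha, hb, hab⟩ : ∃ a b : ℝ, 0 < a ∧ b < 1 ∧ tsupport ψ ⊆ Icc a b := by
    rcases (tsupport ψ).eq_empty_or_nonempty with he | hne
    · exact ⟨1, 0, by norm_num, by norm_num, by simp [he]⟩
    · have hK : IsCompact (tsupport ψ) := h.2.1
      exact ⟨sInf (tsupport ψ), sSup (tsupport ψ), (h.2.2 (hK.sInf_mem hne)).1,
        (h.2.2 (hK.sSup_mem hne)).2,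
        fun x hx => ⟨csInf_le hK.bddBelow hx, le_csSup hK.bddAbove hx⟩⟩
  have hz : ∀ x, x ∉ Icc a b → ψ x = 0 := fun x hx =>
    image_eq_zero_of_notMem_tsupport fun hx' => hx (hab hx')
  have hs : tsupport (fun x => ∫ s in (0 : ℝ)..x, ψ s) ⊆ Icc a b := by
    refine closure_minimal (fun x hx => ?_) isClosed_Icc
    by_contra hx'
    apply hx
    rw [mem_Icc, not_and_or, not_le, not_le] at hx'
    rcases hx' with hx' | hx'
    · show ∫ s in (0 : ℝ)..x, ψ s = 0
      rw [intervalIntegral.integral_congr (g := fun _ => (0 : ℝ))]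
      · simp
      · intro s hs
        refine hz s fun hs' => ?_
        rw [mem_uIcc] at hs
        have := hs'.1
        rcases hs with hs | hs <;> linarith [hs.1, hs.2]
    · have e := intervalIntegral.integral_add_adjacent_intervals
        (hc.intervalIntegrable (μ := volume) 0 x) (hc.intervalIntegrable (μ := volume) x 1)
      rw [← integral_leb1, h0,
        intervalIntegral.integral_congr (a := x) (g := fun _ => (0 : ℝ))] at e
      · simpa using e
      · intro s hs
        refine hz s fun hs' => ?_
        rw [mem_uIcc] at hs
        have := hs'.2
        rcases hs with hs | hs <;> linarith [hs.1, hs.2]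
  refine ⟨_, ⟨?_, ?_, hs.trans fun x hx => ⟨ha.trans_le hx.1, hx.2.trans_lt hb⟩⟩, hde⟩
  · rw [contDiff_infty_iff_deriv, hde]
    exact ⟨fun x => (hd x).differentiableAt, h.1⟩
  · exact isCompact_Icc.of_isClosed_subset (isClosed_tsupport _) hs

lemma IsTest1.integrable_smul {φ : ℝ → ℝ} (h : IsTest1 φ) {F : ℝ → Vec n}
    (hF : Integrable F leb1) : Integrable (fun x => φ x • F x) leb1 := by
  obtain ⟨C, hC⟩ := h.2.1.exists_bound_of_continuous h.1.continuous
  exact integrable_bdd_smul h.1.continuous.measurable ⟨C, hC⟩ hF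

lemma IsTest1.integrable {φ : ℝ → ℝ} (h : IsTest1 φ) : Integrable φ leb1 := by
  obtain ⟨C, hC⟩ := h.2.1.exists_bound_of_continuous h.1.continuous
  exact (integrable_const C).mono' h.1.continuous.aestronglyMeasurable
    (Filter.Eventually.of_forall hC)

lemma ae_eq_zero_of_integral_isTest1 {F : ℝ → Vec n} (hF : Integrable F leb1)
    (h : ∀ φ, IsTest1 φ → ∫ x, φ x • F x ∂leb1 = 0) : F =ᵐ[leb1] 0 := by
  have h1 := (isOpen_Ioo : IsOpen (Ioo (0 : ℝ) 1)).ae_eq_zero_of_integral_contDiff_smul_eq_zero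
    (f := F) (μ := leb1) (hF.locallyIntegrable.locallyIntegrableOn _)
    (fun φ h1 h2 h3 => h φ ⟨h1, h2, h3⟩)
  filter_upwards [h1, ae_mem_Ioo_leb1] with x h2 h3 using h2 h3

/-- The du Bois-Reymond lemma: a function of one variable whose weak derivative is zero is
constant. -/
lemma ae_eq_integral_of_weakDeriv_eq_zero {F : ℝ → Vec n} (hF : Integrable F leb1)
    (h : ∀ χ, IsTest1 χ → ∫ x, deriv χ x • F x ∂leb1 = 0) :
    F =ᵐ[leb1] fun _ => ∫ x, F x ∂leb1 := by
  obtain ⟨ρ, hρ, hρ1⟩ := exists_isTest1_integral_eq_one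
  set c := ∫ x, ρ x • F x ∂leb1 with hc
  have h1 : (fun x => F x - c) =ᵐ[leb1] 0 := by
    refine ae_eq_zero_of_integral_isTest1 (hF.sub (integrable_const c)) fun φ hφ => ?_
    -- `φ - (∫ φ) ρ` has mean value zero, hence is the derivative of a test function
    set I := ∫ x, φ x ∂leb1 with hI
    have ht : IsTest1 fun x => φ x - I * ρ x := by
      have hs : tsupport (fun x => φ x - I * ρ x) ⊆ tsupport φ ∪ tsupport ρ := by
        refine closure_minimal (fun x hx => ?_)
          ((isClosed_tsupport _).union (isClosed_tsupport _))
        by_contra hx'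
        rw [mem_union, not_or] at hx'
        apply hx
        simp only [image_eq_zero_of_notMem_tsupport hx'.1,
          image_eq_zero_of_notMem_tsupport hx'.2, mul_zero, sub_zero]
      exact ⟨hφ.1.sub (contDiff_const.mul hρ.1),
        IsCompact.of_isClosed_subset (hφ.2.1.union hρ.2.1) (isClosed_tsupport _) hs,
        hs.trans (union_subset hφ.2.2 hρ.2.2)⟩
    obtain ⟨χ, hχ, hd⟩ := ht.exists_deriv_eq (by
      rw [integral_sub hφ.integrable (hρ.integrable.const_mul I), integral_const_mul, hρ1,
        mul_one, sub_self])
    have h2 := h χ hχ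
    simp only [hd, sub_smul, mul_smul] at h2
    rw [integral_sub (hφ.integrable_smul hF) (g := fun x => I • ρ x • F x)
      ((hρ.integrable_smul hF).smul I), integral_smul,
      ← hc] at h2
    simp only [smul_sub]
    rw [integral_sub (hφ.integrable_smul hF) (hφ.integrable_smul (integrable_const c)),
      integral_smul_const, h2]
  have h2 : F =ᵐ[leb1] fun _ => c := by
    filter_upwards [h1] with x hx
    exact sub_eq_zero.1 hx
  rw [integral_congr_ae h2]
  simpa using h2

/-- An integrable function on the square is zero if its integrals over all rectangles are. -/
lemma ae_eq_zero_of_setIntegral_prod {f : ℝ × ℝ → Vec n} (hf : Integrable f leb2)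
    (h : ∀ A B, MeasurableSet A → MeasurableSet B → ∫ p in A ×ˢ B, f p ∂leb2 = 0) :
    f =ᵐ[leb2] 0 := by
  refine hf.ae_eq_zero_of_forall_setIntegral_eq_zero fun s hs h_fin => ?_
  clear h_fin
  have h0 : ∫ p, f p ∂leb2 = 0 := by
    simpa using h univ univ MeasurableSet.univ MeasurableSet.univ
  induction s, hs using MeasurableSpace.induction_on_inter generateFrom_prod.symm
    isPiSystem_prod with
  | empty => simp
  | basic t ht =>
    obtain ⟨A, hA, B, hB, rfl⟩ := ht
    exact h A B hA hB
  | compl t htm ih => rw [setIntegral_compl htm hf, ih, h0, sub_zero]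
  | iUnion g hd hm ih =>
    rw [integral_iUnion hm hd hf.integrableOn]
    simp [ih]

/-- A function on the square whose weak derivative in `x` is zero does not depend on `x`. -/
lemma IsWeakDeriv.avgX_eq {f : L2S n} (h : IsWeakDeriv (1, 0) f 0) : avgX f = f := by
  have hf := integrable_coeFn f
  -- for a test function `χ`, `∫ χ'(x) f(x, y) dx` is zero for almost every `y`
  have h1 : ∀ χ, IsTest1 χ → (fun y => ∫ x, deriv χ x • f (x, y) ∂leb1) =ᵐ[leb1] 0 := by
    intro χ hχ
    have hi : Integrable (fun p : ℝ × ℝ => deriv χ p.1 • f p) leb2 := by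
      obtain ⟨C, hC⟩ := hχ.2.1.deriv.exists_bound_of_continuous hχ.continuous_deriv
      exact integrable_bdd_smul (k := fun p : ℝ × ℝ => deriv χ p.1)
        (hχ.continuous_deriv.measurable.comp measurable_fst) ⟨C, fun z => hC z.1⟩ hf
    refine ae_eq_zero_of_integral_isTest1 hi.integral_prod_right fun ψ hψ => ?_
    have h2 := h _ (hχ.mul hψ)
    simp only [hχ.fderiv_mul hψ] at h2
    have h3 : ∫ p : ℝ × ℝ, (deriv χ p.1 * ψ p.2) • f p ∂leb2 = 0 := by
      have h4 : ∫ p : ℝ × ℝ, (χ p.1 * ψ p.2) • (0 : L2S n) p ∂leb2 = 0 := by simp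
      rw [h4] at h2
      exact neg_eq_zero.1 h2.symm
    rw [integral_leb2_symm] at h3
    · rw [← h3]
      refine integral_congr_ae (Filter.Eventually.of_forall fun y => ?_)
      simp only [← integral_smul, smul_smul, mul_comm]
    · obtain ⟨C, hC⟩ := hψ.2.1.exists_bound_of_continuous hψ.1.continuous
      have := integrable_bdd_smul (k := fun p : ℝ × ℝ => ψ p.2)
        (hψ.1.continuous.measurable.comp measurable_snd) ⟨C, fun z => hC z.2⟩ hi
      simpa only [smul_smul, mul_comm] using this
  have hsec : ∀ B : Set ℝ, Integrable f (leb1.prod (leb1.restrict B)) := fun B =>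
    hf.mono_measure (Measure.prod_mono le_rfl Measure.restrict_le_self)
  -- hence the integral of `f` over `y ∈ B` does not depend on `x`
  have h2 : ∀ B, MeasurableSet B → (fun x => ∫ y in B, f (x, y) ∂leb1) =ᵐ[leb1]
      fun _ => ∫ x, ∫ y in B, f (x, y) ∂leb1 ∂leb1 := by
    intro B hB
    refine ae_eq_integral_of_weakDeriv_eq_zero (hsec B).integral_prod_left fun χ hχ => ?_
    simp only [← integral_smul]
    rw [integral_integral_swap]
    · rw [← integral_zero ℝ (Vec n) (μ := leb1.restrict B)]
      exact integral_congr_ae (ae_restrict_of_ae (h1 χ hχ))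
    · obtain ⟨C, hC⟩ := hχ.2.1.deriv.exists_bound_of_continuous hχ.continuous_deriv
      exact integrable_bdd_smul (k := fun p : ℝ × ℝ => deriv χ p.1)
        (hχ.continuous_deriv.measurable.comp measurable_fst) ⟨C, fun z => hC z.1⟩ (hsec B)
  have h3 : (fun p => f p - avgX f p) =ᵐ[leb2] 0 := by
    have ha := integrable_coeFn (avgX f)
    refine ae_eq_zero_of_setIntegral_prod (hf.sub ha) fun A B hA hB => ?_
    have hm : leb2.restrict (A ×ˢ B) = (leb1.restrict A).prod (leb1.restrict B) :=
      (Measure.prod_restrict A B).symm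
    have e1 : ∫ p in A ×ˢ B, f p ∂leb2
        = ∫ _x in A, ∫ x, ∫ y in B, f (x, y) ∂leb1 ∂leb1 ∂leb1 := by
      have hi := hf.integrableOn (s := A ×ˢ B)
      rw [IntegrableOn, hm] at hi
      rw [hm, integral_prod _ hi]
      exact integral_congr_ae (ae_restrict_of_ae (h2 B hB))
    have e2 : ∫ p in A ×ˢ B, avgX f p ∂leb2
        = ∫ _x in A, ∫ x, ∫ y in B, f (x, y) ∂leb1 ∂leb1 ∂leb1 := by
      have hi := ha.integrableOn (s := A ×ˢ B)
      rw [IntegrableOn, hm] at hi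
      rw [hm, integral_prod _ hi]
      refine integral_congr_ae (ae_restrict_of_ae ?_)
      filter_upwards [ae_prod (KX_coe oneK f)] with x hx
      rw [integral_integral_swap (f := fun x y => f (x, y)) (hsec B)]
      refine integral_congr_ae (ae_restrict_of_ae ?_)
      filter_upwards [hx] with y hy
      rw [hy]
      simp [oneK]
    rw [integral_sub hf.integrableOn ha.integrableOn, e1, e2, sub_self]
  apply Lp.ext
  filter_upwards [h3] with p hp
  exact (sub_eq_zero.1 hp).symm

/-- A function minus the primitive of its weak derivative does not depend on `x`. -/
lemma IsWeakDeriv.avgX_sub_primX {f g : L2S n} (h : IsWeakDeriv (1, 0) f g) (b : ℝ) :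
    avgX (f - primX b g) = f - primX b g := by
  have := h.sub (isWeakDeriv_primX b g)
  rw [sub_self] at this
  exact this.avgX_eq

lemma isWeakDeriv_of_avgX_eq {f : L2S n} (h : avgX f = f) : IsWeakDeriv (1, 0) f 0 := by
  rw [← h]
  exact isWeakDeriv_avgX f

lemma IsTest.comp_swap {φ : ℝ × ℝ → ℝ} (h : IsTest φ) : IsTest (φ ∘ Prod.swap) := by
  refine ⟨h.1.comp (contDiff_snd.prodMk contDiff_fst),
    h.2.1.comp_homeomorph (Homeomorph.prodComm ℝ ℝ), ?_⟩
  have e := tsupport_comp_eq_preimage φ (Homeomorph.prodComm ℝ ℝ)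
  intro p hp
  have hp' : p ∈ (Homeomorph.prodComm ℝ ℝ) ⁻¹' tsupport φ := by rw [← e]; exact hp
  have := h.2.2 hp'
  exact ⟨this.2, this.1⟩

lemma IsWeakDeriv.swap {e : ℝ × ℝ} {f g : L2S n} (h : IsWeakDeriv e f g) :
    IsWeakDeriv e.swap (swapL f) (swapL g) := by
  intro φ hφ
  have h1 := h _ hφ.comp_swap
  have key : ∀ (ψ : ℝ × ℝ → ℝ) (f : L2S n),
      ∫ p, ψ p • swapL f p ∂leb2 = ∫ p, ψ p.swap • f p ∂leb2 := by
    intro ψ f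
    rw [← measurePreserving_swap.integral_comp MeasurableEquiv.prodComm.measurableEmbedding]
    refine integral_congr_ae ?_
    filter_upwards [ae_swap (swapL_coe f)] with q hq
    simp only [Prod.swap, hq]
  have hd : ∀ p, fderiv ℝ (φ ∘ Prod.swap) p e = fderiv ℝ φ p.swap e.swap := by
    intro p
    have h2 : HasFDerivAt (φ ∘ Prod.swap) _ p :=
      ((hφ.1.differentiable (by simp)) p.swap).hasFDerivAt.comp p
        ((hasFDerivAt_snd (p := p)).prodMk (hasFDerivAt_fst (p := p)))
    rw [h2.fderiv]
    rfl
  rw [key, key (fun p => fderiv ℝ φ p e.swap)]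
  simp only [hd] at h1
  exact h1

/-- Statements about weak derivatives in `y` follow from those about `x` by exchange of the
variables. -/
lemma isWeakDeriv_swap_iff {f g : L2S n} :
    IsWeakDeriv (0, 1) f g ↔ IsWeakDeriv (1, 0) (swapL f) (swapL g) :=
  ⟨fun h => h.swap, fun h => by simpa using h.swap⟩

lemma IsWeakDeriv.avgY_sub_primY {f g : L2S n} (h : IsWeakDeriv (0, 1) f g) (b : ℝ) :
    avgY (f - primY b g) = f - primY b g := by
  have := (isWeakDeriv_swap_iff.1 h).avgX_sub_primX b
  have h2 := congrArg swapL this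
  simpa [swapL_KX, map_sub] using h2

lemma isWeakDeriv_of_avgY_eq {f : L2S n} (h : avgY f = f) : IsWeakDeriv (0, 1) f 0 := by
  rw [isWeakDeriv_swap_iff, map_zero]
  refine isWeakDeriv_of_avgX_eq ?_
  conv_rhs => rw [← h]
  rw [swapL_KY]

lemma isWeakDeriv_primY (b : ℝ) (g : L2S n) : IsWeakDeriv (0, 1) (primY b g) g := by
  rw [isWeakDeriv_swap_iff, swapL_KY]
  exact isWeakDeriv_primX b _

/-! ### The Taylor representation of the Sobolev space -/

/-- The triple `(f₀ + J f₁ + J² f₂, f₁ + J f₂, f₂)` with `J` the primitive in `x` from `0`: a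
function with its first two derivatives, in terms of its Taylor data at `x = 0`. -/
def taylorX : (Fin 3 → L2S n) →L[ℝ] (Fin 3 → L2S n) :=
  ContinuousLinearMap.pi
    ![.proj 0 + primX 0 ∘L (.proj 1 + primX 0 ∘L .proj 2), .proj 1 + primX 0 ∘L .proj 2, .proj 2]

/-- The triple `(f₀ + J f₁ + J² f₂, f₁ + J f₂, f₂)` with `J` the primitive in `y` from `0`. -/
def taylorY : (Fin 3 → L2S n) →L[ℝ] (Fin 3 → L2S n) :=
  ContinuousLinearMap.pi
    ![.proj 0 + primY 0 ∘L (.proj 1 + primY 0 ∘L .proj 2), .proj 1 + primY 0 ∘L .proj 2, .proj 2]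

lemma taylorX_two (f : Fin 3 → L2S n) : taylorX f 2 = f 2 := rfl

lemma taylorX_castSucc (f : Fin 3 → L2S n) (i : Fin 2) :
    taylorX f i.castSucc = f i.castSucc + primX 0 (taylorX f i.succ) := by
  fin_cases i <;> rfl

lemma taylorY_castSucc (f : Fin 3 → L2S n) (i : Fin 2) :
    taylorY f i.castSucc = f i.castSucc + primY 0 (taylorY f i.succ) := by
  fin_cases i <;> rfl

/-- Induction for statements about the three derivatives, from the highest one down. -/
lemma fin3_descend {P : Fin 3 → Prop} (h2 : P 2) (h : ∀ i : Fin 2, P i.succ → P i.castSucc)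
    (i : Fin 3) : P i := by
  have h1 : P 1 := h 1 h2
  have h0 : P 0 := h 0 h1
  fin_cases i <;> assumption

/-- An operator that commutes with the primitive commutes with the Taylor map. -/
lemma taylorX_comm (K : L2S n →L[ℝ] L2S n) (hK : ∀ v, K (primX 0 v) = primX 0 (K v))
    (f : Fin 3 → L2S n) (i : Fin 3) : K (taylorX f i) = taylorX (fun k => K (f k)) i := by
  refine fin3_descend (P := fun i => K (taylorX f i) = taylorX (fun k => K (f k)) i) rfl
    (fun i ih => ?_) i
  rw [taylorX_castSucc, taylorX_castSucc, map_add, hK, ih]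

lemma taylorY_comm (K : L2S n →L[ℝ] L2S n) (hK : ∀ v, K (primY 0 v) = primY 0 (K v))
    (f : Fin 3 → L2S n) (i : Fin 3) : K (taylorY f i) = taylorY (fun k => K (f k)) i := by
  refine fin3_descend (P := fun i => K (taylorY f i) = taylorY (fun k => K (f k)) i) rfl
    (fun i ih => ?_) i
  rw [taylorY_castSucc, taylorY_castSucc, map_add, hK, ih]

lemma eq_zero_of_taylorX {f : Fin 3 → L2S n} (h : ∀ i, taylorX f i = 0) (i : Fin 3) : f i = 0 := by
  refine fin3_descend (P := fun i => f i = 0) (h 2) (fun i _ => ?_) i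
  have := h i.castSucc
  rwa [taylorX_castSucc, h i.succ, map_zero, add_zero] at this

lemma eq_zero_of_taylorY {f : Fin 3 → L2S n} (h : ∀ i, taylorY f i = 0) (i : Fin 3) : f i = 0 := by
  refine fin3_descend (P := fun i => f i = 0) (h 2) (fun i _ => ?_) i
  have := h i.castSucc
  rwa [taylorY_castSucc, h i.succ, map_zero, add_zero] at this

/-- The Taylor data `d k l` of elements of `W₂` at the corner `(0, 0)`: `d 2 2` is the fundamental
state `∂ₓ²∂ᵧ² u`, the function `d k l` does not depend on `x` if `k < 2`, and it does not depend
on `y` if `l < 2`. -/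
def TaylorData (n : ℕ) : Submodule ℝ (Fin 3 → Fin 3 → L2S n) where
  carrier := {d | (∀ (k : Fin 2) (l : Fin 3), avgX (d k.castSucc l) = d k.castSucc l) ∧
    (∀ (k : Fin 3) (l : Fin 2), avgY (d k l.castSucc) = d k l.castSucc)}
  add_mem' := fun ha hb =>
    ⟨fun k l => by simp [ha.1 k l, hb.1 k l], fun k l => by simp [ha.2 k l, hb.2 k l]⟩
  zero_mem' := ⟨fun _ _ => by simp, fun _ _ => by simp⟩
  smul_mem' := fun c _ h => ⟨fun k l => by simp [h.1 k l], fun k l => by simp [h.2 k l]⟩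

/-- The family of derivatives with given Taylor data. -/
def taylor : (Fin 3 → Fin 3 → L2S n) →L[ℝ] (Fin 3 → Fin 3 → L2S n) :=
  ContinuousLinearMap.pi fun i => ContinuousLinearMap.pi fun j =>
    .proj i ∘L taylorX ∘L
      ContinuousLinearMap.pi fun k => .proj j ∘L taylorY ∘L .proj k

lemma taylor_apply (d : Fin 3 → Fin 3 → L2S n) (i j : Fin 3) :
    taylor d i j = taylorX (fun k => taylorY (d k) j) i := rfl

lemma primX_primY (a b : ℝ) (v : L2S n) : primY b (primX a v) = primX a (primY b v) :=
  KX_KY_comm _ _ v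

lemma taylor_castSucc_left (d : Fin 3 → Fin 3 → L2S n) (i : Fin 2) (j : Fin 3) :
    taylor d i.castSucc j = taylorY (d i.castSucc) j + primX 0 (taylor d i.succ j) := by
  simp only [taylor_apply, taylorX_castSucc]

/-- The Taylor expansions in `x` and in `y` commute. -/
lemma taylor_castSucc_right (d : Fin 3 → Fin 3 → L2S n) (i : Fin 3) (j : Fin 2) :
    taylor d i j.castSucc
      = taylorX (fun k => d k j.castSucc) i + primY 0 (taylor d i j.succ) := by
  simp only [taylor_apply, taylorY_castSucc]
  rw [taylorX_comm _ (fun v => primX_primY _ _ v)]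
  exact congrFun (map_add taylorX (fun k => d k j.castSucc)
    (fun k => primY 0 (taylorY (d k) j.succ))) i

lemma avgX_taylorY {f : Fin 3 → L2S n} (h : ∀ j, avgX (f j) = f j) (j : Fin 3) :
    avgX (taylorY f j) = taylorY f j := by
  rw [taylorY_comm _ (fun v => (KX_KY_comm _ _ v).symm)]
  simp only [h]

lemma avgY_taylorX {f : Fin 3 → L2S n} (h : ∀ j, avgY (f j) = f j) (j : Fin 3) :
    avgY (taylorX f j) = taylorX f j := by
  rw [taylorX_comm _ (fun v => (KX_KY_comm _ _ v))]
  simp only [h]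

lemma taylor_mem_W2 (d : TaylorData n) : taylor d.1 ∈ W2 n := by
  constructor
  · intro i j
    have h := (isWeakDeriv_of_avgX_eq (avgX_taylorY (d.2.1 i) j)).add
      (isWeakDeriv_primX 0 (taylor d.1 i.succ j))
    rwa [zero_add, ← taylor_castSucc_left] at h
  · intro i j
    have h := (isWeakDeriv_of_avgY_eq (avgY_taylorX (fun k => d.2.2 k j) i)).add
      (isWeakDeriv_primY 0 (taylor d.1 i j.succ))
    rwa [zero_add, ← taylor_castSucc_right] at h

/-- The element of `W₂` with given Taylor data. -/
def ofTaylor : TaylorData n →L[ℝ] W2 n :=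
  (taylor ∘L (TaylorData n).subtypeL).codRestrict _ taylor_mem_W2

/-- `pd i j` as a continuous linear map on `W₂`. -/
def pdL (i j : Fin 3) : W2 n →L[ℝ] L2S n := .proj j ∘L .proj i ∘L (W2 n).subtypeL

lemma pdL_apply (i j : Fin 3) (u : W2 n) : pdL i j u = pd i j u := rfl

lemma pd_ofTaylor (d : TaylorData n) (i j : Fin 3) :
    pd i j (ofTaylor d) = taylor d.1 i j := rfl

lemma pd_two_two_ofTaylor (d : TaylorData n) : pd 2 2 (ofTaylor d) = d.1 2 2 := rfl

lemma W2_ext {u v : W2 n} (h : ∀ i j, pd i j u = pd i j v) : u = v :=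
  Subtype.ext (funext fun i => funext fun j => h i j)

lemma ofTaylor_eq_zero {d : TaylorData n} (h : ofTaylor d = 0) (k l : Fin 3) : d.1 k l = 0 := by
  have h1 : ∀ i j, taylor d.1 i j = 0 := fun i j => by
    rw [← pd_ofTaylor, h]; rfl
  exact eq_zero_of_taylorY (fun j => eq_zero_of_taylorX (fun i => h1 i j) k) l

lemma W2_derivX (u : W2 n) (i : Fin 2) (j : Fin 3) :
    IsWeakDeriv (1, 0) (pd i.castSucc j u) (pd i.succ j u) := u.2.1 i j

lemma W2_derivY (u : W2 n) (i : Fin 3) (j : Fin 2) :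
    IsWeakDeriv (0, 1) (pd i j.castSucc u) (pd i j.succ u) := u.2.2 i j

lemma fixed_sub {K P : L2S n →L[ℝ] L2S n} (hKP : ∀ v, K (P v) = P (K v)) {f g : L2S n}
    (hf : K f = f) (hg : K g = g) : K (f - P g) = f - P g := by
  rw [map_sub, hKP, hf, hg]

/-- The Taylor data `(f₀ - J f₁, f₁ - J f₂, f₂)` of a triple of derivatives in `x`: the inverse of
`taylorX`. -/
def detaylorX (f : Fin 3 → L2S n) : Fin 3 → L2S n :=
  ![f 0 - primX 0 (f 1), f 1 - primX 0 (f 2), f 2]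

/-- The inverse of `taylorY`. -/
def detaylorY (f : Fin 3 → L2S n) : Fin 3 → L2S n :=
  ![f 0 - primY 0 (f 1), f 1 - primY 0 (f 2), f 2]

lemma detaylorX_castSucc (f : Fin 3 → L2S n) (i : Fin 2) :
    detaylorX f i.castSucc = f i.castSucc - primX 0 (f i.succ) := by
  fin_cases i <;> rfl

lemma detaylorY_castSucc (f : Fin 3 → L2S n) (i : Fin 2) :
    detaylorY f i.castSucc = f i.castSucc - primY 0 (f i.succ) := by
  fin_cases i <;> rfl

lemma taylorX_detaylorX (f : Fin 3 → L2S n) (i : Fin 3) : taylorX (detaylorX f) i = f i := by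
  refine fin3_descend (P := fun i => taylorX (detaylorX f) i = f i) rfl (fun i ih => ?_) i
  rw [taylorX_castSucc, ih, detaylorX_castSucc, sub_add_cancel]

lemma taylorY_detaylorY (f : Fin 3 → L2S n) (i : Fin 3) : taylorY (detaylorY f) i = f i := by
  refine fin3_descend (P := fun i => taylorY (detaylorY f) i = f i) rfl (fun i ih => ?_) i
  rw [taylorY_castSucc, ih, detaylorY_castSucc, sub_add_cancel]

/-- Every element of `W₂` has Taylor data. -/
lemma exists_ofTaylor_eq (u : W2 n) : ∃ d : TaylorData n, ofTaylor d = u := by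
  let e : Fin 3 → Fin 3 → L2S n := fun k j => detaylorX (fun i => pd i j u) k
  have he2 : ∀ j, e 2 j = pd 2 j u := fun _ => rfl
  have heX : ∀ (k : Fin 2) j, avgX (e k.castSucc j) = e k.castSucc j := by
    intro k j
    simp only [e, detaylorX_castSucc]
    exact (W2_derivX u k j).avgX_sub_primX 0
  have hY : ∀ i (j : Fin 2), avgY (pd i j.castSucc u - primY 0 (pd i j.succ u))
      = pd i j.castSucc u - primY 0 (pd i j.succ u) :=
    fun i j => (W2_derivY u i j).avgY_sub_primY 0
  have heY : ∀ k (j : Fin 2), avgY (e k j.castSucc - primY 0 (e k j.succ))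
      = e k j.castSucc - primY 0 (e k j.succ) := by
    intro k j
    refine fin3_descend (P := fun k => avgY (e k j.castSucc - primY 0 (e k j.succ))
      = e k j.castSucc - primY 0 (e k j.succ)) (hY 2 j) (fun k _ => ?_) k
    simp only [e, detaylorX_castSucc, map_sub, primX_primY]
    have h := fixed_sub (K := avgY) (P := primX 0) (fun v => KX_KY_comm _ _ v)
      (hY k.castSucc j) (hY k.succ j)
    simp only [map_sub] at h ⊢
    convert h using 1 <;> abel
  have hd : (fun k => detaylorY (e k)) ∈ TaylorData n := by
    constructor
    · intro k l
      refine fin3_descend (P := fun l => avgX (detaylorY (e k.castSucc) l)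
        = detaylorY (e k.castSucc) l) (heX k 2) (fun l _ => ?_) l
      rw [detaylorY_castSucc]
      exact fixed_sub (fun v => (KX_KY_comm _ _ v).symm) (heX k _) (heX k _)
    · intro k l
      simp only [detaylorY_castSucc]
      exact heY k l
  refine ⟨⟨_, hd⟩, W2_ext fun i j => ?_⟩
  rw [pd_ofTaylor, taylor_apply]
  simp only [taylorY_detaylorY]
  exact taylorX_detaylorX _ i

/-- An element of `W₂` is determined by its values: weak derivatives are unique. -/
lemma W2_eq_zero {u : W2 n} (h : pd 0 0 u = 0) : u = 0 := by
  have hx : ∀ i, pd i 0 u = 0 := by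
    have h1 : pd 1 0 u = 0 := IsWeakDeriv.eq_zero (e := (1, 0)) (h ▸ W2_derivX u 0 0)
    have h2 : pd 2 0 u = 0 := IsWeakDeriv.eq_zero (e := (1, 0)) (h1 ▸ W2_derivX u 1 0)
    intro i
    fin_cases i <;> assumption
  refine W2_ext fun i j => ?_
  have h1 : pd i 1 u = 0 := IsWeakDeriv.eq_zero (e := (0, 1)) (hx i ▸ W2_derivY u i 0)
  have h2 : pd i 2 u = 0 := IsWeakDeriv.eq_zero (e := (0, 1)) (h1 ▸ W2_derivY u i 1)
  have h0 := hx i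
  fin_cases j <;> assumption

/-! ### Traces -/

/-- The value of `∂ₓⁱ∂ᵧʲ u` at the corner `(a, b)`, as a constant function on the square. -/
def trC (i j a b : Fin 2) : W2 n →L[ℝ] L2S n :=
  (pdL i.castSucc j.castSucc - primX (endpt a) ∘L pdL i.succ j.castSucc)
    - primY (endpt b) ∘L (pdL i.castSucc j.succ - primX (endpt a) ∘L pdL i.succ j.succ)

/-- The values of `∂ₓ²∂ᵧʲ u` on the edge `y = b`, as a function on the square that does not
depend on `y`. -/
def trY (j b : Fin 2) : W2 n →L[ℝ] L2S n :=
  pdL 2 j.castSucc - primY (endpt b) ∘L pdL 2 j.succ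

/-- The values of `∂ₓⁱ∂ᵧ² u` on the edge `x = b`, as a function on the square that does not
depend on `x`. -/
def trX (i b : Fin 2) : W2 n →L[ℝ] L2S n :=
  pdL i.castSucc 2 - primX (endpt b) ∘L pdL i.succ 2

lemma avgY_trY (j b : Fin 2) (u : W2 n) : avgY (trY j b u) = trY j b u :=
  (W2_derivY u 2 j).avgY_sub_primY _

lemma avgX_trX (j b : Fin 2) (u : W2 n) : avgX (trX j b u) = trX j b u :=
  (W2_derivX u j 2).avgX_sub_primX _

lemma avgX_trC (i j a b : Fin 2) (u : W2 n) : avgX (trC i j a b u) = trC i j a b u :=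
  fixed_sub (K := avgX) (P := primY (endpt b)) (fun v => (KX_KY_comm _ _ v).symm)
    ((W2_derivX u i j.castSucc).avgX_sub_primX (endpt a))
    ((W2_derivX u i j.succ).avgX_sub_primX (endpt a))

/-- The corner values, with the expansion in `y` taken first. -/
lemma trC_apply' (i j a b : Fin 2) (u : W2 n) : trC i j a b u
    = (pd i.castSucc j.castSucc u - primY (endpt b) (pd i.castSucc j.succ u))
      - primX (endpt a) (pd i.succ j.castSucc u - primY (endpt b) (pd i.succ j.succ u)) := by
  simp only [trC, sub_apply, ContinuousLinearMap.comp_apply, pdL_apply, map_sub, primX_primY]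
  abel

lemma avgY_trC (i j a b : Fin 2) (u : W2 n) : avgY (trC i j a b u) = trC i j a b u := by
  have h := fixed_sub (K := avgY) (P := primX (endpt a)) (fun v => (KX_KY_comm _ _ v))
    ((W2_derivY u i.castSucc j).avgY_sub_primY (endpt b))
    ((W2_derivY u i.succ j).avgY_sub_primY (endpt b))
  rw [trC_apply', h]

lemma trC_eq_cst (i j a b : Fin 2) (u : W2 n) :
    trC i j a b u = cst n (meanL (trC i j a b u)) := by
  rw [← avgX_avgY, avgY_trC, avgX_trC]

/-- The kernel is continuous in its first variable, except where the other one takes values in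
a null set. -/
def BKer.AEContinuous (k : BKer) : Prop :=
  ∀ x₀, ∀ᵐ θ ∂leb1, ContinuousAt (fun x => k.k (x, θ)) x₀

lemma oneK_aeContinuous : oneK.AEContinuous :=
  fun _ => Filter.Eventually.of_forall fun _ => continuousAt_const

lemma stepK_aeContinuous (b : ℝ) : (stepK b).AEContinuous := by
  intro x₀
  have h : ∀ᵐ θ ∂leb1, θ ≠ x₀ := by
    refine ae_restrict_of_ae ?_
    simp [ae_iff]
  filter_upwards [h] with θ hθ
  refine ContinuousAt.sub ?_ continuousAt_const
  rcases lt_or_gt_of_ne hθ with h | h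
  · refine (continuousAt_const (y := (1 : ℝ))).congr ?_
    filter_upwards [lt_mem_nhds h] with x hx
    simp [hx]
  · refine (continuousAt_const (y := (0 : ℝ))).congr ?_
    filter_upwards [gt_mem_nhds h] with x hx
    simp [hx.le]

/-- The primitive from the end point `b` vanishes at `b`. -/
lemma stepK_endpt (b : Fin 2) : ∀ᵐ θ ∂leb1, (stepK (endpt b)).k (endpt b, θ) = 0 := by
  filter_upwards [ae_mem_Ioo_leb1] with θ hθ
  fin_cases b
  · simp [stepK, endpt, hθ.1.le]
  · simp [stepK, endpt, hθ.2]

lemma continuous_dblInt {k l : BKer} (hk : k.AEContinuous) (hl : l.AEContinuous) (v : L2S n) :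
    Continuous (dblInt k l v) := by
  rw [continuous_iff_continuousAt]
  intro p₀
  obtain ⟨C, hC⟩ := k.bdd
  obtain ⟨C', hC'⟩ := l.bdd
  refine continuousAt_of_dominated (bound := fun q => C * C' * ‖v q‖)
    (Filter.Eventually.of_forall fun p => (integrable_dbl k l v p).1)
    (Filter.Eventually.of_forall fun p => Filter.Eventually.of_forall fun q => ?_)
    ((integrable_coeFn v).norm.const_mul _) ?_
  · rw [norm_smul, norm_mul]
    refine mul_le_mul_of_nonneg_right ?_ (norm_nonneg _)
    exact mul_le_mul (hC _) (hC' _) (norm_nonneg _) ((abs_nonneg _).trans (hC (0, 0)))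
  · filter_upwards [ae_fst (hk p₀.1), ae_snd (hl p₀.2)] with q h1 h2
    have c1 : ContinuousAt (fun p : ℝ × ℝ => k.k (p.1, q.1)) p₀ :=
      ContinuousAt.comp (g := fun x => k.k (x, q.1)) (f := Prod.fst) h1 continuousAt_fst
    have c2 : ContinuousAt (fun p : ℝ × ℝ => l.k (p.2, q.2)) p₀ :=
      ContinuousAt.comp (g := fun x => l.k (x, q.2)) (f := Prod.snd) h2 continuousAt_snd
    exact (c1.mul c2).smul continuousAt_const

lemma leb2_eq : leb2 = volume.restrict (Icc (0 : ℝ) 1 ×ˢ Icc (0 : ℝ) 1) := by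
  rw [leb2, leb1, Measure.prod_restrict, Measure.volume_eq_prod]

/-- The value of `repC g` is the one of any continuous representative. -/
lemma repC_eq {g : L2S n} {f : ℝ × ℝ → Vec n} (hf : Continuous f) (h : g =ᵐ[leb2] f)
    {p : ℝ × ℝ} (hp : p ∈ Icc (0 : ℝ) 1 ×ˢ Icc (0 : ℝ) 1) : repC g p = f p := by
  have h1 := Classical.epsilon_spec (p := fun f : ℝ × ℝ → Vec n =>
    ContinuousOn f (Icc 0 1 ×ˢ Icc 0 1) ∧ g =ᵐ[leb2] f) ⟨f, hf.continuousOn, h⟩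
  change ContinuousOn (repC g) _ ∧ g =ᵐ[leb2] repC g at h1
  have h2 : repC g =ᵐ[leb2] f := h1.2.symm.trans h
  rw [leb2_eq] at h2
  refine Measure.eqOn_of_ae_eq h2 h1.1 hf.continuousOn ?_ hp
  rw [interior_prod_eq, closure_prod_eq, interior_Icc, closure_Ioo zero_ne_one]

/-- The values of `repY g` are those of any representative that is continuous in `y`. -/
lemma repY_eq {g : L2S n} {f : ℝ × ℝ → Vec n}
    (hf : ∀ᵐ x ∂leb1, ContinuousOn (fun y => f (x, y)) (Icc 0 1)) (h : g =ᵐ[leb2] f) :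
    ∀ᵐ x ∂leb1, ∀ y ∈ Icc (0 : ℝ) 1, repY g (x, y) = f (x, y) := by
  have h1 := Classical.epsilon_spec (p := fun f : ℝ × ℝ → Vec n =>
    (∀ᵐ x ∂leb1, ContinuousOn (fun y => f (x, y)) (Icc 0 1)) ∧ g =ᵐ[leb2] f) ⟨f, hf, h⟩
  change (∀ᵐ x ∂leb1, ContinuousOn (fun y => repY g (x, y)) _) ∧ g =ᵐ[leb2] repY g at h1
  filter_upwards [h1.1, hf, ae_prod (h1.2.symm.trans h)] with x h2 h3 h4
  exact Measure.eqOn_Icc_of_ae_eq volume zero_ne_one h4 h2 h3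

lemma repX_eq {g : L2S n} {f : ℝ × ℝ → Vec n}
    (hf : ∀ᵐ y ∂leb1, ContinuousOn (fun x => f (x, y)) (Icc 0 1)) (h : g =ᵐ[leb2] f) :
    ∀ᵐ y ∂leb1, ∀ x ∈ Icc (0 : ℝ) 1, repX g (x, y) = f (x, y) := by
  have h1 := Classical.epsilon_spec (p := fun f : ℝ × ℝ → Vec n =>
    (∀ᵐ y ∂leb1, ContinuousOn (fun x => f (x, y)) (Icc 0 1)) ∧ g =ᵐ[leb2] f) ⟨f, hf, h⟩
  change (∀ᵐ y ∂leb1, ContinuousOn (fun x => repX g (x, y)) _) ∧ g =ᵐ[leb2] repX g at h1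
  filter_upwards [h1.1, hf, ae_prod' (h1.2.symm.trans h)] with y h2 h3 h4
  exact Measure.eqOn_Icc_of_ae_eq volume zero_ne_one h4 h2 h3

lemma endpt_mem (b : Fin 2) : endpt b ∈ Icc (0 : ℝ) 1 := by
  fin_cases b <;> simp [endpt]

/-- A corner value is the mean value of the constant `trC`. The continuous representative is
obtained from the double Taylor expansion at the corner `(a, b)`, in which only the constant term
does not vanish there. -/
lemma Lam1_apply (u : W2 n) (c : CornerIdx n) :
    Lam1 u c = meanL (trC c.1.1 c.1.2 c.2.1.1 c.2.1.2 u) c.2.2 := by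
  obtain ⟨⟨i, j⟩, ⟨a, b⟩, k⟩ := c
  show repC (pd i.castSucc j.castSucc u) (endpt a, endpt b) k = meanL (trC i j a b u) k
  set r := pd i.succ j.succ u
  set s := pd i.succ j.castSucc u - primY (endpt b) r with hs
  set t := pd i.castSucc j.succ u - primX (endpt a) r with ht
  set f := fun p => meanL (trC i j a b u) + dblInt (stepK (endpt a)) oneK s p
    + dblInt oneK (stepK (endpt b)) t p + dblInt (stepK (endpt a)) (stepK (endpt b)) r p with hf
  have hfc : Continuous f :=
    ((continuous_const.add (continuous_dblInt (stepK_aeContinuous _) oneK_aeContinuous _)).add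
      (continuous_dblInt oneK_aeContinuous (stepK_aeContinuous _) _)).add
      (continuous_dblInt (stepK_aeContinuous _) (stepK_aeContinuous _) _)
  have h1 : avgY s = s := (W2_derivY u i.succ j).avgY_sub_primY _
  have h2 : avgX t = t := (W2_derivX u i j.succ).avgX_sub_primX _
  have e : pd i.castSucc j.castSucc u = cst n (meanL (trC i j a b u))
      + primX (endpt a) (avgY s) + primY (endpt b) (avgX t)
      + primX (endpt a) (primY (endpt b) r) := by
    rw [h1, h2, ← trC_eq_cst, hs, ht]
    simp only [trC, sub_apply, ContinuousLinearMap.comp_apply, pdL_apply,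
      map_sub, primX_primY]
    abel
  have h : pd i.castSucc j.castSucc u =ᵐ[leb2] f := by
    rw [e]
    filter_upwards [Lp.coeFn_add (cst n (meanL (trC i j a b u)) + primX (endpt a) (avgY s)
      + primY (endpt b) (avgX t)) (primX (endpt a) (primY (endpt b) r)),
      Lp.coeFn_add (cst n (meanL (trC i j a b u)) + primX (endpt a) (avgY s))
        (primY (endpt b) (avgX t)),
      Lp.coeFn_add (cst n (meanL (trC i j a b u))) (primX (endpt a) (avgY s)),
      cst_coe (meanL (trC i j a b u)), KX_KY_coe (stepK (endpt a)) oneK s,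
      KY_KX_coe oneK (stepK (endpt b)) t, KX_KY_coe (stepK (endpt a)) (stepK (endpt b)) r]
      with p h1 h2 h3 h4 h5 h6 h7
    rw [h1, Pi.add_apply, h2, Pi.add_apply, h3, Pi.add_apply, h4, h5, h6, h7]
  rw [repC_eq hfc h ⟨endpt_mem a, endpt_mem b⟩]
  have z1 : ∀ (l : BKer) (v : L2S n), dblInt (stepK (endpt a)) l v (endpt a, endpt b) = 0 := by
    intro l v
    refine integral_eq_zero_of_ae ?_
    filter_upwards [ae_fst (stepK_endpt a)] with q hq
    simp [hq]
  have z2 : dblInt oneK (stepK (endpt b)) t (endpt a, endpt b) = 0 := by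
    refine integral_eq_zero_of_ae ?_
    filter_upwards [ae_snd (stepK_endpt b)] with q hq
    simp [hq]
  rw [hf]
  simp only [z1, z2, add_zero]

/-- The function `x ↦ ∫₀¹ v(x, y) dy` on the interval. -/
def restX : L2S n →L[ℝ] L2I n :=
  intOp (τ := id) (MeasurePreserving.id leb2) (k := fun _ : ℝ × ℝ => 1) measurable_const
    ⟨1, fun _ => by simp⟩

lemma restX_coe (v : L2S n) : restX v =ᵐ[leb1] fun x => ∫ y, v (x, y) ∂leb1 := by
  filter_upwards [intOp_coe (τ := id) (MeasurePreserving.id leb2) (k := fun _ : ℝ × ℝ => 1)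
    measurable_const ⟨1, fun _ => by simp⟩ v] with x hx
  rw [restX, hx]
  simp

/-- On functions that do not depend on `y`, `restX` is the passage to functions of `x`. -/
lemma restX_ae {v : L2S n} (h : avgY v = v) : ∀ᵐ p ∂leb2, restX v p.1 = v p := by
  have h1 := KY_coe oneK v
  rw [show KY oneK v = v from h] at h1
  filter_upwards [ae_fst (restX_coe v), h1] with p h2 h3
  rw [h2, h3]
  simp [oneK]

/-- A function `f` with the weak derivative `r` in `y` has a representative that is continuous in
`y` for almost every `x`. Its values at `y = b` are those of `f - ∫_b^y r`, which does not depend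
on `y`. -/
lemma exists_rep {f r : L2S n} (b : Fin 2)
    (h : avgY (f - primY (endpt b) r) = f - primY (endpt b) r) :
    ∃ F : ℝ × ℝ → Vec n, (∀ᵐ x ∂leb1, ContinuousOn (fun y => F (x, y)) (Icc 0 1)) ∧
      f =ᵐ[leb2] F ∧
      ∀ᵐ x ∂leb1, F (x, endpt b) = restX (f - primY (endpt b) r) x := by
  set s := f - primY (endpt b) r with hs
  refine ⟨fun p => restX s p.1 + ∫ η, (stepK (endpt b)).k (p.2, η) • r (p.1, η) ∂leb1,
    ?_, ?_, ?_⟩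
  · filter_upwards [integrable_sec' r] with x hx
    refine Continuous.continuousOn (continuous_const.add ?_)
    rw [continuous_iff_continuousAt]
    intro y₀
    obtain ⟨C, hC⟩ := (stepK (endpt b)).bdd
    refine continuousAt_of_dominated (bound := fun η => C * ‖r (x, η)‖)
      (Filter.Eventually.of_forall fun y => (integrable_bdd_smul
        ((stepK (endpt b)).meas_sec _) ((stepK (endpt b)).bdd_sec _) hx).1)
      (Filter.Eventually.of_forall fun y => Filter.Eventually.of_forall fun η => ?_)
      (hx.norm.const_mul _) ?_
    · rw [norm_smul]
      exact mul_le_mul_of_nonneg_right (hC _) (norm_nonneg _)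
    · filter_upwards [stepK_aeContinuous (endpt b) y₀] with η hη
      exact hη.smul continuousAt_const
  · have e : f = s + primY (endpt b) r := by rw [hs, sub_add_cancel]
    rw [e]
    filter_upwards [Lp.coeFn_add s (primY (endpt b) r), restX_ae h,
      KY_coe (stepK (endpt b)) r] with p h1 h2 h3
    rw [h1, Pi.add_apply, h2, h3]
  · refine Filter.Eventually.of_forall fun x => ?_
    simp only
    rw [integral_eq_zero_of_ae, add_zero]
    filter_upwards [stepK_endpt b] with η hη
    simp [hη]

lemma repY_trace {f r : L2S n} (b : Fin 2)
    (h : avgY (f - primY (endpt b) r) = f - primY (endpt b) r) :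
    ∀ᵐ x ∂leb1, repY f (x, endpt b) = restX (f - primY (endpt b) r) x := by
  obtain ⟨F, h1, h2, h3⟩ := exists_rep b h
  filter_upwards [repY_eq h1 h2, h3] with x h4 h5
  rw [h4 _ (endpt_mem b), h5]

lemma repX_trace {f r : L2S n} (b : Fin 2)
    (h : avgX (f - primX (endpt b) r) = f - primX (endpt b) r) :
    ∀ᵐ y ∂leb1, repX f (endpt b, y) = restX (swapL (f - primX (endpt b) r)) y := by
  have h' : avgY (swapL f - primY (endpt b) (swapL r))
      = swapL f - primY (endpt b) (swapL r) := by
    rw [← swapL_KX, ← map_sub, ← swapL_KX, h]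
  obtain ⟨F, h1, h2, h3⟩ := exists_rep b h'
  have h4 : f =ᵐ[leb2] fun p => F (p.2, p.1) := by
    filter_upwards [ae_swap h2, ae_swap (swapL_coe f)] with p h5 h6
    rw [← h5, h6]
  filter_upwards [repX_eq (f := fun p => F (p.2, p.1)) h1 h4, h3] with x h5 h6
  rw [h5 _ (endpt_mem b), h6, map_sub swapL, swapL_KX]

lemma Lam2_ae (u : W2 n) :
    ∀ᵐ x ∂leb1, ∀ c : EdgeIdx n, Lam2 u x c = restX (trY c.1 c.2.1 u) x c.2.2 := by
  rw [ae_all_iff]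
  rintro ⟨j, b, k⟩
  filter_upwards [repY_trace b ((W2_derivY u 2 j).avgY_sub_primY (endpt b))] with x hx
  show repY (pd 2 j.castSucc u) (x, endpt b) k = _
  rw [hx]
  rfl

lemma Lam3_ae (u : W2 n) :
    ∀ᵐ y ∂leb1, ∀ c : EdgeIdx n, Lam3 u y c = restX (swapL (trX c.1 c.2.1 u)) y c.2.2 := by
  rw [ae_all_iff]
  rintro ⟨i, b, k⟩
  filter_upwards [repX_trace b ((W2_derivX u i 2).avgX_sub_primX (endpt b))] with y hy
  show repX (pd i.castSucc 2 u) (endpt b, y) k = _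
  rw [hy]
  rfl

lemma Lam2_ae_leb2 (u : W2 n) :
    ∀ᵐ p ∂leb2, ∀ c : EdgeIdx n, Lam2 u p.1 c = trY c.1 c.2.1 u p c.2.2 := by
  have h : ∀ᵐ p ∂leb2, ∀ j b, restX (trY j b u) p.1 = trY j b u p := by
    simp only [ae_all_iff]
    exact fun j b => restX_ae (avgY_trY j b u)
  filter_upwards [ae_fst (Lam2_ae u), h] with p h1 h2 c
  rw [h1, h2]

lemma restX_swapL_ae {v : L2S n} (h : avgX v = v) : ∀ᵐ p ∂leb2, restX (swapL v) p.2 = v p := by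
  have h' : avgY (swapL v) = swapL v := by rw [← swapL_KX, h]
  filter_upwards [ae_swap (restX_ae h'), ae_swap (swapL_coe v)] with p h1 h2
  rw [h1, h2]

lemma Lam3_ae_leb2 (u : W2 n) :
    ∀ᵐ p ∂leb2, ∀ c : EdgeIdx n, Lam3 u p.2 c = trX c.1 c.2.1 u p c.2.2 := by
  have h : ∀ᵐ p ∂leb2, ∀ j b, restX (swapL (trX j b u)) p.2 = trX j b u p := by
    simp only [ae_all_iff]
    exact fun j b => restX_swapL_ae (avgX_trX j b u)
  filter_upwards [ae_snd (Lam3_ae u), h] with p h1 h2 c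
  rw [h1, h2]

/-! ### The boundary operator -/

/-- `mv M` as a continuous linear map. -/
def mvL {ι κ : Type} [Fintype ι] [Fintype κ] (M : Matrix ι κ ℝ) :
    EuclideanSpace ℝ κ →L[ℝ] EuclideanSpace ℝ ι :=
  LinearMap.toContinuousLinearMap
    { toFun := mv M
      map_add' := fun x y => by ext i; simp [mv, Matrix.mulVec_add]
      map_smul' := fun c x => by ext i; simp [mv, Matrix.mulVec_smul] }

lemma mvL_apply {ι κ : Type} [Fintype ι] [Fintype κ] (M : Matrix ι κ ℝ)
    (x : EuclideanSpace ℝ κ) : mvL M x = mv M x := rfl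

lemma mv_apply {ι κ : Type} [Fintype κ] (M : Matrix ι κ ℝ)
    (x : EuclideanSpace ℝ κ) (i : ι) : mv M x i = ∑ k, M i k * x k := rfl

/-- The block of `E` that multiplies the values of `∂ₓⁱ∂ᵧʲ u` at the corner `(a, b)`. -/
def cornerBlock (E : BCMatrix n) (i j a b : Fin 2) : Vec n →L[ℝ] Vec (8 * n) :=
  mvL fun r k => E r (.inl ((i, j), (a, b), k))

/-- The block of `E` that multiplies the values of `∂ₓ²∂ᵧʲ u` on the edge `y = b`. -/
def edgeBlockY (E : BCMatrix n) (j b : Fin 2) : Vec n →L[ℝ] Vec (8 * n) :=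
  mvL fun r k => E r (.inr (.inl (j, b, k)))

/-- The block of `E` that multiplies the values of `∂ₓⁱ∂ᵧ² u` on the edge `x = b`. -/
def edgeBlockX (E : BCMatrix n) (i b : Fin 2) : Vec n →L[ℝ] Vec (8 * n) :=
  mvL fun r k => E r (.inr (.inr (i, b, k)))

lemma cornerBlock_apply (E : BCMatrix n) (i j a b : Fin 2) (x : Vec n) (r : Fin (8 * n)) :
    cornerBlock E i j a b x r = ∑ k, E r (.inl ((i, j), (a, b), k)) * x k := rfl

lemma edgeBlockY_apply (E : BCMatrix n) (j b : Fin 2) (x : Vec n) (r : Fin (8 * n)) :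
    edgeBlockY E j b x r = ∑ k, E r (.inr (.inl (j, b, k))) * x k := rfl

lemma edgeBlockX_apply (E : BCMatrix n) (j b : Fin 2) (x : Vec n) (r : Fin (8 * n)) :
    edgeBlockX E j b x r = ∑ k, E r (.inr (.inr (j, b, k))) * x k := rfl

/-- The contribution of the corner values to the boundary operator. -/
def bdC (E : BCMatrix n) : W2 n →L[ℝ] L2S (8 * n) :=
  ∑ i, ∑ j, ∑ a, ∑ b, liftL (cornerBlock E i j a b) ∘L trC i j a b

/-- The contribution of the edges `y = 0`, `y = 1` to the boundary operator. -/
def bdY (E : BCMatrix n) : W2 n →L[ℝ] L2S (8 * n) :=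
  ∑ j, ∑ b, liftL (edgeBlockY E j b) ∘L trY j b

/-- The contribution of the edges `x = 0`, `x = 1` to the boundary operator. -/
def bdX (E : BCMatrix n) : W2 n →L[ℝ] L2S (8 * n) :=
  ∑ i, ∑ b, liftL (edgeBlockX E i b) ∘L trX i b

/-- The boundary operator `M[E] Λ_bf` as a continuous linear map into `L₂`. -/
def bdL (E : BCMatrix n) : W2 n →L[ℝ] L2S (8 * n) := bdC E + bdY E + bdX E

lemma coeFn_sum {α ι : Type} [MeasurableSpace α] {μ : Measure α} (s : Finset ι)
    (f : ι → Lp (Vec n) 2 μ) : (∑ i ∈ s, f i : Lp (Vec n) 2 μ) =ᵐ[μ] fun a => ∑ i ∈ s, f i a := by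
  classical
  induction s using Finset.induction_on with
  | empty => exact Lp.coeFn_zero (Vec n) 2 μ
  | insert i s hi ih =>
    rw [Finset.sum_insert hi]
    filter_upwards [Lp.coeFn_add (f i) (∑ i ∈ s, f i), ih] with a h1 h2
    rw [h1, Pi.add_apply, h2, Finset.sum_insert hi]

/-- If each term of a finite sum in `L₂` agrees almost everywhere with a function, so does the
sum. -/
lemma coeFn_sum_congr {α ι : Type} [Fintype ι] [MeasurableSpace α] {μ : Measure α}
    {f : ι → Lp (Vec n) 2 μ} {g : ι → α → Vec n} (h : ∀ i, f i =ᵐ[μ] g i) :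
    (∑ i, f i : Lp (Vec n) 2 μ) =ᵐ[μ] fun a => ∑ i, g i a := by
  filter_upwards [coeFn_sum Finset.univ f, ae_all_iff.2 h] with a h1 h2
  rw [h1]
  exact Finset.sum_congr rfl fun i _ => h2 i

/-- The boundary operator of the statement agrees with the continuous linear map `bdL E`. -/
lemma bdry_ae (E : BCMatrix n) (u : W2 n) : bdry E u =ᵐ[leb2] bdL E u := by
  have hC : bdC E u =ᵐ[leb2] fun _ => ∑ i, ∑ j, ∑ a, ∑ b,
      cornerBlock E i j a b (meanL (trC i j a b u)) := by
    simp only [bdC, sum_apply]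
    refine coeFn_sum_congr fun i => coeFn_sum_congr fun j => coeFn_sum_congr fun a =>
      coeFn_sum_congr fun b => ?_
    rw [ContinuousLinearMap.comp_apply]
    conv_lhs => rw [trC_eq_cst]
    rw [liftL_cst]
    exact cst_coe _
  have hY : bdY E u =ᵐ[leb2] fun p => ∑ j, ∑ b, edgeBlockY E j b (trY j b u p) := by
    simp only [bdY, sum_apply]
    exact coeFn_sum_congr fun j => coeFn_sum_congr fun b => liftL_coe _ _
  have hX : bdX E u =ᵐ[leb2] fun p => ∑ j, ∑ b, edgeBlockX E j b (trX j b u p) := by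
    simp only [bdX, sum_apply]
    exact coeFn_sum_congr fun j => coeFn_sum_congr fun b => liftL_coe _ _
  filter_upwards [hC, hY, hX, Lam2_ae_leb2 u, Lam3_ae_leb2 u,
    Lp.coeFn_add (bdC E u + bdY E u) (bdX E u), Lp.coeFn_add (bdC E u) (bdY E u)]
    with p h1 h2 h3 h4 h5 h6 h7
  have e : bdL E u p = bdC E u p + bdY E u p + bdX E u p := by
    rw [← Pi.add_apply (bdC E u : ℝ × ℝ → Vec (8 * n)), ← h7]
    exact h6
  rw [e, h1, h2, h3]
  ext r
  have e1 : bdry E u p r = (∑ c, E r (.inl c) * Lam1 u c)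
      + ((∑ c, E r (.inr (.inl c)) * Lam2 u p.1 c)
      + ∑ c, E r (.inr (.inr c)) * Lam3 u p.2 c) := by
    rw [bdry, mv_apply, Fintype.sum_sum_type, Fintype.sum_sum_type]
    rfl
  rw [e1, ← add_assoc]
  simp only [Lam1_apply, h4, h5, Fintype.sum_prod_type, PiLp.add_apply, WithLp.ofLp_sum,
    Finset.sum_apply, cornerBlock_apply, edgeBlockY_apply, edgeBlockX_apply]

lemma mem_X_iff {E : BCMatrix n} {u : W2 n} : u ∈ X E ↔ bdL E u = 0 := by
  have h : u ∈ X E ↔ bdry E u =ᵐ[leb2] 0 := Iff.rfl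
  rw [h]
  constructor
  · intro h
    exact Lp.ext ((bdry_ae E u).symm.trans (h.trans (Lp.coeFn_zero _ _ _).symm))
  · intro h
    have := bdry_ae E u
    rw [h] at this
    exact this.trans (Lp.coeFn_zero _ _ _)

lemma WellPosedBC.exists_eq {E : BCMatrix n} (hE : WellPosedBC E) (u : W2 n) :
    ∃ h : W2 n, pd 2 2 h = 0 ∧ bdL E h = bdL E u := by
  obtain ⟨h, ⟨h1, h2⟩, -⟩ := hE u
  exact ⟨h, h1, Lp.ext ((bdry_ae E h).symm.trans (h2.trans (bdry_ae E u)))⟩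

lemma WellPosedBC.eq_zero {E : BCMatrix n} (hE : WellPosedBC E) {u : W2 n} (h : pd 2 2 u = 0)
    (hb : bdL E u = 0) : u = 0 := by
  have h0 : (pd 2 2 (0 : W2 n)) = 0 := rfl
  refine (hE 0).unique ⟨h, ?_⟩ ⟨h0, Filter.EventuallyEq.rfl⟩
  refine (bdry_ae E u).trans (Filter.EventuallyEq.trans ?_ (bdry_ae E 0).symm)
  rw [hb, map_zero]

/-! ### Boundary values in terms of Taylor data -/

lemma primX_zero_sub (b : ℝ) (v : L2S n) : primX 0 v - primX b v = b • avgX v := by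
  rw [primX_eq b]; abel

lemma primY_zero_sub (b : ℝ) (v : L2S n) : primY 0 v - primY b v = b • avgY v := by
  rw [primY_eq b]; abel

/-- `v ↦ ∫₀¹ (1 - η) v(·, η) dη` for `j = 0` and `v ↦ ∫₀¹ v(·, η) dη` for `j = 1`. -/
def momY : Fin 2 → L2S n →L[ℝ] L2S n := ![avgY ∘L primY 0, avgY]

/-- `v ↦ ∫₀¹ (1 - θ) v(θ, ·) dθ` for `j = 0` and `v ↦ ∫₀¹ v(θ, ·) dθ` for `j = 1`. -/
def momX : Fin 2 → L2S n →L[ℝ] L2S n := ![avgX ∘L primX 0, avgX]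

lemma avgY_momY (j : Fin 2) (v : L2S n) : avgY (momY j v) = momY j v := by
  fin_cases j <;> simp [momY, avgY_avgY]

lemma avgX_momX (j : Fin 2) (v : L2S n) : avgX (momX j v) = momX j v := by
  fin_cases j <;> simp [momX, avgX_avgX]

/-- `α_j + b α_{j+1}`: the value at `b` of the derivative of order `j` of the polynomial
`α₀ + t α₁`. -/
def edgeVal {M : Type} [AddCommGroup M] [Module ℝ M] (α : Fin 2 → M) (j b : Fin 2) : M :=
  α j + endpt b • (![α 1, 0] : Fin 2 → M) j

/-- The trace on the edge `y = b` in terms of the Taylor data at `y = 0`. -/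
lemma trY_ofTaylor (d : TaylorData n) (j b : Fin 2) :
    trY j b (ofTaylor d) = edgeVal (fun l => d.1 2 l.castSucc) j b
      + endpt b • momY j (d.1 2 2) := by
  have e : trY j b (ofTaylor d) = taylorY (d.1 2) j.castSucc
      - primY (endpt b) (taylorY (d.1 2) j.succ) := rfl
  rw [e, taylorY_castSucc, add_sub_assoc, primY_zero_sub]
  have h1 : avgY (d.1 2 1) = d.1 2 1 := d.2.2 2 1
  fin_cases j
  · simp only [edgeVal, momY]
    have e2 : taylorY (d.1 2) 1 = d.1 2 1 + primY 0 (d.1 2 2) := rfl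
    simp [e2, h1, add_assoc]
  · simp only [edgeVal, momY]
    have e2 : taylorY (d.1 2) 2 = d.1 2 2 := rfl
    simp [e2]

lemma trX_ofTaylor (d : TaylorData n) (j b : Fin 2) :
    trX j b (ofTaylor d) = edgeVal (fun k => d.1 k.castSucc 2) j b
      + endpt b • momX j (d.1 2 2) := by
  have e : trX j b (ofTaylor d) = taylorX (fun k => d.1 k 2) j.castSucc
      - primX (endpt b) (taylorX (fun k => d.1 k 2) j.succ) := rfl
  rw [e, taylorX_castSucc, add_sub_assoc, primX_zero_sub]
  have h1 : avgX (d.1 1 2) = d.1 1 2 := d.2.1 1 2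
  fin_cases j
  · simp only [edgeVal, momX]
    have e2 : taylorX (fun k => d.1 k 2) 1 = d.1 1 2 + primX 0 (d.1 2 2) := rfl
    simp [e2, h1, add_assoc]
  · simp only [edgeVal, momX]
    have e2 : taylorX (fun k => d.1 k 2) 2 = d.1 2 2 := rfl
    simp [e2]

/-- The matrices `P₀`, `P₁` for which `P₀ α₀ + P₁ α₁` is the sum of the products of `N_{jb}` with
the value at `b` of the derivative of order `j` of `α₀ + t α₁`. -/
def edgeMat (N : Fin 2 → Fin 2 → Vec n →L[ℝ] Vec m) : Fin 2 → Vec n →L[ℝ] Vec m :=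
  ![∑ b, N 0 b, ∑ b, (N 1 b + endpt b • N 0 b)]

/-- The contribution of the fundamental state `v` to the values on a pair of edges, for given
moments `K`. -/
def edgeRem (N : Fin 2 → Fin 2 → Vec n →L[ℝ] Vec m) (K : Fin 2 → L2S n →L[ℝ] L2S n) :
    L2S n →L[ℝ] L2S m :=
  ∑ j, ∑ b, endpt b • (liftL (N j b) ∘L K j)

lemma liftL_add (L L' : Vec n →L[ℝ] Vec m) (v : L2S n) :
    liftL (L + L') v = liftL L v + liftL L' v :=
  congrArg (fun f : L2S n →L[ℝ] L2S m => f v) (ContinuousLinearMap.add_compLpL L L')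

lemma liftL_smul (c : ℝ) (L : Vec n →L[ℝ] Vec m) (v : L2S n) :
    liftL (c • L) v = c • liftL L v :=
  congrArg (fun f : L2S n →L[ℝ] L2S m => f v) (ContinuousLinearMap.smul_compLpL c L)

lemma liftL_liftL {k : ℕ} (L : Vec m →L[ℝ] Vec k) (L' : Vec n →L[ℝ] Vec m) (v : L2S n) :
    liftL L (liftL L' v) = liftL (L ∘L L') v := by
  apply Lp.ext
  filter_upwards [liftL_coe L (liftL L' v), liftL_coe L' v, liftL_coe (L ∘L L') v] with p h1 h2 h3
  rw [h1, h2, h3]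
  rfl

lemma liftL_id (v : L2S n) : liftL (.id ℝ (Vec n)) v = v := by
  apply Lp.ext
  filter_upwards [liftL_coe (.id ℝ (Vec n)) v] with p h1
  rw [h1]
  rfl

lemma liftL_zero (v : L2S n) : liftL (0 : Vec n →L[ℝ] Vec m) v = 0 := by
  apply Lp.ext
  filter_upwards [liftL_coe (0 : Vec n →L[ℝ] Vec m) v, Lp.coeFn_zero (Vec m) 2 leb2] with p h1 h2
  rw [h1, h2]
  rfl

/-- Collects the coefficients of the two Taylor data on a pair of edges. -/
lemma sum_edgeVal (N : Fin 2 → Fin 2 → Vec n →L[ℝ] Vec m) (s : Fin 2 → L2S n) :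
    ∑ j, ∑ b, liftL (N j b) (edgeVal s j b) = ∑ l, liftL (edgeMat N l) (s l) := by
  simp only [edgeVal, edgeMat, Fin.sum_univ_two, map_add, map_smul]
  simp only [Matrix.cons_val_zero, Matrix.cons_val_one, liftL_add, liftL_smul, map_zero, smul_zero]
  abel

lemma bdY_ofTaylor (E : BCMatrix n) (d : TaylorData n) :
    bdY E (ofTaylor d) = ∑ l, liftL (edgeMat (edgeBlockY E) l) (d.1 2 l.castSucc)
      + edgeRem (edgeBlockY E) momY (d.1 2 2) := by
  rw [← sum_edgeVal (edgeBlockY E) (fun l => d.1 2 l.castSucc)]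
  simp only [bdY, edgeRem, sum_apply, ContinuousLinearMap.comp_apply,
    smul_apply, trY_ofTaylor, map_add, map_smul, Finset.sum_add_distrib]

lemma bdX_ofTaylor (E : BCMatrix n) (d : TaylorData n) :
    bdX E (ofTaylor d) = ∑ l, liftL (edgeMat (edgeBlockX E) l) (d.1 l.castSucc 2)
      + edgeRem (edgeBlockX E) momX (d.1 2 2) := by
  rw [← sum_edgeVal (edgeBlockX E) (fun l => d.1 l.castSucc 2)]
  simp only [bdX, edgeRem, sum_apply, ContinuousLinearMap.comp_apply,
    smul_apply, trX_ofTaylor, map_add, map_smul, Finset.sum_add_distrib]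

lemma avgY_bdY (E : BCMatrix n) (u : W2 n) : avgY (bdY E u) = bdY E u := by
  simp only [bdY, sum_apply, ContinuousLinearMap.comp_apply, map_sum,
    KY_liftL, avgY_trY]

lemma avgX_bdX (E : BCMatrix n) (u : W2 n) : avgX (bdX E u) = bdX E u := by
  simp only [bdX, sum_apply, ContinuousLinearMap.comp_apply, map_sum,
    KX_liftL, avgX_trX]

lemma avgX_bdC (E : BCMatrix n) (u : W2 n) : avgX (bdC E u) = bdC E u := by
  simp only [bdC, sum_apply, ContinuousLinearMap.comp_apply, map_sum,
    KX_liftL, avgX_trC]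

lemma avgY_bdC (E : BCMatrix n) (u : W2 n) : avgY (bdC E u) = bdC E u := by
  simp only [bdC, sum_apply, ContinuousLinearMap.comp_apply, map_sum,
    KY_liftL, avgY_trC]

/-- A function that depends neither on `x` nor on `y` is constant. -/
lemma eq_cst_of_avg {v : L2S n} (hx : avgX v = v) (hy : avgY v = v) : v = cst n (meanL v) := by
  rw [← avgX_avgY, hy, hx]

/-! ### Functions of one variable with zero moments -/

lemma memLp_fst_smul {f : ℝ → ℝ} (hf : Continuous f) (c : Vec n) :
    MemLp (fun p : ℝ × ℝ => f p.1 • c) 2 leb2 := by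
  obtain ⟨C, hC⟩ := isCompact_Icc.exists_bound_of_continuousOn (hf.continuousOn (s := Icc 0 1))
  refine MemLp.of_bound (hf.comp continuous_fst |>.smul continuous_const).aestronglyMeasurable
    (C * ‖c‖) ?_
  filter_upwards [ae_fst ae_mem_leb1] with p hp
  rw [norm_smul]
  exact mul_le_mul_of_nonneg_right (hC _ hp) (norm_nonneg _)

/-- The function `f(x) c` on the square. -/
def fnX {f : ℝ → ℝ} (hf : Continuous f) (c : Vec n) : L2S n := (memLp_fst_smul hf c).toLp

lemma fnX_coe {f : ℝ → ℝ} (hf : Continuous f) (c : Vec n) :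
    fnX hf c =ᵐ[leb2] fun p => f p.1 • c := MemLp.coeFn_toLp _

lemma avgY_fnX {f : ℝ → ℝ} (hf : Continuous f) (c : Vec n) : avgY (fnX hf c) = fnX hf c := by
  apply Lp.ext
  filter_upwards [KY_coe oneK (fnX hf c), fnX_coe hf c, ae_fst (ae_prod (fnX_coe hf c))]
    with p h1 h2 h3
  rw [h1, h2, integral_congr_ae (g := fun _ => f p.1 • c)]
  · simp
  · filter_upwards [h3] with η hη
    simp [hη, oneK]

lemma avgX_fnX {f F : ℝ → ℝ} (hf : Continuous f) (hF : ∀ x, HasDerivAt F (f x) x) (c : Vec n) :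
    avgX (fnX hf c) = cst n ((F 1 - F 0) • c) := by
  apply Lp.ext
  filter_upwards [KX_coe oneK (fnX hf c), cst_coe ((F 1 - F 0) • c),
    ae_snd (ae_prod' (fnX_coe hf c))] with p h1 h2 h3
  rw [h1, h2, integral_congr_ae (g := fun θ => f θ • c), integral_leb1,
    intervalIntegral.integral_smul_const,
    intervalIntegral.integral_eq_sub_of_hasDerivAt (fun x _ => hF x) (hf.intervalIntegrable _ _)]
  filter_upwards [h3] with θ hθ
  simp [hθ, oneK]

/-- Integrals over `[0, x]`, written with the Heaviside kernel. -/
lemma integral_leb1_ite' {E : Type} [NormedAddCommGroup E] [NormedSpace ℝ E] (f : ℝ → E) {t : ℝ}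
    (ht : t ∈ Icc (0 : ℝ) 1) :
    ∫ x, (if x < t then f x else 0) ∂leb1 = ∫ x in (0 : ℝ)..t, f x := by
  rw [intervalIntegral.integral_of_le ht.1, integral_Ioc_eq_integral_Ioo]
  have : (fun x => if x < t then f x else 0) = (Iio t).indicator f := by
    ext x; simp [indicator]
  rw [this, integral_indicator measurableSet_Iio, leb1, ← Measure.restrict_congr_set
    (Ico_ae_eq_Icc (μ := volume) (a := (0 : ℝ)) (b := 1)),
    Measure.restrict_restrict measurableSet_Iio, ← integral_Ico_eq_integral_Ioo]
  congr 2
  ext x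
  simp only [mem_inter_iff, mem_Iio, mem_Ico]
  constructor
  · rintro ⟨h1, h2, h3⟩; exact ⟨h2, h1⟩
  · rintro ⟨h1, h2⟩; exact ⟨h2, h1, h2.trans_le ht.2⟩

lemma primX_fnX {f F : ℝ → ℝ} (hf : Continuous f) (hF : ∀ x, HasDerivAt F (f x) x) (h0 : F 0 = 0)
    (hFc : Continuous F) (c : Vec n) : primX 0 (fnX hf c) = fnX hFc c := by
  apply Lp.ext
  filter_upwards [KX_coe (stepK 0) (fnX hf c), fnX_coe hFc c,
    ae_snd (ae_prod' (fnX_coe hf c)), ae_fst ae_mem_leb1] with p h1 h2 h3 h4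
  rw [h1, h2, integral_congr_ae (g := fun θ => if θ < p.1 then f θ • c else 0),
    integral_leb1_ite' _ h4, intervalIntegral.integral_smul_const,
    intervalIntegral.integral_eq_sub_of_hasDerivAt (fun x _ => hF x) (hf.intervalIntegrable _ _),
    h0, sub_zero]
  filter_upwards [h3] with θ hθ
  simp [hθ, stepK]

/-- The second derivative of `x² (1 - x)² c`. As this function vanishes at `0` and `1` together with
its derivative, `ortho c` is orthogonal to `1` and `x`. -/
def ortho (c : Vec n) : L2S n :=
  fnX (f := fun x : ℝ => 2 - 12 * x + 12 * x ^ 2) (by fun_prop) c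

lemma avgY_ortho (c : Vec n) : avgY (ortho c) = ortho c := avgY_fnX _ _

lemma hasDerivAt_ortho (x : ℝ) : HasDerivAt (fun x : ℝ => 2 * x - 6 * x ^ 2 + 4 * x ^ 3)
    (2 - 12 * x + 12 * x ^ 2) x := by
  refine ((((hasDerivAt_id' x).const_mul 2).sub ((hasDerivAt_pow 2 x).const_mul 6)).add
    ((hasDerivAt_pow 3 x).const_mul 4)).congr_deriv ?_
  norm_num
  ring

lemma hasDerivAt_ortho' (x : ℝ) : HasDerivAt (fun x : ℝ => x ^ 2 - 2 * x ^ 3 + x ^ 4)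
    (2 * x - 6 * x ^ 2 + 4 * x ^ 3) x := by
  refine (((hasDerivAt_pow 2 x).sub ((hasDerivAt_pow 3 x).const_mul 2)).add
    (hasDerivAt_pow 4 x)).congr_deriv ?_
  norm_num
  ring

lemma hasDerivAt_ortho'' (x : ℝ) :
    HasDerivAt (fun x : ℝ => x ^ 3 / 3 - x ^ 4 / 2 + x ^ 5 / 5) (x ^ 2 - 2 * x ^ 3 + x ^ 4) x := by
  refine ((((hasDerivAt_pow 3 x).div_const 3).sub ((hasDerivAt_pow 4 x).div_const 2)).add
    ((hasDerivAt_pow 5 x).div_const 5)).congr_deriv ?_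
  norm_num
  ring

lemma avgX_ortho (c : Vec n) : avgX (ortho c) = 0 := by
  rw [ortho, avgX_fnX _ hasDerivAt_ortho]
  norm_num

lemma primX_ortho (c : Vec n) : primX 0 (ortho c)
    = fnX (f := fun x : ℝ => 2 * x - 6 * x ^ 2 + 4 * x ^ 3) (by fun_prop) c :=
  primX_fnX _ hasDerivAt_ortho (by norm_num) _ c

lemma avgX_primX_ortho (c : Vec n) : avgX (primX 0 (ortho c)) = 0 := by
  rw [primX_ortho, avgX_fnX _ hasDerivAt_ortho']
  norm_num

lemma ortho_eq_zero {c : Vec n} (h : ortho c = 0) : c = 0 := by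
  have h1 : avgX (primX 0 (primX 0 (ortho c))) = 0 := by rw [h]; simp
  rw [primX_ortho, primX_fnX _ hasDerivAt_ortho' (by norm_num) (by fun_prop),
    avgX_fnX _ hasDerivAt_ortho''] at h1
  have h2 := congrArg meanL h1
  rw [meanL_cst, map_zero] at h2
  norm_num at h2
  exact h2

lemma liftL_ortho (L : Vec n →L[ℝ] Vec m) (c : Vec n) : liftL L (ortho c) = ortho (L c) := by
  apply Lp.ext
  filter_upwards [liftL_coe L (ortho c), fnX_coe (f := fun x : ℝ => 2 - 12 * x + 12 * x ^ 2)
    (by fun_prop) c, fnX_coe (f := fun x : ℝ => 2 - 12 * x + 12 * x ^ 2) (by fun_prop) (L c)]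
    with p h1 h2 h3
  rw [h1, ortho, h2, ortho, h3, map_smul]

lemma ortho_add (c c' : Vec n) : ortho (c + c') = ortho c + ortho c' := by
  apply Lp.ext
  filter_upwards [Lp.coeFn_add (ortho c) (ortho c'),
    fnX_coe (f := fun x : ℝ => 2 - 12 * x + 12 * x ^ 2) (by fun_prop) c,
    fnX_coe (f := fun x : ℝ => 2 - 12 * x + 12 * x ^ 2) (by fun_prop) c',
    fnX_coe (f := fun x : ℝ => 2 - 12 * x + 12 * x ^ 2) (by fun_prop) (c + c')]
    with p h1 h2 h3 h4
  rw [ortho, h4, h1, Pi.add_apply, ortho, ortho, h2, h3, smul_add]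

lemma ortho_zero : ortho (0 : Vec n) = 0 := by
  have := ortho_add (0 : Vec n) 0
  rwa [add_zero, left_eq_add] at this

/-! ### Injectivity of the edge matrices -/

/-- The Taylor data with the constants `c`, the edge functions `α` (of `x`) and `β` (of `y`) and
the fundamental state `v`. -/
def dataFun (c : Fin 2 → Fin 2 → L2S n) (α β : Fin 2 → L2S n) (v : L2S n) :
    Fin 3 → Fin 3 → L2S n :=
  ![![c 0 0, c 0 1, β 0], ![c 1 0, c 1 1, β 1], ![α 0, α 1, v]]

lemma dataFun_mem {c : Fin 2 → Fin 2 → L2S n} {α β : Fin 2 → L2S n} {v : L2S n}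
    (hcx : ∀ k l, avgX (c k l) = c k l) (hcy : ∀ k l, avgY (c k l) = c k l)
    (hα : ∀ l, avgY (α l) = α l) (hβ : ∀ k, avgX (β k) = β k) :
    dataFun c α β v ∈ TaylorData n := by
  constructor
  · intro k l
    fin_cases k <;> fin_cases l
    exacts [hcx 0 0, hcx 0 1, hβ 0, hcx 1 0, hcx 1 1, hβ 1]
  · intro k l
    fin_cases k <;> fin_cases l
    exacts [hcy 0 0, hcy 0 1, hcy 1 0, hcy 1 1, hα 0, hα 1]

/-- A function with zero initial values at `x = 0` whose second derivative `s` has zero moments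
vanishes at `x = 0` and `x = 1` together with its derivative. -/
lemma taylorX_trace_eq_zero (s : L2S n) (h0 : avgX s = 0) (h1 : avgX (primX 0 s) = 0) (i : Fin 2)
    (b : ℝ) : taylorX ![0, 0, s] i.castSucc - primX b (taylorX ![0, 0, s] i.succ) = 0 := by
  rw [taylorX_castSucc, add_sub_assoc, primX_zero_sub]
  have h2 : taylorX ![0, 0, s] 1 = primX 0 s := by
    have := taylorX_castSucc ![0, 0, s] 1
    simpa [taylorX_two] using this
  fin_cases i
  · show (0 : L2S n) + b • avgX (taylorX ![0, 0, s] 1) = 0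
    rw [h2, h1, smul_zero, add_zero]
  · show (0 : L2S n) + b • avgX (taylorX ![0, 0, s] 2) = 0
    rw [taylorX_two]
    simp [h0]

/-- The block matrix that multiplies the two edge functions of `x` is injective: otherwise a
function of `x` with zero moments would give an element of `W₂` without fundamental state and with
zero boundary values. -/
lemma edgeMatY_injective {E : BCMatrix n}
    (hE : ∀ u : W2 n, pd 2 2 u = 0 → bdL E u = 0 → u = 0) {α : Fin 2 → Vec n}
    (h : ∑ l, edgeMat (edgeBlockY E) l (α l) = 0) : α = 0 := by
  let d : TaylorData n := ⟨dataFun 0 (fun l => ortho (α l)) 0 0,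
    dataFun_mem (by simp) (by simp) (fun l => avgY_ortho _) (by simp)⟩
  have hd2 : ∀ l : Fin 2, d.1 2 l.castSucc = ortho (α l) := by
    intro l; fin_cases l <;> rfl
  have hd22 : d.1 2 2 = 0 := rfl
  have hdk2 : ∀ k : Fin 2, d.1 k.castSucc 2 = 0 := by
    intro k; fin_cases k <;> rfl
  -- the corner values vanish, since `∂ₓ² u` has zero moments in `x`
  have hC : bdC E (ofTaylor d) = 0 := by
    have hs : ∀ j, (fun k => taylorY (d.1 k) j) = ![0, 0, taylorY (d.1 2) j] := by
      intro j
      have hz : taylorY (0 : Fin 3 → L2S n) j = 0 := by rw [map_zero]; rfl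
      have hr : ∀ k : Fin 2, d.1 k.castSucc = 0 := by
        intro k
        funext l
        fin_cases k <;> fin_cases l <;> rfl
      funext k
      fin_cases k
      · show taylorY (d.1 (Fin.castSucc 0)) j = 0
        rw [hr, hz]
      · show taylorY (d.1 (Fin.castSucc 1)) j = 0
        rw [hr, hz]
      · rfl
    have h2 : ∀ K : L2S n →L[ℝ] L2S n, (∀ v, K (primY 0 v) = primY 0 (K v)) →
        (∀ c : Vec n, K (ortho c) = 0) → ∀ j, K (taylorY (d.1 2) j) = 0 := by
      intro K hK h0 j
      rw [taylorY_comm _ hK]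
      have : (fun k => K (d.1 2 k)) = 0 := by
        funext l
        fin_cases l
        · exact h0 _
        · exact h0 _
        · exact map_zero K
      rw [this, map_zero]
      rfl
    have h3 : ∀ j, avgX (taylorY (d.1 2) j) = 0 :=
      h2 avgX (fun v => (KX_KY_comm _ _ v).symm) avgX_ortho
    have h4 : ∀ j, avgX (primX 0 (taylorY (d.1 2) j)) = 0 :=
      h2 (avgX ∘L primX 0) (fun v => by
        simp only [ContinuousLinearMap.comp_apply]
        rw [KX_KY_comm, ← primX_primY]) avgX_primX_ortho
    have htr : ∀ i j a b, trC i j a b (ofTaylor d) = 0 := by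
      intro i j a b
      have e : trC i j a b (ofTaylor d)
        = (taylorX ![0, 0, taylorY (d.1 2) j.castSucc] i.castSucc
            - primX (endpt a) (taylorX ![0, 0, taylorY (d.1 2) j.castSucc] i.succ))
          - primY (endpt b) (taylorX ![0, 0, taylorY (d.1 2) j.succ] i.castSucc
            - primX (endpt a) (taylorX ![0, 0, taylorY (d.1 2) j.succ] i.succ)) := by
        rw [← hs, ← hs]
        rfl
      rw [e, taylorX_trace_eq_zero _ (h3 _) (h4 _), taylorX_trace_eq_zero _ (h3 _) (h4 _),
        map_zero, sub_zero]
    simp only [bdC, sum_apply, ContinuousLinearMap.comp_apply, htr, map_zero, Finset.sum_const_zero]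
  have hb : bdL E (ofTaylor d) = 0 := by
    have e : bdL E (ofTaylor d) = bdC E (ofTaylor d) + bdY E (ofTaylor d) + bdX E (ofTaylor d) :=
      rfl
    rw [e, hC, bdY_ofTaylor, bdX_ofTaylor]
    simp only [hd2, hdk2, hd22, map_zero, Finset.sum_const_zero, add_zero, zero_add, liftL_ortho]
    rw [Fin.sum_univ_two, ← ortho_add,
      ← Fin.sum_univ_two (f := fun l => edgeMat (edgeBlockY E) l (α l)), h, ortho_zero]
  have h0 := ofTaylor_eq_zero (hE _ (pd_two_two_ofTaylor d ▸ hd22) hb)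
  funext l
  exact ortho_eq_zero ((hd2 l).symm.trans (h0 2 _))

/-! ### Exchange of the two variables -/

/-- Exchange of the two variables in `W₂`. -/
def swapW2 (u : W2 n) : W2 n :=
  ⟨fun i j => swapL (pd j i u), fun i j => (W2_derivY u j i).swap,
    fun i j => (W2_derivX u j i).swap⟩

lemma swapW2_swapW2 (u : W2 n) : swapW2 (swapW2 u) = u :=
  W2_ext fun _ _ => swapL_swapL _

lemma pd_swapW2 (i j : Fin 3) (u : W2 n) : pd i j (swapW2 u) = swapL (pd j i u) := rfl

/-- The boundary conditions with the two variables exchanged. -/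
def swapBC (E : BCMatrix n) : BCMatrix n := fun r c => E r <| match c with
  | .inl ((i, j), (a, b), k) => .inl ((j, i), (b, a), k)
  | .inr (.inl c) => .inr (.inr c)
  | .inr (.inr c) => .inr (.inl c)

lemma trC_swapW2 (i j a b : Fin 2) (u : W2 n) :
    trC i j a b (swapW2 u) = swapL (trC j i b a u) := by
  rw [trC_apply' j i]
  simp only [trC, sub_apply, ContinuousLinearMap.comp_apply, pdL_apply, map_sub, pd_swapW2,
    swapL_KX, swapL_KY]

lemma trY_swapW2 (j b : Fin 2) (u : W2 n) : trY j b (swapW2 u) = swapL (trX j b u) := by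
  simp only [trY, trX, sub_apply, ContinuousLinearMap.comp_apply, pdL_apply, map_sub, pd_swapW2,
    swapL_KX]

lemma trX_swapW2 (j b : Fin 2) (u : W2 n) : trX j b (swapW2 u) = swapL (trY j b u) := by
  simp only [trY, trX, sub_apply, ContinuousLinearMap.comp_apply, pdL_apply, map_sub, pd_swapW2,
    swapL_KY]

lemma bdL_swapW2 (E : BCMatrix n) (u : W2 n) :
    bdL (swapBC E) (swapW2 u) = swapL (bdL E u) := by
  have hC : bdC (swapBC E) (swapW2 u) = swapL (bdC E u) := by
    simp only [bdC, sum_apply, ContinuousLinearMap.comp_apply, map_sum, trC_swapW2, swapL_liftL]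
    rw [Finset.sum_comm]
    refine Finset.sum_congr rfl fun i _ => Finset.sum_congr rfl fun j _ => ?_
    rw [Finset.sum_comm]
    rfl
  have hY : bdY (swapBC E) (swapW2 u) = swapL (bdX E u) := by
    simp only [bdX, bdY, sum_apply, ContinuousLinearMap.comp_apply, map_sum, trY_swapW2,
      swapL_liftL]
    rfl
  have hX : bdX (swapBC E) (swapW2 u) = swapL (bdY E u) := by
    simp only [bdX, bdY, sum_apply, ContinuousLinearMap.comp_apply, map_sum, trX_swapW2,
      swapL_liftL]
    rfl
  have e : ∀ (E : BCMatrix n) (u : W2 n), bdL E u = bdC E u + bdY E u + bdX E u :=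
    fun _ _ => rfl
  rw [e, e, hC, hY, hX, map_add, map_add]
  abel

/-- The analogue of `edgeMatY_injective` for the edge functions of `y`. -/
lemma edgeMatX_injective {E : BCMatrix n}
    (hE : ∀ u : W2 n, pd 2 2 u = 0 → bdL E u = 0 → u = 0) {β : Fin 2 → Vec n}
    (h : ∑ l, edgeMat (edgeBlockX E) l (β l) = 0) : β = 0 := by
  refine edgeMatY_injective (E := swapBC E) (fun u h2 hb => ?_) h
  have h1 : swapW2 u = 0 := by
    refine hE _ ?_ ?_
    · rw [pd_swapW2, h2, map_zero]
    · have := bdL_swapW2 E (swapW2 u)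
      rw [swapW2_swapW2, hb] at this
      have h3 := congrArg swapL this
      rwa [swapL_swapL, map_zero, eq_comm] at h3
  rw [← swapW2_swapW2 u, h1]
  exact W2_ext fun _ _ => map_zero swapL

/-! ### Solving the boundary value problem -/

/-- An injective block matrix of edge matrices has a left inverse, also when they act on
functions. -/
lemma exists_edgeInv {N : Fin 2 → Fin 2 → Vec n →L[ℝ] Vec m}
    (hN : ∀ α : Fin 2 → Vec n, ∑ l, edgeMat N l (α l) = 0 → α = 0) :
    ∃ Q : Fin 2 → Vec m →L[ℝ] Vec n, ∀ (l : Fin 2) (s : Fin 2 → L2S n),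
      liftL (Q l) (∑ k, liftL (edgeMat N k) (s k)) = s l := by
  let A : (Fin 2 → Vec n) →ₗ[ℝ] Vec m := ∑ l, (edgeMat N l).toLinearMap ∘ₗ LinearMap.proj l
  have hA : ∀ α, A α = ∑ l, edgeMat N l (α l) := fun α => by
    simp [A]
  obtain ⟨g, hg⟩ := A.exists_leftInverse_of_injective (LinearMap.ker_eq_bot'.2 fun α h =>
    hN α (by rw [← hA, h]))
  refine ⟨fun l => LinearMap.toContinuousLinearMap (LinearMap.proj l ∘ₗ g), fun l s => ?_⟩
  have key : ∀ k, LinearMap.toContinuousLinearMap (LinearMap.proj l ∘ₗ g) ∘L edgeMat N k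
      = if l = k then .id ℝ (Vec n) else 0 := by
    intro k
    ext1 x
    have h1 : A (Pi.single k x) = edgeMat N k x := by
      rw [hA, Finset.sum_eq_single k]
      · simp
      · intro j _ hj
        simp [Pi.single_eq_of_ne hj]
      · simp
    have h2 : g (A (Pi.single k x)) = Pi.single k x := congrArg (fun f => f (Pi.single k x)) hg
    rw [h1] at h2
    have h3 := congrFun h2 l
    refine h3.trans ?_
    split_ifs with hlk
    · subst hlk; simp
    · rw [Pi.single_eq_of_ne hlk]; rfl
  rw [map_sum, Finset.sum_eq_single l]
  · rw [liftL_liftL, key, if_pos rfl, liftL_id]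
  · intro k _ hk
    rw [liftL_liftL, key, if_neg hk.symm, liftL_zero]
  · simp

/-- Values for Taylor data with constant entries: the four constants `d k l`, `k, l < 2`, and the
two entries each on the edges `y = 0` and `x = 0`. -/
abbrev ConstData (n : ℕ) := (Fin 2 → Fin 2 → Vec n) × (Fin 2 → Vec n) × (Fin 2 → Vec n)

lemma dataFun_castSucc_castSucc (c : Fin 2 → Fin 2 → L2S n) (α β : Fin 2 → L2S n) (v : L2S n)
    (k l : Fin 2) : dataFun c α β v k.castSucc l.castSucc = c k l := by
  fin_cases k <;> fin_cases l <;> rfl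

lemma dataFun_two_castSucc (c : Fin 2 → Fin 2 → L2S n) (α β : Fin 2 → L2S n) (v : L2S n)
    (l : Fin 2) : dataFun c α β v 2 l.castSucc = α l := by
  fin_cases l <;> rfl

lemma dataFun_castSucc_two (c : Fin 2 → Fin 2 → L2S n) (α β : Fin 2 → L2S n) (v : L2S n)
    (k : Fin 2) : dataFun c α β v k.castSucc 2 = β k := by
  fin_cases k <;> rfl

lemma TaylorData_ext {d e : TaylorData n}
    (hc : ∀ k l : Fin 2, d.1 k.castSucc l.castSucc = e.1 k.castSucc l.castSucc)
    (hα : ∀ l : Fin 2, d.1 2 l.castSucc = e.1 2 l.castSucc)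
    (hβ : ∀ k : Fin 2, d.1 k.castSucc 2 = e.1 k.castSucc 2) (hv : d.1 2 2 = e.1 2 2) : d = e := by
  refine Subtype.ext (funext fun k => funext fun l => ?_)
  fin_cases k <;> fin_cases l
  exacts [hc 0 0, hc 0 1, hβ 0, hc 1 0, hc 1 1, hβ 1, hα 0, hα 1, hv]

lemma TaylorData_add_apply (d e : TaylorData n) (k l : Fin 3) :
    (d + e).1 k l = d.1 k l + e.1 k l := rfl

section mkData

variable {V : Type} [NormedAddCommGroup V] [NormedSpace ℝ V]

/-- Taylor data depending linearly on a parameter. -/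
def mkData (c : Fin 2 → Fin 2 → V →L[ℝ] L2S n) (α β : Fin 2 → V →L[ℝ] L2S n) (v : V →L[ℝ] L2S n)
    (hcx : ∀ k l x, avgX (c k l x) = c k l x) (hcy : ∀ k l x, avgY (c k l x) = c k l x)
    (hα : ∀ l x, avgY (α l x) = α l x) (hβ : ∀ k x, avgX (β k x) = β k x) :
    V →L[ℝ] TaylorData n :=
  (ContinuousLinearMap.pi fun k => ContinuousLinearMap.pi fun l =>
    (![![c 0 0, c 0 1, β 0], ![c 1 0, c 1 1, β 1], ![α 0, α 1, v]] :
      Fin 3 → Fin 3 → V →L[ℝ] L2S n) k l).codRestrict _ (by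
    intro x
    convert dataFun_mem (v := v x) (fun k l => hcx k l x) (fun k l => hcy k l x)
      (fun l => hα l x) (fun k => hβ k x) using 1
    funext k l
    fin_cases k <;> fin_cases l <;> rfl)

lemma mkData_apply {c : Fin 2 → Fin 2 → V →L[ℝ] L2S n} {α β : Fin 2 → V →L[ℝ] L2S n}
    {v : V →L[ℝ] L2S n} (hcx : ∀ k l x, avgX (c k l x) = c k l x)
    (hcy : ∀ k l x, avgY (c k l x) = c k l x) (hα : ∀ l x, avgY (α l x) = α l x)
    (hβ : ∀ k x, avgX (β k x) = β k x) (x : V) :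
    (mkData c α β v hcx hcy hα hβ x).1
      = dataFun (fun k l => c k l x) (fun l => α l x) (fun k => β k x) (v x) := by
  funext k l
  fin_cases k <;> fin_cases l <;> rfl

end mkData

/-- The Taylor data with constant entries. -/
def constData : ConstData n →L[ℝ] TaylorData n :=
  mkData (fun k l => cst n ∘L .proj l ∘L .proj k ∘L .fst ℝ _ _)
    (fun l => cst n ∘L .proj l ∘L .fst ℝ _ _ ∘L .snd ℝ _ _)
    (fun k => cst n ∘L .proj k ∘L .snd ℝ _ _ ∘L .snd ℝ _ _) 0
    (fun _ _ _ => avgX_cst _) (fun _ _ _ => avgY_cst _) (fun _ _ => avgY_cst _)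
    (fun _ _ => avgX_cst _)

lemma constData_apply (γ : ConstData n) : (constData γ).1 = dataFun (fun k l => cst n (γ.1 k l))
    (fun l => cst n (γ.2.1 l)) (fun k => cst n (γ.2.2 k)) 0 :=
  mkData_apply _ _ _ _ γ

lemma cst_eq_zero {c : Vec n} (h : cst n c = 0) : c = 0 := by
  rw [← meanL_cst c, h, map_zero]

/-- The mean value of the boundary operator, on Taylor data with constant entries. -/
def constBd (E : BCMatrix n) : ConstData n →L[ℝ] Vec (8 * n) :=
  meanL ∘L bdL E ∘L ofTaylor ∘L constData

lemma constBd_apply (E : BCMatrix n) (γ : ConstData n) :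
    constBd E γ = meanL (bdL E (ofTaylor (constData γ))) := rfl

lemma fixed_add {K : L2S n →L[ℝ] L2S n} {f g : L2S n} (hf : K f = f) (hg : K g = g) :
    K (f + g) = f + g := by
  rw [map_add, hf, hg]

lemma pd_sub (i j : Fin 3) (u v : W2 n) : pd i j (u - v) = pd i j u - pd i j v := rfl

/-- For constant Taylor data the boundary operator is constant, so that its mean value determines
it. -/
lemma constBd_injective {E : BCMatrix n} (hE : WellPosedBC E) :
    Function.Injective (constBd E) := by
  rw [injective_iff_map_eq_zero]
  intro γ h
  set d := constData γ with hd
  have h22 : d.1 2 2 = 0 := by rw [hd, constData_apply]; rfl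
  have hα : ∀ l, d.1 2 (Fin.castSucc l) = cst n (γ.2.1 l) := fun l => by
    rw [hd, constData_apply, dataFun_two_castSucc]
  have hβ : ∀ l, d.1 (Fin.castSucc l) 2 = cst n (γ.2.2 l) := fun l => by
    rw [hd, constData_apply, dataFun_castSucc_two]
  have hc : ∀ k l, d.1 (Fin.castSucc k) (Fin.castSucc l) = cst n (γ.1 k l) := fun k l => by
    rw [hd, constData_apply, dataFun_castSucc_castSucc]
  have hY : avgX (bdY E (ofTaylor d)) = bdY E (ofTaylor d) := by
    rw [bdY_ofTaylor, h22, map_zero, add_zero, map_sum]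
    simp only [hα, liftL_cst, avgX_cst]
  have hX : avgY (bdX E (ofTaylor d)) = bdX E (ofTaylor d) := by
    rw [bdX_ofTaylor, h22, map_zero, add_zero, map_sum]
    simp only [hβ, liftL_cst, avgY_cst]
  have hb : bdL E (ofTaylor d) = 0 := by
    rw [eq_cst_of_avg (v := bdL E (ofTaylor d))]
    · rw [← constBd_apply, h, map_zero]
    · exact fixed_add (fixed_add (avgX_bdC E _) hY) (avgX_bdX E _)
    · exact fixed_add (fixed_add (avgY_bdC E _) (avgY_bdY E _)) hX
  have h0 := ofTaylor_eq_zero (hE.eq_zero ((pd_two_two_ofTaylor d).trans h22) hb)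
  refine Prod.ext ?_ (Prod.ext ?_ ?_)
  · funext k l
    exact cst_eq_zero ((hc k l).symm.trans (h0 _ _))
  · funext l
    exact cst_eq_zero ((hα l).symm.trans (h0 _ _))
  · funext k
    exact cst_eq_zero ((hβ k).symm.trans (h0 _ _))

lemma avgY_edgeRem (N : Fin 2 → Fin 2 → Vec n →L[ℝ] Vec m) (v : L2S n) :
    avgY (edgeRem N momY v) = edgeRem N momY v := by
  simp only [edgeRem, sum_apply, smul_apply, ContinuousLinearMap.comp_apply, map_sum,
    map_smul, KY_liftL, avgY_momY]

lemma avgX_edgeRem (N : Fin 2 → Fin 2 → Vec n →L[ℝ] Vec m) (v : L2S n) :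
    avgX (edgeRem N momX v) = edgeRem N momX v := by
  simp only [edgeRem, sum_apply, smul_apply, ContinuousLinearMap.comp_apply, map_sum,
    map_smul, KX_liftL, avgX_momX]

/-- If `f(x) + g(y)` is constant, then so are `f` and `g`. -/
lemma exists_eq_cst {c f g : L2S n} (hcx : avgX c = c) (hcy : avgY c = c) (hf : avgY f = f)
    (hg : avgX g = g) (h : c + f + g = 0) : (∃ a, f = cst n a) ∧ ∃ b, g = cst n b := by
  have ef : f = -(c + g) := by
    rw [eq_neg_iff_add_eq_zero, ← h]; abel
  have eg : g = -(c + f) := by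
    rw [eq_neg_iff_add_eq_zero, ← h]; abel
  refine ⟨⟨_, eq_cst_of_avg ?_ hf⟩, ⟨_, eq_cst_of_avg hg ?_⟩⟩
  · rw [ef, map_neg, fixed_add hcx hg]
  · rw [eg, map_neg, fixed_add hcy hf]

/-- In the equation `M[E] Λ_bf u = 0`, a function of `x` is the negative of a function of `y`,
so that both are constant. -/
lemma edges_eq_cst {E : BCMatrix n} {d : TaylorData n} (h : bdL E (ofTaylor d) = 0) :
    (∃ a, ∑ l, liftL (edgeMat (edgeBlockY E) l) (d.1 2 l.castSucc)
      + edgeRem (edgeBlockY E) momY (d.1 2 2) = cst _ a) ∧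
    ∃ b, ∑ l, liftL (edgeMat (edgeBlockX E) l) (d.1 l.castSucc 2)
      + edgeRem (edgeBlockX E) momX (d.1 2 2) = cst _ b := by
  rw [← bdY_ofTaylor, ← bdX_ofTaylor]
  exact exists_eq_cst (avgX_bdC E _) (avgY_bdC E _) (avgY_bdY E _) (avgX_bdX E _) h

lemma liftL_neg (L : Vec n →L[ℝ] Vec m) (v : L2S n) : liftL (-L) v = - liftL L v := by
  rw [← neg_one_smul ℝ L, liftL_smul, neg_one_smul]

set_option maxHeartbeats 800000 in
/-- The solution operator of the boundary value problem `∂ₓ²∂ᵧ² u = v`, `u ∈ X`, in the form that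
exhibits its structure: up to constants that depend linearly on `v`, the Taylor data on the edges
are linear combinations of the moments of `v` in one variable, with constant matrices. -/
theorem WellPosedBC.exists_solution {E : BCMatrix n} (hE : WellPosedBC E) :
    ∃ (QY QX : Fin 2 → Vec (8 * n) →L[ℝ] Vec n) (γ : L2S n →L[ℝ] ConstData n)
      (d : L2S n →L[ℝ] TaylorData n),
      (∀ v (k l : Fin 2), (d v).1 k.castSucc l.castSucc = cst n ((γ v).1 k l)) ∧
      (∀ v (l : Fin 2), (d v).1 2 l.castSucc
        = cst n ((γ v).2.1 l) + liftL (QY l) (edgeRem (edgeBlockY E) momY v)) ∧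
      (∀ v (k : Fin 2), (d v).1 k.castSucc 2
        = cst n ((γ v).2.2 k) + liftL (QX k) (edgeRem (edgeBlockX E) momX v)) ∧
      (∀ v, (d v).1 2 2 = v) ∧ ∀ v, ofTaylor (d v) ∈ X E := by
  obtain ⟨PY, hPY⟩ := exists_edgeInv fun α => edgeMatY_injective (fun u => hE.eq_zero) (α := α)
  obtain ⟨PX, hPX⟩ := exists_edgeInv fun α => edgeMatX_injective (fun u => hE.eq_zero) (β := α)
  obtain ⟨R, hR⟩ := (constBd E).toLinearMap.exists_leftInverse_of_injective
    (LinearMap.ker_eq_bot.2 (constBd_injective hE))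
  have hR' : ∀ γ, R (constBd E γ) = γ := fun γ => congrArg (fun f => f γ) hR
  set rY := edgeRem (edgeBlockY E) momY with hrY
  set rX := edgeRem (edgeBlockX E) momX with hrX
  have arY : ∀ v, avgY (rY v) = rY v := avgY_edgeRem _
  have arX : ∀ v, avgX (rX v) = rX v := avgX_edgeRem _
  -- the part of the Taylor data that is local in one of the variables
  let d₀ : L2S n →L[ℝ] TaylorData n :=
    mkData (fun _ _ => 0) (fun l => liftL (-PY l) ∘L rY) (fun k => liftL (-PX k) ∘L rX) (.id ℝ _)
      (fun _ _ _ => map_zero _) (fun _ _ _ => map_zero _)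
      (fun l v => by rw [ContinuousLinearMap.comp_apply, KY_liftL, arY])
      (fun k v => by rw [ContinuousLinearMap.comp_apply, KX_liftL, arX])
  have hd₀ : ∀ v, (d₀ v).1 = dataFun (fun _ _ => 0) (fun l => liftL (-PY l) (rY v))
      (fun k => liftL (-PX k) (rX v)) v := fun v => mkData_apply _ _ _ _ v
  clear_value d₀
  -- the constants that correct the mean value of the boundary operator
  let γ : L2S n →L[ℝ] ConstData n :=
    -(LinearMap.toContinuousLinearMap R ∘L meanL ∘L bdL E ∘L ofTaylor ∘L d₀)
  have hγ₀ : ∀ v, γ v = -R (meanL (bdL E (ofTaylor (d₀ v)))) := fun v => rfl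
  clear_value γ
  have hsum : ∀ v, (constData ∘L γ + d₀) v = constData (γ v) + d₀ v := fun v => rfl
  refine ⟨fun l => -PY l, fun k => -PX k, γ, constData ∘L γ + d₀, ?_, ?_, ?_, ?_, ?_⟩
  · intro v k l
    rw [hsum, TaylorData_add_apply, constData_apply, hd₀]
    simp only [dataFun_castSucc_castSucc, add_zero]
  · intro v l
    rw [hsum, TaylorData_add_apply, constData_apply, hd₀]
    simp only [dataFun_two_castSucc]
  · intro v k
    rw [hsum, TaylorData_add_apply, constData_apply, hd₀]
    simp only [dataFun_castSucc_two]
  · intro v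
    rw [hsum, TaylorData_add_apply, constData_apply, hd₀]
    exact zero_add _
  intro v
  -- well-posedness gives some solution, with Taylor data `d`; it is shown to be the one above
  obtain ⟨h, hh, hb⟩ := hE.exists_eq (ofTaylor (d₀ v))
  obtain ⟨d, hd⟩ := exists_ofTaylor_eq (ofTaylor (d₀ v) - h)
  have hX0 : bdL E (ofTaylor d) = 0 := by rw [hd, map_sub, hb, sub_self]
  have h22 : d.1 2 2 = v := by
    rw [← pd_two_two_ofTaylor, hd]
    rw [pd_sub, hh, sub_zero, pd_two_two_ofTaylor, hd₀]
    rfl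
  obtain ⟨⟨a, ha⟩, ⟨b, hb'⟩⟩ := edges_eq_cst hX0
  rw [h22, ← hrY] at ha
  rw [h22, ← hrX] at hb'
  have dY : ∀ l : Fin 2, d.1 2 l.castSucc = cst n (PY l a) + liftL (-PY l) (rY v) := by
    intro l
    rw [← liftL_cst, ← ha, map_add, liftL_neg, hPY l fun l => d.1 2 l.castSucc,
      add_neg_cancel_right]
  have dX : ∀ l : Fin 2, d.1 l.castSucc 2 = cst n (PX l b) + liftL (-PX l) (rX v) := by
    intro l
    rw [← liftL_cst, ← hb', map_add, liftL_neg, hPX l fun l => d.1 l.castSucc 2,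
      add_neg_cancel_right]
  have dC : ∀ k l : Fin 2, d.1 k.castSucc l.castSucc
      = cst n (meanL (d.1 k.castSucc l.castSucc)) := fun k l =>
    eq_cst_of_avg (d.2.1 k _) (d.2.2 _ l)
  set γ' : ConstData n := (fun k l => meanL (d.1 k.castSucc l.castSucc),
    fun l => PY l a, fun l => PX l b) with hγ'
  have hdd : d = constData γ' + d₀ v := by
    refine TaylorData_ext (fun k l => ?_) (fun l => ?_) (fun k => ?_) ?_
    · rw [TaylorData_add_apply, constData_apply, hd₀]
      simp only [dataFun_castSucc_castSucc, add_zero]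
      exact dC k l
    · rw [TaylorData_add_apply, constData_apply, hd₀]
      simp only [dataFun_two_castSucc]
      exact dY l
    · rw [TaylorData_add_apply, constData_apply, hd₀]
      simp only [dataFun_castSucc_two]
      exact dX k
    · rw [TaylorData_add_apply, constData_apply, hd₀]
      exact h22.trans (zero_add _).symm
  -- constants are determined by the boundary condition
  have hγ : γ' = γ v := by
    have h1 : bdL E (ofTaylor (constData γ')) + bdL E (ofTaylor (d₀ v)) = 0 := by
      rw [← map_add, ← map_add, ← hdd, hd, map_sub, hb, sub_self]
    have h2 := congrArg meanL h1
    rw [map_add, map_zero] at h2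
    have h3 : constBd E γ' = - meanL (bdL E (ofTaylor (d₀ v))) := eq_neg_of_add_eq_zero_left h2
    rw [← hR' γ', h3, map_neg, hγ₀]
  rw [mem_X_iff]
  have h4 : (constData ∘L γ + d₀) v = d := by
    rw [hsum, hdd, hγ]
  rw [h4, hd, map_sub, hb, sub_self]

/-! ### Matrix-valued kernels -/

lemma mv_eq_sum (M : Matrix (Fin m) (Fin n) ℝ) (x : Vec n) :
    mv M x = ∑ i, ∑ k, (M i k * x k) • EuclideanSpace.single i (1 : ℝ) := by
  ext r
  rw [mv_apply]
  simp only [WithLp.ofLp_sum, Finset.sum_apply, PiLp.smul_apply, PiLp.single_apply,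
    smul_eq_mul, mul_ite, mul_one, mul_zero]
  rw [Finset.sum_eq_single r]
  · simp
  · intro i _ hi
    simp [hi.symm]
  · simp

lemma memLp_coord {α : Type} [MeasurableSpace α] {μ : Measure α} {p : ENNReal} {f : α → Vec n}
    (hf : MemLp f p μ) (k : Fin n) : MemLp (fun a => f a k) p μ :=
  (EuclideanSpace.proj (𝕜 := ℝ) k).comp_memLp' hf

/-- Hölder's inequality for matrix-vector products. -/
lemma MatMemLp.mv {α : Type} [MeasurableSpace α] {μ : Measure α} {p q r : ENNReal}
    [p.HolderTriple q r] {M : α → Matrix (Fin m) (Fin n) ℝ} (hM : MatMemLp M p μ) {f : α → Vec n}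
    (hf : MemLp f q μ) : MemLp (fun a => PIE2D.mv (M a) (f a)) r μ := by
  simp only [mv_eq_sum]
  refine memLp_finsetSum _ fun i _ => memLp_finsetSum _ fun k _ => ?_
  have h : MemLp (fun a => M a i k * f a k) r μ := (memLp_coord hf k).mul (hM i k)
  exact (ContinuousLinearMap.toSpanSingleton ℝ
    (EuclideanSpace.single i (1 : ℝ) : Vec m)).comp_memLp' h

/-- Hölder's inequality for matrix products. -/
lemma MatMemLp.mul {α : Type} [MeasurableSpace α] {μ : Measure α} {p q r : ENNReal} {l : ℕ}
    [p.HolderTriple q r] {M : α → Matrix (Fin m) (Fin n) ℝ} {N : α → Matrix (Fin n) (Fin l) ℝ}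
    (hM : MatMemLp M p μ) (hN : MatMemLp N q μ) : MatMemLp (fun a => M a * N a) r μ := by
  intro i j
  simp only [Matrix.mul_apply]
  exact memLp_finsetSum _ fun k _ => (hN k j).mul (hM i k)

lemma MatMemLp.add {α : Type} [MeasurableSpace α] {μ : Measure α} {p : ENNReal}
    {M N : α → Matrix (Fin m) (Fin n) ℝ} (hM : MatMemLp M p μ) (hN : MatMemLp N p μ) :
    MatMemLp (fun a => M a + N a) p μ := fun i j => (hM i j).add (hN i j)

lemma MatMemLp.zero {α : Type} [MeasurableSpace α] {μ : Measure α} {p : ENNReal} :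
    MatMemLp (fun _ : α => (0 : Matrix (Fin m) (Fin n) ℝ)) p μ := fun _ _ => MemLp.zero'

/-- The product of square-integrable kernels of separate variables. -/
lemma MatMemLp.mul_prod {α β : Type} [MeasurableSpace α] [MeasurableSpace β] {μ : Measure α}
    {ν : Measure β} [SFinite μ] [SFinite ν] {l : ℕ} {M : α → Matrix (Fin m) (Fin n) ℝ}
    {N : β → Matrix (Fin n) (Fin l) ℝ} (hM : MatMemLp M 2 μ) (hN : MatMemLp N 2 ν) :
    MatMemLp (fun z : α × β => M z.1 * N z.2) 2 (μ.prod ν) := by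
  intro i j
  simp only [Matrix.mul_apply]
  refine memLp_finsetSum _ fun k _ => ?_
  have h1 := (hM i k).1
  have h2 := (hN k j).1
  have h : AEStronglyMeasurable (fun z : α × β => M z.1 i k * N z.2 k j) (μ.prod ν) :=
    h1.comp_fst.mul h2.comp_snd
  rw [memLp_two_iff_integrable_sq h]
  simp only [mul_pow]
  exact ((memLp_two_iff_integrable_sq h1).1 (hM i k)).mul_prod
    ((memLp_two_iff_integrable_sq h2).1 (hN k j))

lemma mv_add_left (M N : Matrix (Fin m) (Fin n) ℝ) (x : Vec n) :
    mv (M + N) x = mv M x + mv N x := by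
  ext i; simp [mv, Matrix.add_mulVec]

lemma mv_mul {l : ℕ} (M : Matrix (Fin m) (Fin n) ℝ) (N : Matrix (Fin n) (Fin l) ℝ) (x : Vec l) :
    mv (M * N) x = mv M (mv N x) := by
  ext i; simp [mv, Matrix.mulVec_mulVec]

lemma mv_zero_left (x : Vec n) : mv (0 : Matrix (Fin m) (Fin n) ℝ) x = 0 := by
  ext i; simp [mv]

lemma mv_one (x : Vec n) : mv (1 : Matrix (Fin n) (Fin n) ℝ) x = x := by
  ext i; simp [mv]

lemma mv_smul_left (c : ℝ) (M : Matrix (Fin m) (Fin n) ℝ) (x : Vec n) :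
    mv (c • M) x = c • mv M x := by
  ext i; simp [mv, Matrix.smul_mulVec]

/-- The matrix of a linear map between spaces of column vectors. -/
def matOf (L : Vec n →L[ℝ] Vec m) : Matrix (Fin m) (Fin n) ℝ :=
  fun i k => L (EuclideanSpace.single k 1) i

lemma vec_eq_sum (x : Vec n) : x = ∑ k, x k • EuclideanSpace.single k (1 : ℝ) := by
  ext i
  simp [Pi.single_apply]

lemma mv_matOf (L : Vec n →L[ℝ] Vec m) (x : Vec n) : mv (matOf L) x = L x := by
  have h : L x = ∑ k, x k • L (EuclideanSpace.single k (1 : ℝ)) := by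
    conv_lhs => rw [vec_eq_sum x]
    simp only [map_sum, map_smul]
  ext i
  rw [mv_apply, h]
  simp [matOf, mul_comm]

/-- The Riesz representation of continuous linear maps from `L₂` to column vectors. -/
lemma exists_kernel (P : L2S n →L[ℝ] Vec m) : ∃ K : ℝ × ℝ → Matrix (Fin m) (Fin n) ℝ,
    MatMemLp K 2 leb2 ∧ ∀ v, P v = ∫ p, mv (K p) (v p) ∂leb2 := by
  let g : Fin m → L2S n := fun i =>
    (InnerProductSpace.toDual ℝ (L2S n)).symm (EuclideanSpace.proj i ∘L P)
  have hg : ∀ i v, P v i = ∫ p, ∑ k, g i p k * v p k ∂leb2 := by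
    intro i v
    have h1 : inner ℝ (g i) v = P v i := by
      simp only [g, InnerProductSpace.toDual_symm_apply]
      rfl
    rw [← h1, L2.inner_def]
    refine integral_congr_ae (Filter.Eventually.of_forall fun p => ?_)
    simp [PiLp.inner_apply, mul_comm]
  have hK : MatMemLp (fun p i k => g i p k : ℝ × ℝ → Matrix (Fin m) (Fin n) ℝ) 2 leb2 :=
    fun i k => memLp_coord (Lp.memLp (g i)) k
  refine ⟨_, hK, fun v => ?_⟩
  have hi : Integrable (fun p => mv (fun i k => g i p k : Matrix (Fin m) (Fin n) ℝ) (v p)) leb2 :=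
    memLp_one_iff_integrable.1 (hK.mv (Lp.memLp v))
  ext i
  rw [hg]
  exact (EuclideanSpace.proj (𝕜 := ℝ) i).integral_comp_comm hi

section kact

variable {Ω B Ω' : Type} [MeasurableSpace Ω] [MeasurableSpace B] [MeasurableSpace Ω']
  {μ : Measure Ω} {μ' : Measure Ω'}

/-- The action `∫ k(a, b) v(τ(a, b)) db` of a matrix-valued kernel. -/
def kact (ν : Measure B) (τ : Ω × B → Ω') (k : Ω × B → Matrix (Fin m) (Fin n) ℝ) (v : Ω' → Vec n)
    (a : Ω) : Vec m := ∫ b, mv (k (a, b)) (v (τ (a, b))) ∂ν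

variable {ν : Measure B} [IsProbabilityMeasure μ] [IsProbabilityMeasure ν]
  [IsProbabilityMeasure μ'] {τ : Ω × B → Ω'}

lemma kact_integrable_prod (hτ : MeasurePreserving τ (μ.prod ν) μ')
    {k : Ω × B → Matrix (Fin m) (Fin n) ℝ} (hk : MatMemLp k 2 (μ.prod ν)) (v : Lp (Vec n) 2 μ') :
    Integrable (fun z => mv (k z) (v (τ z))) (μ.prod ν) :=
  memLp_one_iff_integrable.1 (hk.mv ((Lp.memLp v).comp_measurePreserving hτ))

lemma kact_integrable (hτ : MeasurePreserving τ (μ.prod ν) μ')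
    {k : Ω × B → Matrix (Fin m) (Fin n) ℝ} (hk : MatMemLp k 2 (μ.prod ν)) (v : Lp (Vec n) 2 μ') :
    ∀ᵐ a ∂μ, Integrable (fun b => mv (k (a, b)) (v (τ (a, b)))) ν :=
  (kact_integrable_prod hτ hk v).prod_right_ae

lemma kact_add (hτ : MeasurePreserving τ (μ.prod ν) μ')
    {k k' : Ω × B → Matrix (Fin m) (Fin n) ℝ} (hk : MatMemLp k 2 (μ.prod ν))
    (hk' : MatMemLp k' 2 (μ.prod ν)) (v : Lp (Vec n) 2 μ') :
    ∀ᵐ a ∂μ, kact ν τ (fun z => k z + k' z) v a = kact ν τ k v a + kact ν τ k' v a := by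
  filter_upwards [kact_integrable hτ hk v, kact_integrable hτ hk' v] with a h1 h2
  simp only [kact, mv_add_left]
  exact integral_add h1 h2

lemma kact_mul {l : ℕ} (hτ : MeasurePreserving τ (μ.prod ν) μ') (A : Ω → Matrix (Fin l) (Fin m) ℝ)
    {k : Ω × B → Matrix (Fin m) (Fin n) ℝ} (hk : MatMemLp k 2 (μ.prod ν))
    (v : Lp (Vec n) 2 μ') :
    ∀ᵐ a ∂μ, kact ν τ (fun z => A z.1 * k z) v a = mv (A a) (kact ν τ k v a) := by
  filter_upwards [kact_integrable hτ hk v] with a h1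
  simp only [kact, mv_mul]
  exact (mvL (A a)).integral_comp_comm h1

lemma kact_zero (v : Ω' → Vec n) (a : Ω) :
    kact ν τ (fun _ => (0 : Matrix (Fin m) (Fin n) ℝ)) v a = 0 := by
  simp [kact, mv_zero_left]

lemma MatMemLp.comp_fst_mul {l : ℕ} {p q r : ENNReal} [p.HolderTriple q r]
    {A : Ω → Matrix (Fin l) (Fin m) ℝ} (hA : MatMemLp A p μ)
    {k : Ω × B → Matrix (Fin m) (Fin n) ℝ} (hk : MatMemLp k q (μ.prod ν)) :
    MatMemLp (fun z => A z.1 * k z) r (μ.prod ν) :=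
  MatMemLp.mul (fun i j => (hA i j).comp_fst ν) hk

end kact

/-! ### Operators with partial integral kernels -/

lemma measurePreserving_selY :
    MeasurePreserving (fun z : (ℝ × ℝ) × ℝ => (z.1.1, z.2)) (leb2.prod leb1) leb2 :=
  (measurePreserving_fst (μ := leb1) (ν := leb1)).prod (MeasurePreserving.id leb1)

lemma measurePreserving_selXY :
    MeasurePreserving (fun z : (ℝ × ℝ) × ℝ × ℝ => z.2) (leb2.prod leb2) leb2 :=
  measurePreserving_snd

/-- `F` is given by a multiplier, kernels that act in one of the variables, and a kernel that acts
in both, all of them square-integrable. This is a 2D PI operator whose kernels are not split along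
the diagonals. -/
def IsFullPI (F : L2S n → L2S m) : Prop :=
  ∃ (R₀ : ℝ × ℝ → Matrix (Fin m) (Fin n) ℝ) (k₁ k₂ : (ℝ × ℝ) × ℝ → Matrix (Fin m) (Fin n) ℝ)
    (k₃ : (ℝ × ℝ) × ℝ × ℝ → Matrix (Fin m) (Fin n) ℝ),
    MatMemLp R₀ 2 leb2 ∧ MatMemLp k₁ 2 (leb2.prod leb1) ∧ MatMemLp k₂ 2 (leb2.prod leb1) ∧
    MatMemLp k₃ 2 (leb2.prod leb2) ∧ ∀ v : L2S n, ∀ᵐ p ∂leb2, F v p = mv (R₀ p) (v p)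
      + kact leb1 (fun z : (ℝ × ℝ) × ℝ => (z.2, z.1.2)) k₁ v p
      + kact leb1 (fun z : (ℝ × ℝ) × ℝ => (z.1.1, z.2)) k₂ v p
      + kact leb2 (fun z : (ℝ × ℝ) × ℝ × ℝ => z.2) k₃ v p

lemma IsFullPI.add {F G : L2S n → L2S m} (hF : IsFullPI F) (hG : IsFullPI G) :
    IsFullPI fun v => F v + G v := by
  obtain ⟨R, k₁, k₂, k₃, h0, h1, h2, h3, h⟩ := hF
  obtain ⟨R', k₁', k₂', k₃', h0', h1', h2', h3', h'⟩ := hG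
  refine ⟨_, _, _, _, h0.add h0', h1.add h1', h2.add h2', h3.add h3', fun v => ?_⟩
  filter_upwards [h v, h' v, Lp.coeFn_add (F v) (G v), kact_add measurePreserving_selX h1 h1' v,
    kact_add measurePreserving_selY h2 h2' v, kact_add measurePreserving_selXY h3 h3' v]
    with p e e' e0 e1 e2 e3
  rw [e0, Pi.add_apply, e, e', e1, e2, e3, mv_add_left]
  abel

/-- Multiplication by a bounded matrix-valued function preserves the class. -/
lemma IsFullPI.mul {l : ℕ} {F : L2S n → L2S m} (hF : IsFullPI F)
    {A : ℝ × ℝ → Matrix (Fin l) (Fin m) ℝ} (hA : MatMemLp A ⊤ leb2) {G : L2S n → L2S l}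
    (hG : ∀ v, ∀ᵐ p ∂leb2, G v p = mv (A p) (F v p)) : IsFullPI G := by
  obtain ⟨R, k₁, k₂, k₃, h0, h1, h2, h3, h⟩ := hF
  refine ⟨_, _, _, _, hA.mul h0, hA.comp_fst_mul h1, hA.comp_fst_mul h2, hA.comp_fst_mul h3,
    fun v => ?_⟩
  filter_upwards [h v, hG v, kact_mul measurePreserving_selX A h1 v,
    kact_mul measurePreserving_selY A h2 v, kact_mul measurePreserving_selXY A h3 v]
    with p e e0 e1 e2 e3
  rw [e0, e, e1, e2, e3, mv_mul]
  simp only [← mvL_apply, map_add]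

lemma matMemLp_const {α : Type} [MeasurableSpace α] {μ : Measure α} [IsFiniteMeasure μ]
    (M : Matrix (Fin m) (Fin n) ℝ) (p : ENNReal) : MatMemLp (fun _ : α => M) p μ :=
  fun _ _ => memLp_const _

lemma IsFullPI.liftL {l : ℕ} {F : L2S n → L2S m} (hF : IsFullPI F) (L : Vec m →L[ℝ] Vec l) :
    IsFullPI fun v => liftL L (F v) := by
  refine hF.mul (matMemLp_const (matOf L) ⊤) fun v => ?_
  filter_upwards [liftL_coe L (F v)] with p hp
  rw [hp, mv_matOf]

lemma isFullPI_id : IsFullPI fun v : L2S n => v := by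
  refine ⟨fun _ => 1, fun _ => 0, fun _ => 0, fun _ => 0, matMemLp_const _ _, .zero, .zero, .zero,
    fun v => Filter.Eventually.of_forall fun p => ?_⟩
  simp only [kact_zero, mv_one, add_zero]

lemma matMemLp_smul_one {α : Type} [MeasurableSpace α] {μ : Measure α} [IsFiniteMeasure μ]
    {k : α → ℝ} (hk : Measurable k) (hC : ∃ C, ∀ z, |k z| ≤ C) :
    MatMemLp (fun z => k z • (1 : Matrix (Fin n) (Fin n) ℝ)) 2 μ := by
  obtain ⟨C, hC⟩ := hC
  intro i j
  have h : MemLp k 2 μ := MemLp.of_bound hk.aestronglyMeasurable C (Filter.Eventually.of_forall hC)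
  exact h.mul_const _

lemma mv_smul_one (c : ℝ) (x : Vec n) : mv (c • (1 : Matrix (Fin n) (Fin n) ℝ)) x = c • x := by
  rw [mv_smul_left, mv_one]

lemma isFullPI_KX (k : BKer) : IsFullPI fun v : L2S n => KX k v := by
  refine ⟨fun _ => 0, fun z => k.k (z.1.1, z.2) • 1, fun _ => 0, fun _ => 0, .zero,
    matMemLp_smul_one (k.meas.comp (by fun_prop)) ⟨_, fun z => k.bdd.choose_spec (z.1.1, z.2)⟩,
    .zero, .zero, fun v => ?_⟩
  filter_upwards [KX_coe k v] with p hp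
  simp only [kact, mv_zero_left, integral_zero, add_zero, zero_add, hp, mv_smul_one]

lemma isFullPI_KY (k : BKer) : IsFullPI fun v : L2S n => KY k v := by
  refine ⟨fun _ => 0, fun _ => 0, fun z => k.k (z.1.2, z.2) • 1, fun _ => 0, .zero, .zero,
    matMemLp_smul_one (k.meas.comp (by fun_prop)) ⟨_, fun z => k.bdd.choose_spec (z.1.2, z.2)⟩,
    .zero, fun v => ?_⟩
  filter_upwards [KY_coe k v] with p hp
  simp only [kact, mv_zero_left, integral_zero, add_zero, zero_add, hp, mv_smul_one]

lemma isFullPI_KX_KY (k l : BKer) : IsFullPI fun v : L2S n => KX k (KY l v) := by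
  refine ⟨fun _ => 0, fun _ => 0, fun _ => 0,
    fun z => (k.k (z.1.1, z.2.1) * l.k (z.1.2, z.2.2)) • 1, .zero, .zero, .zero,
    matMemLp_smul_one ?_ ?_, fun v => ?_⟩
  · exact (k.meas.comp (by fun_prop)).mul (l.meas.comp (by fun_prop))
  · obtain ⟨C, hC⟩ := k.bdd
    obtain ⟨C', hC'⟩ := l.bdd
    refine ⟨C * C', fun z => ?_⟩
    rw [abs_mul]
    exact mul_le_mul (hC _) (hC' _) (abs_nonneg _) ((abs_nonneg _).trans (hC (0, 0)))
  · filter_upwards [KX_KY_coe k l v] with p hp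
    simp only [kact, mv_zero_left, integral_zero, add_zero, zero_add, hp, mv_smul_one, dblInt]

/-- Operators of finite rank are integral operators, by the Riesz representation. -/
lemma isFullPI_rank {r : ℕ} (K : Vec r →L[ℝ] L2S m) (γ : L2S n →L[ℝ] Vec r) :
    IsFullPI fun v : L2S n => K (γ v) := by
  obtain ⟨G, hG, hγ⟩ := exists_kernel γ
  let M : ℝ × ℝ → Matrix (Fin m) (Fin r) ℝ := fun p i s => K (EuclideanSpace.single s 1) p i
  have hM : MatMemLp M 2 leb2 := fun i s => memLp_coord (Lp.memLp _) i
  have hKM : ∀ c : Vec r, ∀ᵐ p ∂leb2, K c p = mv (M p) c := by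
    intro c
    have h : K c = ∑ s, c s • K (EuclideanSpace.single s (1 : ℝ)) := by
      conv_lhs => rw [vec_eq_sum c]
      simp only [map_sum, map_smul]
    have h2 := coeFn_sum_congr (f := fun s => c s • K (EuclideanSpace.single s (1 : ℝ)))
      (fun s => Lp.coeFn_smul (c s) (K (EuclideanSpace.single s (1 : ℝ))))
    filter_upwards [h2] with p hp
    rw [h, hp]
    ext i
    rw [mv_apply]
    simp [M, mul_comm]
  refine ⟨fun _ => 0, fun _ => 0, fun _ => 0, fun z => M z.1 * G z.2, .zero, .zero, .zero,
    hM.mul_prod hG, fun v => ?_⟩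
  have hGi : Integrable (fun q => mv (G q) (v q)) leb2 :=
    memLp_one_iff_integrable.1 (hG.mv (Lp.memLp v))
  filter_upwards [hKM (γ v)] with p hp
  simp only [kact, mv_zero_left, integral_zero, add_zero, zero_add, hp, mv_mul]
  rw [hγ]
  exact ((mvL (M p)).integral_comp_comm hGi).symm

/-! ### Splitting the kernels along the diagonals -/

lemma intervalIntegrable_of_leb1 {f : ℝ → Vec n} (hf : Integrable f leb1) {a b : ℝ}
    (ha : a ∈ Icc (0 : ℝ) 1) (hb : b ∈ Icc (0 : ℝ) 1) : IntervalIntegrable f volume a b := by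
  have h : IntegrableOn f (Icc 0 1) := hf
  rw [intervalIntegrable_iff]
  exact h.mono_set (uIoc_subset_uIcc.trans (uIcc_subset_Icc ha hb))

lemma integral_leb1_split {f : ℝ → Vec n} (hf : Integrable f leb1) {x : ℝ}
    (hx : x ∈ Icc (0 : ℝ) 1) :
    ∫ θ, f θ ∂leb1 = (∫ θ in (0 : ℝ)..x, f θ) + ∫ θ in x..(1 : ℝ), f θ := by
  rw [integral_leb1, intervalIntegral.integral_add_adjacent_intervals
    (intervalIntegrable_of_leb1 hf (by simp) hx) (intervalIntegrable_of_leb1 hf hx (by simp))]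

lemma integral_leb2_split {f : ℝ × ℝ → Vec n} (hf : Integrable f leb2) {x y : ℝ}
    (hx : x ∈ Icc (0 : ℝ) 1) (hy : y ∈ Icc (0 : ℝ) 1) :
    ∫ q, f q ∂leb2 = (∫ θ in (0 : ℝ)..x, ∫ η in (0 : ℝ)..y, f (θ, η))
      + (∫ θ in x..(1 : ℝ), ∫ η in (0 : ℝ)..y, f (θ, η))
      + (∫ θ in (0 : ℝ)..x, ∫ η in y..(1 : ℝ), f (θ, η))
      + (∫ θ in x..(1 : ℝ), ∫ η in y..(1 : ℝ), f (θ, η)) := by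
  have hs : ∀ s : Set (ℝ × ℝ), MeasurableSet s →
      Integrable (fun θ => ∫ η, s.indicator f (θ, η) ∂leb1) leb1 :=
    fun s hs => (hf.indicator hs).integral_prod_left
  have h1 : Integrable (fun θ => ∫ η in (0 : ℝ)..y, f (θ, η)) leb1 := by
    refine (hs {q | q.2 < y} (measurableSet_lt measurable_snd measurable_const)).congr
      (Filter.Eventually.of_forall fun θ => ?_)
    simp only [indicator, mem_ofPred_eq]
    exact integral_leb1_ite' (fun η => f (θ, η)) hy
  have h2 : Integrable (fun θ => ∫ η in y..(1 : ℝ), f (θ, η)) leb1 := by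
    refine (hs {q | y < q.2} (measurableSet_lt measurable_const measurable_snd)).congr
      (Filter.Eventually.of_forall fun θ => ?_)
    simp only [indicator, mem_ofPred_eq]
    exact integral_leb1_ite (fun η => f (θ, η)) hy
  have h3 : ∫ q, f q ∂leb2
      = ∫ θ, ((∫ η in (0 : ℝ)..y, f (θ, η)) + ∫ η in y..(1 : ℝ), f (θ, η)) ∂leb1 := by
    rw [integral_leb2 hf]
    refine integral_congr_ae ?_
    filter_upwards [hf.prod_right_ae] with θ hθ using integral_leb1_split hθ hy
  rw [h3, integral_add h1 h2, integral_leb1_split h1 hx, integral_leb1_split h2 hx, ← add_assoc]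

/-- The kernels `R₁₀` and `R₂₀` of the 2D PI operator are both taken to be the same kernel `k₁`, and
similarly for the other ones. -/
lemma IsFullPI.isPI2D {P : L2S n →L[ℝ] L2S m} (hP : IsFullPI fun v => P v) : IsPI2D P := by
  obtain ⟨R, k₁, k₂, k₃, h0, h1, h2, h3, h⟩ := hP
  refine ⟨⟨R, fun p θ => k₁ (p, θ), fun p θ => k₁ (p, θ), fun p η => k₂ (p, η),
    fun p η => k₂ (p, η), fun p q => k₃ (p, q), fun p q => k₃ (p, q), fun p q => k₃ (p, q),
    fun p q => k₃ (p, q), h0, h1, h1, h2, h2, h3, h3, h3, h3⟩, fun v => ?_⟩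
  filter_upwards [h v, ae_fst ae_mem_leb1, ae_snd ae_mem_leb1,
    kact_integrable measurePreserving_selX h1 v, kact_integrable measurePreserving_selY h2 v,
    kact_integrable measurePreserving_selXY h3 v] with p hp hx hy i1 i2 i3
  rw [hp]
  simp only [kact, PIParam.app]
  rw [integral_leb1_split i1 hx, integral_leb1_split i2 hy, integral_leb2_split i3 hx hy]
  abel

/-! ### The algebra generated by partial integrations -/

/-- A composition of at most one integral operator in each of the variables. -/
def word : Option BKer → Option BKer → L2S n →L[ℝ] L2S n
  | none, none => .id ℝ _
  | some k, none => KX k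
  | none, some l => KY l
  | some k, some l => KX k ∘L KY l

/-- Sums of words with constant matrix coefficients and of operators of finite rank. -/
inductive IsWordSum : (L2S n → L2S m) → Prop
  | word (L : Vec n →L[ℝ] Vec m) (k l : Option BKer) : IsWordSum fun v => liftL L (word k l v)
  | rank {r : ℕ} (K : Vec r →L[ℝ] L2S m) (γ : L2S n →L[ℝ] Vec r) : IsWordSum fun v => K (γ v)
  | add {F G : L2S n → L2S m} (hF : IsWordSum F) (hG : IsWordSum G) : IsWordSum fun v => F v + G v

namespace IsWordSum

lemma id : IsWordSum fun v : L2S n => v := by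
  have h := IsWordSum.word (.id ℝ (Vec n)) none none
  simp only [liftL_id] at h
  exact h

lemma liftL {l : ℕ} (L : Vec m →L[ℝ] Vec l) {F : L2S n → L2S m} (hF : IsWordSum F) :
    IsWordSum fun v => liftL L (F v) := by
  induction hF with
  | word L' k l => simpa only [liftL_liftL] using IsWordSum.word (L ∘L L') k l
  | rank K γ => exact .rank (PIE2D.liftL L ∘L K) γ
  | add _ _ h h' => simpa only [map_add] using h.add h'

lemma KX (k : BKer) {F : L2S n → L2S m} (hF : IsWordSum F) : IsWordSum fun v => KX k (F v) := by
  induction hF with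
  | word L k' l' =>
    simp only [KX_liftL]
    cases k' with
    | none => cases l' with
      | none => exact .word L (some k) none
      | some l' => exact .word L (some k) (some l')
    | some k' => cases l' with
      | none => simpa only [KX_comp, PIE2D.word] using IsWordSum.word L (some (k.comp k')) none
      | some l' =>
        simpa only [KX_comp, PIE2D.word, ContinuousLinearMap.comp_apply]
          using IsWordSum.word L (some (k.comp k')) (some l')
  | rank K γ => exact .rank (PIE2D.KX k ∘L K) γ
  | add _ _ h h' => simpa only [map_add] using h.add h'

lemma KY (k : BKer) {F : L2S n → L2S m} (hF : IsWordSum F) : IsWordSum fun v => KY k (F v) := by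
  induction hF with
  | word L k' l' =>
    simp only [KY_liftL]
    cases k' with
    | none => cases l' with
      | none => exact .word L none (some k)
      | some l' => simpa only [KY_comp, PIE2D.word] using IsWordSum.word L none (some (k.comp l'))
    | some k' => cases l' with
      | none =>
        simpa only [KX_KY_comm, PIE2D.word, ContinuousLinearMap.comp_apply]
          using IsWordSum.word L (some k') (some k)
      | some l' =>
        simpa only [KX_KY_comm, KY_comp, PIE2D.word, ContinuousLinearMap.comp_apply]
          using IsWordSum.word L (some k') (some (k.comp l'))
  | rank K γ => exact .rank (PIE2D.KY k ∘L K) γ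
  | add _ _ h h' => simpa only [map_add] using h.add h'

lemma zero : IsWordSum fun _ : L2S n => (0 : L2S m) := by
  simpa using IsWordSum.rank (0 : Vec 0 →L[ℝ] L2S m) 0

lemma smul (c : ℝ) {F : L2S n → L2S m} (hF : IsWordSum F) : IsWordSum fun v => c • F v := by
  simpa only [liftL_smul, liftL_id] using hF.liftL (c • .id ℝ (Vec m))

lemma sum {ι : Type} (s : Finset ι) {F : ι → L2S n → L2S m} (hF : ∀ i, IsWordSum (F i)) :
    IsWordSum fun v => ∑ i ∈ s, F i v := by
  classical
  induction s using Finset.induction_on with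
  | empty => simpa using IsWordSum.zero
  | insert i s hi h => simpa only [Finset.sum_insert hi] using (hF i).add h

lemma isFullPI {F : L2S n → L2S m} (hF : IsWordSum F) : IsFullPI F := by
  induction hF with
  | word L k l =>
    refine IsFullPI.liftL ?_ L
    cases k with
    | none => cases l with
      | none => exact isFullPI_id
      | some l => exact isFullPI_KY l
    | some k => cases l with
      | none => exact isFullPI_KX k
      | some l => exact isFullPI_KX_KY k l
  | rank K γ => exact isFullPI_rank K γ
  | add _ _ h h' => exact h.add h'

end IsWordSum

lemma IsFullPI.sum {ι : Type} (s : Finset ι) {F : ι → L2S n → L2S m} (hF : ∀ i, IsFullPI (F i)) :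
    IsFullPI fun v => ∑ i ∈ s, F i v := by
  classical
  induction s using Finset.induction_on with
  | empty => simpa using IsWordSum.zero.isFullPI
  | insert i s hi h => simpa only [Finset.sum_insert hi] using (hF i).add h

lemma IsWordSum.edgeRem (N : Fin 2 → Fin 2 → Vec n →L[ℝ] Vec m) {K : Fin 2 → L2S n →L[ℝ] L2S n}
    (hK : ∀ j, IsWordSum fun v => K j v) : IsWordSum fun v => edgeRem N K v := by
  have h : ∀ v, PIE2D.edgeRem N K v = ∑ j, ∑ b, endpt b • PIE2D.liftL (N j b) (K j v) := by
    intro v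
    simp [PIE2D.edgeRem]
  simp only [h]
  exact .sum _ fun j => .sum _ fun b => .smul _ (.liftL _ (hK j))

lemma isWordSum_momY (j : Fin 2) : IsWordSum fun v : L2S n => momY j v := by
  fin_cases j
  · exact .KY oneK (.KY (stepK 0) .id)
  · exact .KY oneK .id

lemma isWordSum_momX (j : Fin 2) : IsWordSum fun v : L2S n => momX j v := by
  fin_cases j
  · exact .KX oneK (.KX (stepK 0) .id)
  · exact .KX oneK .id

lemma IsWordSum.cst (g : L2S n →L[ℝ] Vec m) : IsWordSum fun v => cst m (g v) := .rank _ _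

/-- Taylor expansion preserves sums of words. -/
lemma IsWordSum.taylor {d : L2S n → Fin 3 → Fin 3 → L2S m}
    (hd : ∀ k l, IsWordSum fun v => d v k l) (i j : Fin 3) :
    IsWordSum fun v => taylor (d v) i j := by
  simp only [taylor_apply]
  have hY : ∀ k j, IsWordSum fun v => taylorY (d v k) j := by
    intro k j
    induction j using fin3_descend with
    | h2 => exact hd k 2
    | h j ih => simpa only [taylorY_castSucc] using (hd k j.castSucc).add (ih.KY (stepK 0))
  induction i using fin3_descend with
  | h2 => exact hY 2 j
  | h i ih => simpa only [taylorX_castSucc] using (hY i.castSucc j).add (ih.KX (stepK 0))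

/-! ### Partial integral operators onto the edges -/

/-- The function `∫₀¹ F v dy` of `x` is the sum of the integrals of `N(η) v(x, η)` over `η` and of
`G(θ, η) v(θ, η)` over the square. The kernels do not depend on `x`; only for this reason their
products with a square-integrable function of `x` are square-integrable. -/
def IsEdgePI (F : L2S n → L2S m) : Prop :=
  ∃ (N : ℝ → Matrix (Fin m) (Fin n) ℝ) (G : ℝ × ℝ → Matrix (Fin m) (Fin n) ℝ),
    MatMemLp N 2 leb1 ∧ MatMemLp G 2 leb2 ∧ ∀ v : L2S n, ∀ᵐ x ∂leb1, restX (F v) x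
      = ∫ η, mv (N η) (v (x, η)) ∂leb1 + ∫ q, mv (G q) (v q) ∂leb2

lemma integrable_mv_leb2 {G : ℝ × ℝ → Matrix (Fin m) (Fin n) ℝ} (hG : MatMemLp G 2 leb2)
    (v : L2S n) : Integrable (fun q => mv (G q) (v q)) leb2 :=
  memLp_one_iff_integrable.1 (hG.mv (Lp.memLp v))

lemma integrable_mv_leb1 {N : ℝ → Matrix (Fin m) (Fin n) ℝ} (hN : MatMemLp N 2 leb1)
    (v : L2S n) : ∀ᵐ x ∂leb1, Integrable (fun η => mv (N η) (v (x, η))) leb1 := by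
  have h : MatMemLp (fun q : ℝ × ℝ => N q.2) 2 leb2 := fun i k => (hN i k).comp_snd leb1
  exact (integrable_mv_leb2 h v).prod_right_ae

namespace IsEdgePI

lemma add {F F' : L2S n → L2S m} (hF : IsEdgePI F) (hF' : IsEdgePI F') :
    IsEdgePI fun v => F v + F' v := by
  obtain ⟨N, G, hN, hG, h⟩ := hF
  obtain ⟨N', G', hN', hG', h'⟩ := hF'
  refine ⟨_, _, hN.add hN', hG.add hG', fun v => ?_⟩
  filter_upwards [h v, h' v, Lp.coeFn_add (restX (F v)) (restX (F' v)), integrable_mv_leb1 hN v,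
    integrable_mv_leb1 hN' v] with x e e' e0 i i'
  simp only [mv_add_left]
  rw [map_add, e0, Pi.add_apply, e, e', integral_add i i',
    integral_add (integrable_mv_leb2 hG v) (integrable_mv_leb2 hG' v)]
  abel

lemma liftL {l : ℕ} (L : Vec m →L[ℝ] Vec l) {F : L2S n → L2S m} (hF : IsEdgePI F) :
    IsEdgePI fun v => liftL L (F v) := by
  obtain ⟨N, G, hN, hG, h⟩ := hF
  refine ⟨fun η => matOf L * N η, fun q => matOf L * G q,
    MatMemLp.mul (matMemLp_const (matOf L) ⊤) hN, MatMemLp.mul (matMemLp_const (matOf L) ⊤) hG,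
    fun v => ?_⟩
  filter_upwards [h v, integrable_mv_leb1 hN v, restX_coe (PIE2D.liftL L (F v)), restX_coe (F v),
    ae_prod (liftL_coe L (F v)), integrable_sec' (F v)] with x e i e1 e2 e3 i3
  simp only [mv_mul, mv_matOf]
  rw [L.integral_comp_comm i, L.integral_comp_comm (integrable_mv_leb2 hG v), ← map_add, ← e, e1,
    e2, ← L.integral_comp_comm i3]
  exact integral_congr_ae e3

lemma cst (g : L2S n →L[ℝ] Vec m) : IsEdgePI fun v => cst m (g v) := by
  obtain ⟨G, hG, h⟩ := exists_kernel g
  refine ⟨fun _ => 0, G, .zero, hG, fun v => ?_⟩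
  filter_upwards [restX_coe (PIE2D.cst m (g v)), ae_prod (cst_coe (g v))] with x e1 e2
  rw [e1, integral_congr_ae e2]
  simp [mv_zero_left, h]

lemma zero : IsEdgePI fun _ : L2S n => (0 : L2S m) := by
  simpa using IsEdgePI.cst (0 : L2S n →L[ℝ] Vec m)

lemma smul (c : ℝ) {F : L2S n → L2S m} (hF : IsEdgePI F) : IsEdgePI fun v => c • F v := by
  simpa only [liftL_smul, liftL_id] using hF.liftL (c • .id ℝ (Vec m))

lemma sum {ι : Type} (s : Finset ι) {F : ι → L2S n → L2S m} (hF : ∀ i, IsEdgePI (F i)) :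
    IsEdgePI fun v => ∑ i ∈ s, F i v := by
  classical
  induction s using Finset.induction_on with
  | empty => simpa using IsEdgePI.zero
  | insert i s hi h => simpa only [Finset.sum_insert hi] using (hF i).add h

lemma edgeRem (N : Fin 2 → Fin 2 → Vec n →L[ℝ] Vec m) {K : Fin 2 → L2S n →L[ℝ] L2S n}
    (hK : ∀ j, IsEdgePI fun v => K j v) : IsEdgePI fun v => edgeRem N K v := by
  have h : ∀ v, PIE2D.edgeRem N K v = ∑ j, ∑ b, endpt b • PIE2D.liftL (N j b) (K j v) := by
    intro v
    simp [PIE2D.edgeRem]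
  simp only [h]
  exact .sum _ fun j => .sum _ fun b => .smul _ (.liftL _ (hK j))

end IsEdgePI

/-- An integral operator in `y` whose kernel does not depend on the first of its two arguments. -/
lemma isEdgePI_KY {k : BKer} (hk : ∀ y η, k.k (y, η) = k.k (0, η)) :
    IsEdgePI fun v : L2S n => KY k v := by
  refine ⟨fun η => k.k (0, η) • 1, fun _ => 0, matMemLp_smul_one (k.meas_sec 0) (k.bdd_sec 0),
    .zero, fun v => ?_⟩
  filter_upwards [restX_coe (KY k v), ae_prod (KY_coe k v)] with x e1 e2
  rw [e1, integral_congr_ae e2]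
  simp [hk _, mv_smul_one, mv_zero_left]

lemma isEdgePI_momY (j : Fin 2) : IsEdgePI fun v : L2S n => momY j v := by
  fin_cases j
  · have h := isEdgePI_KY (n := n) (k := oneK.comp (stepK 0)) fun y η => rfl
    simp only [← KY_comp] at h
    exact h
  · exact isEdgePI_KY fun y η => rfl

lemma swapL_momX (j : Fin 2) (v : L2S n) : swapL (momX j v) = momY j (swapL v) := by
  fin_cases j
  · exact (swapL_KX _ _).trans (congrArg _ (swapL_KX _ _))
  · exact swapL_KX _ _

/-- The traces on the edges `y = 0` and `y = 1`, expressed as in `trY_ofTaylor`. -/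
lemma isEdgePI_edgeVal {F : Fin 2 → L2S n → L2S n} (hF : ∀ l, IsEdgePI (F l)) (j b : Fin 2) :
    IsEdgePI fun v => edgeVal (fun l => F l v) j b + endpt b • momY j v := by
  refine .add ?_ (.smul _ (isEdgePI_momY j))
  fin_cases j
  · exact (hF 0).add (.smul _ (hF 1))
  · exact (hF 1).add (.smul _ .zero)

/-- Integral operators from functions on the square to functions on the interval, where the first
kernel acts in the second variable only. -/
def IsLinePI (F : L2S n → ℝ → Vec m) : Prop :=
  ∃ (R : ℝ × ℝ → Matrix (Fin m) (Fin n) ℝ) (S : ℝ × ℝ × ℝ → Matrix (Fin m) (Fin n) ℝ),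
    MatMemLp R 2 (leb1.prod leb1) ∧ MatMemLp S 2 (leb1.prod leb2) ∧
    ∀ v : L2S n, ∀ᵐ x ∂leb1, F v x = kact leb1 (fun z : ℝ × ℝ => z) R v x
      + kact leb2 (fun z : ℝ × ℝ × ℝ => z.2) S v x

lemma measurePreserving_id_leb2 :
    MeasurePreserving (fun z : ℝ × ℝ => z) (leb1.prod leb1) leb2 := MeasurePreserving.id _

lemma measurePreserving_snd_leb2 :
    MeasurePreserving (fun z : ℝ × ℝ × ℝ => z.2) (leb1.prod leb2) leb2 := measurePreserving_snd

namespace IsLinePI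

lemma add {F F' : L2S n → ℝ → Vec m} (hF : IsLinePI F) (hF' : IsLinePI F') :
    IsLinePI fun v x => F v x + F' v x := by
  obtain ⟨R, S, hR, hS, h⟩ := hF
  obtain ⟨R', S', hR', hS', h'⟩ := hF'
  refine ⟨_, _, hR.add hR', hS.add hS', fun v => ?_⟩
  filter_upwards [h v, h' v, kact_add measurePreserving_id_leb2 hR hR' v,
    kact_add measurePreserving_snd_leb2 hS hS' v] with x e e' e1 e2
  rw [e, e', e1, e2]
  abel

lemma zero : IsLinePI fun (_ : L2S n) _ => (0 : Vec m) :=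
  ⟨fun _ => 0, fun _ => 0, .zero, .zero, fun v => Filter.Eventually.of_forall fun x => by
    simp [kact, mv_zero_left]⟩

lemma sum {ι : Type} (s : Finset ι) {F : ι → L2S n → ℝ → Vec m} (hF : ∀ i, IsLinePI (F i)) :
    IsLinePI fun v x => ∑ i ∈ s, F i v x := by
  classical
  induction s using Finset.induction_on with
  | empty => simpa using IsLinePI.zero
  | insert i s hi h => simpa only [Finset.sum_insert hi] using (hF i).add h

/-- Both kernels `R₁` and `R₂` of the PI operator are `S`. -/
lemma isPI1DX {F : L2S n → ℝ → Vec m} (hF : IsLinePI F) {P : L2S n →ₗ[ℝ] (ℝ →ₘ[leb1] Vec m)}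
    (hP : ∀ v, P v =ᵐ[leb1] F v) : IsPI1DX P := by
  obtain ⟨R, S, hR, hS, h⟩ := hF
  refine ⟨⟨fun x η => R (x, η), fun x q => S (x, q), fun x q => S (x, q), hR, hS, hS⟩,
    fun v => ?_⟩
  filter_upwards [hP v, h v, ae_mem_leb1, kact_integrable measurePreserving_id_leb2 hR v,
    kact_integrable measurePreserving_snd_leb2 hS v] with x e e' hx i1 i2
  have i2' : Integrable (fun q : ℝ × ℝ => mv (S (x, q)) (v q)) (leb1.prod leb1) := i2
  rw [e, e']
  simp only [kact, PIParam1.appX]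
  rw [← integral_leb1, integral_leb2_symm i2, ← integral_add i1 i2'.integral_prod_right]
  refine integral_congr_ae ?_
  filter_upwards [i2'.prod_left_ae] with η hη
  rw [add_assoc, ← integral_leb1_split hη hx]

/-- The statement for functions of `y` follows by exchange of the variables. -/
lemma isPI1DY {F : L2S n → ℝ → Vec m} (hF : IsLinePI F) {P : L2S n →ₗ[ℝ] (ℝ →ₘ[leb1] Vec m)}
    (hP : ∀ v, P v =ᵐ[leb1] F (swapL v)) : IsPI1DY P := by
  obtain ⟨R, S, hR, hS, h⟩ := hF
  have hS' : MatMemLp (fun z : ℝ × ℝ × ℝ => S (z.1, z.2.swap)) 2 (leb1.prod leb2) := fun i k =>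
    (hS i k).comp_measurePreserving ((MeasurePreserving.id leb1).prod measurePreserving_swap)
  refine ⟨⟨fun y θ => R (y, θ), fun y q => S (y, q.swap), fun y q => S (y, q.swap), hR, hS', hS'⟩,
    fun v => ?_⟩
  filter_upwards [hP v, h (swapL v), ae_mem_leb1,
    kact_integrable measurePreserving_id_leb2 hR (swapL v),
    kact_integrable measurePreserving_snd_leb2 hS' v, ae_prod (swapL_coe v)]
    with y e e' hy i1 i2 hs
  have i2' : Integrable (fun q : ℝ × ℝ => mv (S (y, q.swap)) (v q)) (leb1.prod leb1) := i2
  have e2 : ∫ q, mv (S (y, q)) (swapL v q) ∂leb2 = ∫ q, mv (S (y, q.swap)) (v q) ∂leb2 := by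
    rw [← measurePreserving_swap.integral_comp' (f := MeasurableEquiv.prodComm)]
    refine integral_congr_ae ?_
    filter_upwards [ae_swap (swapL_coe v)] with q hq
    exact congrArg (mv (S (y, q.swap))) hq
  rw [e, e']
  simp only [kact, PIParam1.appY]
  rw [← integral_leb1, e2, integral_leb2 i2, ← integral_add i1 i2'.integral_prod_left]
  refine integral_congr_ae ?_
  filter_upwards [i2'.prod_right_ae, hs] with θ hθ h1
  rw [add_assoc, ← integral_leb1_split hθ hy, h1]

end IsLinePI

/-- Multiplication by a square-integrable function of `x`. -/
lemma IsEdgePI.mul {l : ℕ} {F : L2S n → L2S m} (hF : IsEdgePI F)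
    {M : ℝ → Matrix (Fin l) (Fin m) ℝ} (hM : MatMemLp M 2 leb1) :
    IsLinePI fun v x => mv (M x) (restX (F v) x) := by
  obtain ⟨N, G, hN, hG, h⟩ := hF
  refine ⟨fun z => M z.1 * N z.2, fun z => M z.1 * G z.2, hM.mul_prod hN, hM.mul_prod hG,
    fun v => ?_⟩
  filter_upwards [h v, integrable_mv_leb1 hN v] with x e i
  have h1 := (mvL (M x)).integral_comp_comm i
  have h2 := (mvL (M x)).integral_comp_comm (integrable_mv_leb2 hG v)
  simp only [mvL_apply] at h1 h2
  simp only [kact, mv_mul]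
  rw [h1, h2, e]
  simp only [← mvL_apply, map_add]

/-- The columns of `M` that belong to the normal derivative of order `j` on the edge `b`. -/
def edgeSub (M : Matrix (Fin m) (EdgeIdx n) ℝ) (j b : Fin 2) : Matrix (Fin m) (Fin n) ℝ :=
  fun i k => M i (j, b, k)

lemma mv_edge (M : Matrix (Fin m) (EdgeIdx n) ℝ) {x : EuclideanSpace ℝ (EdgeIdx n)}
    {f : Fin 2 → Fin 2 → Vec n} (h : ∀ c, x c = f c.1 c.2.1 c.2.2) :
    mv M x = ∑ j, ∑ b, mv (edgeSub M j b) (f j b) := by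
  ext i
  rw [mv_apply]
  simp only [Fintype.sum_prod_type, WithLp.ofLp_sum, Finset.sum_apply, mv_apply, edgeSub, h]

lemma MatMemLp.edgeSub {M : ℝ → Matrix (Fin m) (EdgeIdx n) ℝ} {p : ENNReal}
    (hM : MatMemLp M p leb1) (j b : Fin 2) : MatMemLp (fun x => edgeSub (M x) j b) p leb1 :=
  fun i k => hM i (j, b, k)

/-- Multiplication of edge values `W` by a square-integrable matrix-valued function. The products
are integrable, but need not be in `L₂`. -/
def edgeOp {M : ℝ → Matrix (Fin m) (EdgeIdx n) ℝ} (hM : MatMemLp M 2 leb1)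
    (W : Fin 2 → Fin 2 → L2S n →L[ℝ] L2I n) : L2S n →ₗ[ℝ] (ℝ →ₘ[leb1] Vec m) :=
  have hm : ∀ v, MemLp (fun x => ∑ j, ∑ b, mv (edgeSub (M x) j b) (W j b v x)) 1 leb1 :=
    fun v => memLp_finsetSum _ fun j _ => memLp_finsetSum _ fun b _ =>
      (hM.edgeSub j b).mv (Lp.memLp (W j b v))
  { toFun := fun v => AEEqFun.mk _ (hm v).1
    map_add' := fun v v' => by
      rw [AEEqFun.mk_add_mk, AEEqFun.mk_eq_mk]
      have h : ∀ᵐ x ∂leb1, ∀ j b, W j b (v + v') x = W j b v x + W j b v' x := by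
        refine ae_all_iff.2 fun j => ae_all_iff.2 fun b => ?_
        rw [map_add]
        exact Lp.coeFn_add _ _
      filter_upwards [h] with x hx
      simp only [hx, Pi.add_apply]
      simp only [← mvL_apply, map_add, Finset.sum_add_distrib]
    map_smul' := fun c v => by
      rw [RingHom.id_apply, AEEqFun.smul_mk, AEEqFun.mk_eq_mk]
      have h : ∀ᵐ x ∂leb1, ∀ j b, W j b (c • v) x = c • W j b v x := by
        refine ae_all_iff.2 fun j => ae_all_iff.2 fun b => ?_
        rw [map_smul]
        exact Lp.coeFn_smul _ _
      filter_upwards [h] with x hx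
      simp only [hx, Pi.smul_apply]
      simp only [← mvL_apply, map_smul, Finset.smul_sum] }

lemma edgeOp_coe {M : ℝ → Matrix (Fin m) (EdgeIdx n) ℝ} (hM : MatMemLp M 2 leb1)
    (W : Fin 2 → Fin 2 → L2S n →L[ℝ] L2I n) (v : L2S n) :
    edgeOp hM W v =ᵐ[leb1] fun x => ∑ j, ∑ b, mv (edgeSub (M x) j b) (W j b v x) :=
  AEEqFun.coeFn_mk _ _

lemma isPI1DX_edgeOp {M : ℝ → Matrix (Fin m) (EdgeIdx n) ℝ} (hM : MatMemLp M 2 leb1)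
    {W : Fin 2 → Fin 2 → L2S n →L[ℝ] L2I n} {F : Fin 2 → Fin 2 → L2S n → L2S n}
    (hF : ∀ j b, IsEdgePI (F j b)) (hW : ∀ j b v, W j b v = restX (F j b v)) :
    IsPI1DX (edgeOp hM W) := by
  refine IsLinePI.isPI1DX (.sum Finset.univ fun j => .sum Finset.univ fun b =>
    (hF j b).mul (hM.edgeSub j b)) fun v => ?_
  simpa only [hW] using edgeOp_coe hM W v

lemma isPI1DY_edgeOp {M : ℝ → Matrix (Fin m) (EdgeIdx n) ℝ} (hM : MatMemLp M 2 leb1)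
    {W : Fin 2 → Fin 2 → L2S n →L[ℝ] L2I n} {F : Fin 2 → Fin 2 → L2S n → L2S n}
    (hF : ∀ j b, IsEdgePI (F j b)) (hW : ∀ j b v, W j b v = restX (F j b (swapL v))) :
    IsPI1DY (edgeOp hM W) := by
  refine IsLinePI.isPI1DY (.sum Finset.univ fun j => .sum Finset.univ fun b =>
    (hF j b).mul (hM.edgeSub j b)) fun v => ?_
  simpa only [hW] using edgeOp_coe hM W v

/-! ### The inverse of `∂ₓ²∂ᵧ²` on the domain -/

/-- The inverse of `∂ₓ²∂ᵧ²` on `X`, together with the structure of its derivatives and of its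
traces on the edges. -/
theorem WellPosedBC.exists_inverse {E : BCMatrix n} (hE : WellPosedBC E) :
    ∃ S : L2S n →L[ℝ] W2 n, (∀ v, S v ∈ X E) ∧ (∀ v, pd 2 2 (S v) = v) ∧
      (∀ u ∈ X E, S (pd 2 2 u) = u) ∧ (∀ i j, IsWordSum fun v => pd i j (S v)) ∧
      (∀ j b, IsEdgePI fun v => trY j b (S v)) ∧
      ∀ j b, IsEdgePI fun v => swapL (trX j b (S (swapL v))) := by
  obtain ⟨QY, QX, γ, d, hC, hY, hX, h2, hmem⟩ := hE.exists_solution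
  let gC (k l : Fin 2) : L2S n →L[ℝ] Vec n := .proj l ∘L .proj k ∘L .fst ℝ _ _ ∘L γ
  let gY (l : Fin 2) : L2S n →L[ℝ] Vec n := .proj l ∘L .fst ℝ _ _ ∘L .snd ℝ _ _ ∘L γ
  let gX (k : Fin 2) : L2S n →L[ℝ] Vec n := .proj k ∘L .snd ℝ _ _ ∘L .snd ℝ _ _ ∘L γ
  have wC (k l : Fin 2) : IsWordSum fun v => (d v).1 k.castSucc l.castSucc := by
    simp only [hC]
    exact .cst (gC k l)
  have wY (l : Fin 2) : IsWordSum fun v => (d v).1 2 l.castSucc := by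
    simp only [hY]
    exact (IsWordSum.cst (gY l)).add (.liftL _ (.edgeRem _ isWordSum_momY))
  have wX (k : Fin 2) : IsWordSum fun v => (d v).1 k.castSucc 2 := by
    simp only [hX]
    exact (IsWordSum.cst (gX k)).add (.liftL _ (.edgeRem _ isWordSum_momX))
  have w2 : IsWordSum fun v => (d v).1 2 2 := by
    simp only [h2]
    exact .id
  refine ⟨ofTaylor ∘L d, hmem, h2, fun u hu => ?_, fun i j => ?_, fun j b => ?_, fun j b => ?_⟩
  · refine sub_eq_zero.1 (hE.eq_zero ?_ ?_)
    · rw [pd_sub]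
      exact sub_eq_zero.2 (h2 _)
    · rw [map_sub, mem_X_iff.1 hu, ContinuousLinearMap.comp_apply, mem_X_iff.1 (hmem _), sub_zero]
  · simp only [ContinuousLinearMap.comp_apply, pd_ofTaylor]
    refine IsWordSum.taylor (fun k l => ?_) i j
    refine Fin.lastCases ?_ (fun k => ?_) k <;> refine Fin.lastCases ?_ (fun l => ?_) l
    exacts [w2, wY l, wX k, wC k l]
  · simp only [ContinuousLinearMap.comp_apply, trY_ofTaylor, h2]
    refine isEdgePI_edgeVal (fun l => ?_) j b
    simp only [hY]
    exact (IsEdgePI.cst (gY l)).add (.liftL _ (.edgeRem _ isEdgePI_momY))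
  · have hr : ∀ v : L2S n, swapL (edgeRem (edgeBlockX E) momX (swapL v))
        = edgeRem (edgeBlockX E) momY v := by
      intro v
      simp only [edgeRem, sum_apply, smul_apply, ContinuousLinearMap.comp_apply, map_sum, map_smul,
        swapL_liftL, swapL_momX, swapL_swapL]
    have e : ∀ v, swapL (trX j b (ofTaylor (d (swapL v))))
        = edgeVal (fun l => swapL ((d (swapL v)).1 l.castSucc 2)) j b + endpt b • momY j v := by
      intro v
      rw [trX_ofTaylor, h2, map_add, map_smul, swapL_momX, swapL_swapL]
      congr 1
      fin_cases j <;> simp [edgeVal]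
    simp only [ContinuousLinearMap.comp_apply, e]
    refine isEdgePI_edgeVal (F := fun l v => swapL ((d (swapL v)).1 l.castSucc 2)) (fun l => ?_) j b
    simp only [hX, map_add, swapL_cst, swapL_liftL, hr]
    exact (IsEdgePI.cst (gX l ∘L swapL)).add (.liftL _ (.edgeRem _ isEdgePI_momY))

/-! ### Multipliers and integral functionals -/

/-- Multiplication by a bounded matrix-valued function. -/
lemma exists_mul {A : ℝ × ℝ → Matrix (Fin m) (Fin n) ℝ} (hA : MatMemLp A ⊤ leb2) :
    ∃ P : L2S n →L[ℝ] L2S m, ∀ v, P v =ᵐ[leb2] fun p => mv (A p) (v p) := by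
  have hm : ∀ v : L2S n, MemLp (fun p => mv (A p) (v p)) 2 leb2 := fun v => hA.mv (Lp.memLp v)
  have hb : ∀ᵐ p ∂leb2, ∀ i k, ‖A p i k‖ ≤ (eLpNorm (fun p => A p i k) ⊤ leb2).toReal := by
    refine ae_all_iff.2 fun i => ae_all_iff.2 fun k => ?_
    rw [eLpNorm_exponent_top]
    filter_upwards [ae_le_eLpNormEssSup (f := fun p => A p i k) (μ := leb2)] with p hp
    have h := ENNReal.toReal_mono (by simpa using (hA i k).2.ne) hp
    simpa using h
  let L : L2S n →ₗ[ℝ] L2S m :=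
    { toFun := fun v => (hm v).toLp
      map_add' := fun v v' => by
        rw [← MemLp.toLp_add, MemLp.toLp_eq_toLp_iff]
        filter_upwards [Lp.coeFn_add v v'] with p hp
        rw [hp]
        simp only [Pi.add_apply, ← mvL_apply, map_add]
      map_smul' := fun c v => by
        rw [RingHom.id_apply, ← MemLp.toLp_const_smul, MemLp.toLp_eq_toLp_iff]
        filter_upwards [Lp.coeFn_smul c v] with p hp
        rw [hp]
        simp only [Pi.smul_apply, ← mvL_apply, map_smul] }
  refine ⟨L.mkContinuous (∑ i, ∑ k, (eLpNorm (fun p => A p i k) ⊤ leb2).toReal) fun v => ?_,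
    fun v => (hm v).coeFn_toLp⟩
  refine Lp.norm_le_mul_norm_of_ae_le_mul ?_
  filter_upwards [(hm v).coeFn_toLp, hb] with p hp hb
  refine (congrArg norm hp).trans_le ?_
  rw [mv_eq_sum, Finset.sum_mul]
  refine (norm_sum_le _ _).trans (Finset.sum_le_sum fun i _ => ?_)
  rw [Finset.sum_mul]
  refine (norm_sum_le _ _).trans (Finset.sum_le_sum fun k _ => ?_)
  rw [norm_smul, norm_mul, PiLp.norm_single, norm_one, mul_one]
  exact mul_le_mul (hb i k) (PiLp.norm_apply_le (v p) k) (norm_nonneg _) ENNReal.toReal_nonneg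

/-- Multiplication of vectors by a square-integrable matrix-valued function. -/
lemma exists_mult {α : Type} [MeasurableSpace α] {μ : Measure α} [IsFiniteMeasure μ]
    {K : α → Matrix (Fin m) (Fin n) ℝ} (hK : MatMemLp K 2 μ) :
    ∃ P : Vec n →L[ℝ] Lp (Vec m) 2 μ, IsMult K P := by
  have hm : ∀ w : Vec n, MemLp (fun a => mv (K a) w) 2 μ := fun w =>
    hK.mv (memLp_const w : MemLp _ ⊤ μ)
  let L : Vec n →ₗ[ℝ] Lp (Vec m) 2 μ :=
    { toFun := fun w => (hm w).toLp
      map_add' := fun w w' => by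
        rw [← MemLp.toLp_add, MemLp.toLp_eq_toLp_iff]
        refine Filter.Eventually.of_forall fun a => ?_
        simp only [Pi.add_apply, ← mvL_apply, map_add]
      map_smul' := fun c w => by
        rw [RingHom.id_apply, ← MemLp.toLp_const_smul, MemLp.toLp_eq_toLp_iff]
        refine Filter.Eventually.of_forall fun a => ?_
        simp only [Pi.smul_apply, ← mvL_apply, map_smul] }
  exact ⟨LinearMap.toContinuousLinearMap L, hK, fun w => (hm w).coeFn_toLp⟩

/-- The integral operator `∫[K]` is continuous. -/
lemma exists_integral {K : ℝ × ℝ → Matrix (Fin m) (Fin n) ℝ} (hK : MatMemLp K 2 leb2) :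
    ∃ P : L2S n →L[ℝ] Vec m, ∀ v, P v = ∫ p, mv (K p) (v p) ∂leb2 := by
  have hm : ∀ i, MemLp (fun p => (WithLp.toLp 2 (K p i) : Vec n)) 2 leb2 := by
    intro i
    have e : ∀ p, (WithLp.toLp 2 (K p i) : Vec n)
        = ∑ k, K p i k • EuclideanSpace.single k (1 : ℝ) := fun p => vec_eq_sum _
    simp only [e]
    exact memLp_finsetSum _ fun k _ => (ContinuousLinearMap.toSpanSingleton ℝ
      (EuclideanSpace.single k (1 : ℝ) : Vec n)).comp_memLp' (hK i k)
  refine ⟨∑ i, (innerSL ℝ ((hm i).toLp)).smulRight (EuclideanSpace.single i 1), fun v => ?_⟩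
  ext i
  have h1 : (∫ p, mv (K p) (v p) ∂leb2) i = ∫ p, mv (K p) (v p) i ∂leb2 :=
    ((EuclideanSpace.proj (𝕜 := ℝ) i).integral_comp_comm (integrable_mv_leb2 hK v)).symm
  have h2 : inner ℝ ((hm i).toLp) v = ∫ p, mv (K p) (v p) i ∂leb2 := by
    rw [L2.inner_def]
    refine integral_congr_ae ?_
    filter_upwards [(hm i).coeFn_toLp] with p hp
    rw [hp, mv_apply]
    simp [PiLp.inner_apply, mul_comm]
  rw [h1, ← h2]
  simp [sum_apply, Pi.single_apply]

/-- `Λ₁` as a continuous linear map. -/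
def lam1L : W2 n →L[ℝ] EuclideanSpace ℝ (CornerIdx n) :=
  (EuclideanSpace.equiv (CornerIdx n) ℝ).symm.toContinuousLinearMap ∘L
    ContinuousLinearMap.pi fun c => EuclideanSpace.proj c.2.2 ∘L meanL ∘L
      trC c.1.1 c.1.2 c.2.1.1 c.2.1.2

lemma lam1L_apply (u : W2 n) : lam1L u = Lam1 u := by
  ext c
  rw [Lam1_apply]
  rfl

lemma mv_Lam2_ae (u : W2 n) (M : ℝ → Matrix (Fin m) (EdgeIdx n) ℝ) :
    ∀ᵐ x ∂leb1, mv (M x) (Lam2 u x)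
      = ∑ j, ∑ b, mv (edgeSub (M x) j b) (restX (trY j b u) x) := by
  filter_upwards [Lam2_ae u] with x hx
  exact mv_edge _ (f := fun j b => restX (trY j b u) x) hx

lemma mv_Lam3_ae (u : W2 n) (M : ℝ → Matrix (Fin m) (EdgeIdx n) ℝ) :
    ∀ᵐ y ∂leb1, mv (M y) (Lam3 u y)
      = ∑ j, ∑ b, mv (edgeSub (M y) j b) (restX (swapL (trX j b u)) y) := by
  filter_upwards [Lam3_ae u] with y hy
  exact mv_edge _ (f := fun j b => restX (swapL (trX j b u)) y) hy

variable {nu nw nz m₁ m₂ m₃ : ℕ}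

/-! ### The operators of the PIE -/

/-- The operators of the PIE, obtained from the inverse `S` of `∂ₓ²∂ᵧ²` on `X`: the operator `T` is
`S` followed by the embedding of `W₂` in `L₂`, and the others are those of the PDE evaluated at `S
v`. -/
theorem exists_pieSystem (G : PDESystem nu nw nz m₁ m₂ m₃) {S : L2S nu →L[ℝ] W2 nu}
    (hS : ∀ v, S v ∈ X G.E) (h22 : ∀ v, pd 2 2 (S v) = v) (hinv : ∀ u ∈ X G.E, S (pd 2 2 u) = u)
    (hw : ∀ i j, IsWordSum fun v => pd i j (S v)) (hY : ∀ j b, IsEdgePI fun v => trY j b (S v))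
    (hX : ∀ j b, IsEdgePI fun v => swapL (trX j b (S (swapL v)))) :
    ∃ P : PIESystem nu nw nz m₁ m₂ m₃, IsAssociated G P ∧ P.IsPI ∧ ∀ v, P.T v = pd 0 0 (S v) := by
  choose MA hMA using fun i j => exists_mul (G.memLp_A i j)
  choose IC hIC using fun i j => exists_integral (G.memLp_C i j)
  obtain ⟨B, hB⟩ := exists_mult G.memLp_B
  obtain ⟨D₂, hD₂⟩ := exists_mult G.memLp_D₂
  obtain ⟨D₃, hD₃⟩ := exists_mult G.memLp_D₃
  let A : L2S nu →L[ℝ] L2S nu := ∑ i, ∑ j, MA i j ∘L pdL i j ∘L S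
  let C : L2S nu →L[ℝ] Vec nz := ∑ i, ∑ j, IC i j ∘L pdL i j ∘L S
  let W₂ : Fin 2 → Fin 2 → L2S nu →L[ℝ] L2I nu := fun j b => restX ∘L trY j b ∘L S
  let W₃ : Fin 2 → Fin 2 → L2S nu →L[ℝ] L2I nu := fun j b => restX ∘L swapL ∘L trX j b ∘L S
  let P : PIESystem nu nw nz m₁ m₂ m₃ :=
    { T := pdL 0 0 ∘L S
      A := A
      B := B
      C := C
      D := mvL G.D
      Cq₁ := mvL G.C₁ ∘L lam1L ∘L S
      Cq₂ := edgeOp G.memLp_C₂ W₂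
      Cq₃ := edgeOp G.memLp_C₃ W₃
      Dq₁ := mvL G.D₁
      Dq₂ := D₂
      Dq₃ := D₃ }
  have hA : ∀ v, A v = ∑ i, ∑ j, MA i j (pd i j (S v)) := by
    intro v
    simp only [A, sum_apply, ContinuousLinearMap.comp_apply, pdL_apply]
  have hC : ∀ v, C v = ∑ i, ∑ j, IC i j (pd i j (S v)) := by
    intro v
    simp only [C, sum_apply, ContinuousLinearMap.comp_apply, pdL_apply]
  -- functions in `W₂` are determined by their values
  have key : ∀ v (u : W2 nu), pd 0 0 u = P.T v → u = S v := fun v u h =>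
    sub_eq_zero.1 (W2_eq_zero (by rw [pd_sub]; exact sub_eq_zero.2 h))
  refine ⟨P, ⟨fun u hu => ?_, fun v => ⟨S v, hS v, rfl, h22 v⟩, fun v u h => ?_, hB,
    fun v u h => ?_, fun w => rfl, fun v u h => ?_, fun v u h => ?_, fun v u h => ?_,
    fun w => rfl, hD₂, hD₃⟩,
    ⟨?_, ?_, ⟨_, hB⟩, exists_kernel _, exists_kernel _, ?_, ?_, ⟨_, hD₂⟩, ⟨_, hD₃⟩⟩, fun v => rfl⟩
  · exact congrArg (pd 0 0) (hinv u hu)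
  · rw [key v u h]
    change A v =ᵐ[leb2] _
    rw [hA]
    exact coeFn_sum_congr fun i => coeFn_sum_congr fun j => hMA i j _
  · rw [key v u h]
    change C v = _
    rw [hC]
    exact Finset.sum_congr rfl fun i _ => Finset.sum_congr rfl fun j _ => hIC i j _
  · rw [key v u h]
    change mv G.C₁ (lam1L (S v)) = _
    rw [lam1L_apply]
  · rw [key v u h]
    filter_upwards [edgeOp_coe G.memLp_C₂ W₂ v, mv_Lam2_ae (S v) G.C₂] with x h1 h2
    exact h1.trans h2.symm
  · rw [key v u h]
    filter_upwards [edgeOp_coe G.memLp_C₃ W₃ v, mv_Lam3_ae (S v) G.C₃] with x h1 h2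
    exact h1.trans h2.symm
  · exact (hw 0 0).isFullPI.isPI2D
  · refine IsFullPI.isPI2D ?_
    change IsFullPI fun v => A v
    simp only [hA]
    exact .sum _ fun i => .sum _ fun j => (hw i j).isFullPI.mul (G.memLp_A i j) fun v => hMA i j _
  · exact isPI1DX_edgeOp G.memLp_C₂ hY fun j b v => rfl
  · exact isPI1DY_edgeOp G.memLp_C₃ hX fun j b v => by rw [swapL_swapL]; rfl

/-! ### Equivalence of the PDE and the PIE -/

/-- A continuous linear map commutes with the derivative. -/
lemma hasDerivWithinAt_clm {V V' : Type} [NormedAddCommGroup V] [NormedSpace ℝ V]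
    [NormedAddCommGroup V'] [NormedSpace ℝ V'] (L : V →L[ℝ] V') {f : ℝ → V} {g : ℝ → V'}
    {s : Set ℝ} (hg : ∀ t ∈ s, g t = L (f t)) (hf : DifferentiableOn ℝ f s) {t : ℝ} (ht : t ∈ s) :
    HasDerivWithinAt g (L (derivWithin f s t)) s t :=
  (L.hasFDerivAt.comp_hasDerivWithinAt t (hf t ht).hasDerivWithinAt).congr hg (hg t ht)

/-- A trajectory `u` in `X` is `S ∘ v` with `v = ∂ₓ²∂ᵧ² u`, and both maps are continuous and
linear, so that `u` is differentiable into `W₂` if and only if `v` is into `L₂`. -/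
theorem isPDESolution_iff {G : PDESystem nu nw nz m₁ m₂ m₃} {P : PIESystem nu nw nz m₁ m₂ m₃}
    (hGP : IsAssociated G P) {S : L2S nu →L[ℝ] W2 nu} (hinv : ∀ u ∈ X G.E, S (pd 2 2 u) = u)
    (hT : ∀ v, P.T v = pd 0 0 (S v)) {w : ℝ → Vec nw} {u₀ : W2 nu} (hu₀ : u₀ ∈ X G.E)
    {u : ℝ → W2 nu} {z : ℝ → Vec nz} {q₁ : ℝ → Vec m₁} {q₂ : ℝ → L2I m₂} {q₃ : ℝ → L2I m₃} :
    IsPDESolution G w u₀ u z q₁ q₂ q₃ ↔ (∀ t, 0 ≤ t → u t ∈ X G.E) ∧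
      IsPIESolution P w (pd 2 2 u₀) (fun t => pd 2 2 (u t)) z q₁ q₂ q₃ := by
  set v : ℝ → L2S nu := fun t => pd 2 2 (u t) with hv
  -- for functions `u` with values in `X`, the equations agree at every time
  have pw : ∀ t, u t ∈ X G.E → ∀ u' : W2 nu, ∀ v' : L2S nu, u' = S v' →
      ((pd 0 0 u' =ᵐ[leb2] fun p => G.genA (u t) p + mv (G.B p) (w t)) ↔
        P.T v' = P.A (v t) + P.B (w t)) := by
    intro t ht u' v' h
    have hTv : pd 0 0 (u t) = P.T (v t) := (hGP.left_inv _ ht).symm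
    have e : ∀ᵐ p ∂leb2, (P.A (v t) + P.B (w t)) p = G.genA (u t) p + mv (G.B p) (w t) := by
      filter_upwards [Lp.coeFn_add (P.A (v t)) (P.B (w t)), hGP.A _ _ hTv, hGP.B.2 (w t)]
        with p h1 h2 h3
      rw [h1, Pi.add_apply, h2, h3]
    rw [h, ← hT, Lp.ext_iff]
    exact ⟨fun h' => h'.trans (Filter.EventuallyEq.symm e), fun h' => h'.trans e⟩
  have obs : ∀ {k : ℕ} {Q : L2I k} {F : ℝ →ₘ[leb1] Vec k} {H : L2I k} {f h : ℝ → Vec k},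
      F =ᵐ[leb1] f → H =ᵐ[leb1] h →
      ((Q =ᵐ[leb1] fun x => f x + h x) ↔ (Q : ℝ →ₘ[leb1] Vec k) = F + H.1) := by
    intro k Q F H f h hF hH
    have e : (F + H.1 : ℝ →ₘ[leb1] Vec k) =ᵐ[leb1] fun x => f x + h x := by
      filter_upwards [AEEqFun.coeFn_add F H.1, hF, hH] with x h1 h2 h3
      rw [h1, Pi.add_apply, h2]
      exact congrArg _ h3
    rw [AEEqFun.ext_iff]
    exact ⟨fun h' => h'.trans e.symm, fun h' => h'.trans e⟩
  have uS (hu : ∀ t, 0 ≤ t → u t ∈ X G.E) : ∀ t ∈ Ici (0 : ℝ), u t = S (v t) :=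
    fun t ht => (hinv _ (hu t ht)).symm
  have hTv (hu : ∀ t, 0 ≤ t → u t ∈ X G.E) : ∀ t, 0 ≤ t → pd 0 0 (u t) = P.T (v t) :=
    fun t ht => (hGP.left_inv _ (hu t ht)).symm
  have der (hu : ∀ t, 0 ≤ t → u t ∈ X G.E) (hd : DifferentiableOn ℝ v (Ici 0)) (t : ℝ)
      (ht : 0 ≤ t) : derivWithin u (Ici 0) t = S (derivWithin v (Ici 0) t) :=
    (hasDerivWithinAt_clm S (uS hu) hd ht).derivWithin (uniqueDiffOn_Ici 0 t ht)
  constructor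
  · intro h
    have hd : DifferentiableOn ℝ v (Ici 0) := fun t ht =>
      (hasDerivWithinAt_clm (pdL 2 2) (fun _ _ => rfl) h.diff ht).differentiableWithinAt
    refine ⟨h.mem, hd, by rw [← h.init], fun t ht => ?_, fun t ht => ?_, fun t ht => ?_,
      fun t ht => ?_, fun t ht => ?_⟩
    · exact (pw t (h.mem t ht) _ _ (der h.mem hd t ht)).1 (h.state t ht)
    · rw [h.reg t ht, hGP.C _ _ (hTv h.mem t ht), hGP.D]
    · rw [h.obs₁ t ht, hGP.Cq₁ _ _ (hTv h.mem t ht), hGP.Dq₁]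
    · exact (obs (hGP.Cq₂ _ _ (hTv h.mem t ht)) (hGP.Dq₂.2 (w t))).1 (h.obs₂ t ht)
    · exact (obs (hGP.Cq₃ _ _ (hTv h.mem t ht)) (hGP.Dq₃.2 (w t))).1 (h.obs₃ t ht)
  · rintro ⟨hu, h⟩
    have hd := h.diff
    refine ⟨fun t ht => (hasDerivWithinAt_clm S (uS hu) hd ht).differentiableWithinAt, ?_, hu,
      fun t ht => ?_, fun t ht => ?_, fun t ht => ?_, fun t ht => ?_, fun t ht => ?_⟩
    · rw [uS hu 0 self_mem_Ici, ← hinv u₀ hu₀]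
      exact congrArg S h.init
    · exact (pw t (hu t ht) _ _ (der hu hd t ht)).2 (h.state t ht)
    · rw [← hGP.C _ _ (hTv hu t ht), ← hGP.D]
      exact h.reg t ht
    · rw [← hGP.Cq₁ _ _ (hTv hu t ht), ← hGP.Dq₁]
      exact h.obs₁ t ht
    · exact (obs (hGP.Cq₂ _ _ (hTv hu t ht)) (hGP.Dq₂.2 (w t))).2 (h.obs₂ t ht)
    · exact (obs (hGP.Cq₃ _ _ (hTv hu t ht)) (hGP.Dq₃.2 (w t))).2 (h.obs₃ t ht)

end PIE2D

end

theorem mainTheorem3 {nu nw nz m₁ m₂ m₃ : ℕ} (G : PIE2D.PDESystem nu nw nz m₁ m₂ m₃)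
    (hE : PIE2D.WellPosedBC G.E) :
    ∃ P : PIE2D.PIESystem nu nw nz m₁ m₂ m₃,
      PIE2D.IsAssociated G P ∧ P.IsPI ∧
      ∀ (w : ℝ → PIE2D.Vec nw) (u₀ : PIE2D.W2 nu), u₀ ∈ PIE2D.X G.E →
      ∀ (u : ℝ → PIE2D.W2 nu) (z : ℝ → PIE2D.Vec nz) (q₁ : ℝ → PIE2D.Vec m₁)
        (q₂ : ℝ → PIE2D.L2I m₂) (q₃ : ℝ → PIE2D.L2I m₃),
        PIE2D.IsPDESolution G w u₀ u z q₁ q₂ q₃ ↔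
          (∀ t, 0 ≤ t → u t ∈ PIE2D.X G.E) ∧
          PIE2D.IsPIESolution P w (PIE2D.pd 2 2 u₀) (fun t => PIE2D.pd 2 2 (u t)) z q₁ q₂ q₃ := by
  obtain ⟨S, hS, h22, hinv, hw, hY, hX⟩ := hE.exists_inverse
  obtain ⟨P, hGP, hPI, hT⟩ := PIE2D.exists_pieSystem G hS h22 hinv hw hY hX
  exact ⟨P, hGP, hPI, fun w u₀ hu₀ u z q₁ q₂ q₃ => PIE2D.isPDESolution_iff hGP hinv hT hu₀⟩
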